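/- Let $B\subset\mathbb{R}^2$ be a bounded domain with $\overline B\subset\{x_2>0\}$ and smooth boundary $S$, let $\Omega=\{x_2>0\}\setminus\overline B$, $\Gamma=\{x_2=0\}$, let $n=(n_1,n_2)$ be the unit normal on $S\cup\Gamma$ external to $\Omega$, and let $\partial_\sigma$ be the derivative with respect to arc length on $S$. Assume $B\subset\{|x_1|<L,\ h<x_2<H\}$ with $L,h,H>0$, that the modulus of the curvature of $S$ is at most $\kappa$, and that for some $\varepsilon\in(0,h]$ $$\text{(Condition 1)}\quad x_1n_1\le 0,\qquad \text{(Condition 2)}\quad x_1\bigl(x_1^2-(x_2-\varepsilon)^2\bigr)n_1+2x_1^2(x_2-\varepsilon)n_2\ge 0\qquad (x\in S).$$ Let $\nu>0$ and $$\gamma_0^2=\frac{\nu^2}{L^2\nu^2+1+\nu^2x_1^2+\nu^2x_2^2},\qquad \gamma_1^2=\frac{1}{L+\nu^{-1}+H},\qquad \gamma_2^2=\frac{\nu}{1+\nu^2x_1^2}.$$ With $\|\cdot\|_\Xi$ the norm of $L_2(\Xi)$, put $$|||v|||'^2=\|\gamma_0v\|_\Omega^2+\|\nabla v\|_\Omega^2+\|\gamma_1v\|_S^2+\nu\|v\|_\Gamma^2,$$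 $$|||(f,g_1,g_2)|||^2=\|\gamma_0^{-1}f\|_\Omega^2+\|\gamma_1^{-1}g_1\|_S^2+\|\gamma_1^{-1}x_1\partial_\sigma g_1\|_S^2+\|\gamma_2^{-1}g_2\|_\Gamma^2+\nu^{-1}\|x_1\partial_{x_1}g_2\|_\Gamma^2 .$$ Let $\chi\in C^\infty(\mathbb{R})$ be real with $\chi(t)=0$ for $t<1$ and $\chi(t)=1$ for $t>3$, let $$U^{\pm}(x)=\chi(\pm\gamma_1^2x_1)\,e^{\mp i\nu x_1-\nu x_2},$$ and let $d^\pm\in\mathbb{C}$, $f\in C_0^\infty(\Omega)$, $g_1\in C^\infty(S)$, $g_2\in C_0^\infty(\Gamma)$ (complex-valued). Put $f_1=f+\Delta(d^+U^++d^-U^-)$ and $F_1=(f_1,g_1,g_2)$. Let $v$ be a complex-valued function, smooth on $\overline\Omega$, with $$-\Delta v=f_1\ \text{in }\Omega,\qquad \partial_nv=g_1\ \text{on }S,\qquad \partial_nv-\nu v=g_2\ \text{on }\Gamma,\qquad \nabla v\in L_2(\Omega),\quad v|_\Gamma\in L_2(\Gamma).$$ Then $|||v|||'$ and $|||F_1|||$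 are finite and $$\|\partial_{x_1}v\|_\Omega^2\le C_5\,|||v|||'\,|||F_1|||+C_6\,|||F_1|||^2,$$ where, with $C_3=3+2(\kappa L+10)$ and $C_4=\sqrt2+\kappa L$, the constants $C_5,C_6$ depend only on $\kappa,L,h,H,\varepsilon$ and satisfy $$C_5\le C_4+\frac{HC_3}{2\varepsilon}\le C_3\frac H\varepsilon,\qquad C_6\le\frac H{2\varepsilon}+\frac12\le\frac H\varepsilon .$$ -/

import Mathlib

open MeasureTheory Filter Topology
open scoped ContDiff

namespace WaterWaves

noncomputable section

/-- The first partial derivative of a complex function on the plane. -/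
def partial1 (v : ℝ × ℝ → ℂ) (x : ℝ × ℝ) : ℂ := fderiv ℝ v x (1, 0)

/-- The second partial derivative of a complex function on the plane. -/
def partial2 (v : ℝ × ℝ → ℂ) (x : ℝ × ℝ) : ℂ := fderiv ℝ v x (0, 1)

/-- The Laplacian on the plane. -/
def laplacian (v : ℝ × ℝ → ℂ) (x : ℝ × ℝ) : ℂ :=
  partial1 (partial1 v) x + partial2 (partial2 v) x

/-- `|∇v|²`. -/
def gradSq (v : ℝ × ℝ → ℂ) (x : ℝ × ℝ) : ℝ := ‖partial1 v x‖ ^ 2 + ‖partial2 v x‖ ^ 2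

/-- A submerged body: a bounded domain whose closure lies in the open half-plane `x₂ > 0`
(the `x₂`-axis points into the water). -/
structure IsSubmergedBody (B : Set (ℝ × ℝ)) : Prop where
  isOpen : IsOpen B
  isConnected : IsConnected B
  isBounded : Bornology.IsBounded B
  closure_subset : closure B ⊆ {x | 0 < x.2}

/-- The water domain `Ω`: the part of the half-plane outside the closed body. -/
def water (B : Set (ℝ × ℝ)) : Set (ℝ × ℝ) := {x | 0 < x.2} \ closure B

/-- Smoothness of the boundary `S` of the planar open set `B`: `S` is a disjoint union of finitely
many simple closed `C^∞` curves, given here by their arc-length parametrizations. The curves are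
oriented so that `B` lies on their left, and `B` lies locally on one side of `S` only. -/
structure SmoothBoundary (B : Set (ℝ × ℝ)) where
  /-- the number of components of `S` -/
  m : ℕ
  /-- the lengths of the components -/
  len : Fin m → ℝ
  /-- the arc-length parametrizations, extended periodically to the line -/
  curve : Fin m → ℝ → ℝ × ℝ
  len_pos : ∀ i, 0 < len i
  smooth : ∀ i, ContDiff ℝ ∞ (curve i)
  periodic : ∀ i, Function.Periodic (curve i) (len i)
  unit_speed : ∀ i s, (deriv (curve i) s).1 ^ 2 + (deriv (curve i) s).2 ^ 2 = 1
  simple : ∀ i j s t, s ∈ Set.Ico 0 (len i) → t ∈ Set.Ico 0 (len j) →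
    curve i s = curve j t → i = j ∧ s = t
  range_eq : (⋃ i, Set.range (curve i)) = frontier B
  one_sided : ∀ i s, ∀ᶠ t in 𝓝[>] (0 : ℝ),
    curve i s + t • (-(deriv (curve i) s).2, (deriv (curve i) s).1) ∈ B ∧
    curve i s - t • (-(deriv (curve i) s).2, (deriv (curve i) s).1) ∉ closure B

namespace SmoothBoundary

variable {B : Set (ℝ × ℝ)} (S : SmoothBoundary B)

/-- The unit normal to `S` at `S.curve i s`, external to the water domain, that is, pointing
into `B`. -/
def normal (i : Fin S.m) (s : ℝ) : ℝ × ℝ :=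
  (-(deriv (S.curve i) s).2, (deriv (S.curve i) s).1)

/-- The signed curvature of `S` at `S.curve i s`. -/
def curvature (i : Fin S.m) (s : ℝ) : ℝ :=
  (deriv (S.curve i) s).1 * (deriv (deriv (S.curve i)) s).2
    - (deriv (S.curve i) s).2 * (deriv (deriv (S.curve i)) s).1

/-- The derivative along `S`, with respect to arc length, of a function given on `S`. -/
def tangentialDeriv (g : ℝ × ℝ → ℂ) (i : Fin S.m) (s : ℝ) : ℂ :=
  deriv (fun t => g (S.curve i t)) s

/-- The integral over `S` with respect to arc length of a function of the parameters. -/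
def lineIntegral (φ : Fin S.m → ℝ → ℝ) : ℝ := ∑ i, ∫ s in (0 : ℝ)..(S.len i), φ i s

end SmoothBoundary

/-- The weight `γ₀²`. -/
def weight0Sq (ν L : ℝ) (x : ℝ × ℝ) : ℝ :=
  ν ^ 2 / (L ^ 2 * ν ^ 2 + 1 + ν ^ 2 * x.1 ^ 2 + ν ^ 2 * x.2 ^ 2)

/-- The constant weight `γ₁²`. -/
def weight1Sq (ν L H : ℝ) : ℝ := (L + ν⁻¹ + H)⁻¹

/-- The weight `γ₂²`. -/
def weight2Sq (ν : ℝ) (x₁ : ℝ) : ℝ := ν / (1 + ν ^ 2 * x₁ ^ 2)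

/-- The norm `|||v|||'` of the remainder: its square is
`‖γ₀ v‖²_Ω + ‖∇v‖²_Ω + ‖γ₁ v‖²_S + ν ‖v‖²_Γ`. -/
def solNorm {B : Set (ℝ × ℝ)} (S : SmoothBoundary B) (ν L H : ℝ) (v : ℝ × ℝ → ℂ) : ℝ :=
  Real.sqrt ((∫ x in water B, weight0Sq ν L x * ‖v x‖ ^ 2)
    + (∫ x in water B, gradSq v x)
    + S.lineIntegral (fun i s => weight1Sq ν L H * ‖v (S.curve i s)‖ ^ 2)
    + ν * ∫ t : ℝ, ‖v (t, 0)‖ ^ 2)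

/-- The norm `|||(f, g₁, g₂)|||` of the data: its square is
`‖γ₀⁻¹ f‖²_Ω + ‖γ₁⁻¹ g₁‖²_S + ‖γ₁⁻¹ x₁ ∂_σ g₁‖²_S + ‖γ₂⁻¹ g₂‖²_Γ + ν⁻¹ ‖x₁ ∂_{x₁} g₂‖²_Γ`. -/
def dataNorm {B : Set (ℝ × ℝ)} (S : SmoothBoundary B) (ν L H : ℝ)
    (f g₁ : ℝ × ℝ → ℂ) (g₂ : ℝ → ℂ) : ℝ :=
  Real.sqrt ((∫ x in water B, (weight0Sq ν L x)⁻¹ * ‖f x‖ ^ 2)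
    + S.lineIntegral (fun i s => (weight1Sq ν L H)⁻¹ * ‖g₁ (S.curve i s)‖ ^ 2)
    + S.lineIntegral (fun i s =>
        (weight1Sq ν L H)⁻¹ * ((S.curve i s).1 ^ 2 * ‖S.tangentialDeriv g₁ i s‖ ^ 2))
    + (∫ t : ℝ, (weight2Sq ν t)⁻¹ * ‖g₂ t‖ ^ 2)
    + ν⁻¹ * ∫ t : ℝ, t ^ 2 * ‖deriv g₂ t‖ ^ 2)

/-- A smooth cut-off function on the line. -/
structure IsCutoff (χ : ℝ → ℝ) : Prop where
  smooth : ContDiff ℝ ∞ χ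
  eq_zero : ∀ t, t < 1 → χ t = 0
  eq_one : ∀ t, 3 < t → χ t = 1

/-- The outgoing wave `U⁺` on the right. -/
def wavePlus (χ : ℝ → ℝ) (ν L H : ℝ) (x : ℝ × ℝ) : ℂ :=
  (χ (x.1 * weight1Sq ν L H) : ℂ) * Complex.exp (-Complex.I * ν * x.1 - ν * x.2)

/-- The outgoing wave `U⁻` on the left. -/
def waveMinus (χ : ℝ → ℝ) (ν L H : ℝ) (x : ℝ × ℝ) : ℂ :=
  (χ (-x.1 * weight1Sq ν L H) : ℂ) * Complex.exp (Complex.I * ν * x.1 - ν * x.2)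

/-- The right-hand side `f₁ = f + Δ(d⁺U⁺ + d⁻U⁻)` of the remainder problem. -/
def remainderSource (χ : ℝ → ℝ) (ν L H : ℝ) (dp dm : ℂ) (f : ℝ × ℝ → ℂ) (x : ℝ × ℝ) : ℂ :=
  f x + laplacian (fun y => dp * wavePlus χ ν L H y + dm * waveMinus χ ν L H y) x

/-- `v` is a finite-energy solution, smooth up to the boundary, of
`-Δv = f₁` in `Ω`, `∂_n v = g₁` on `S`, `∂_n v - ν v = g₂` on `Γ = {x₂ = 0}`.
A function is smooth on the closure of `Ω` if it is the restriction of a smooth function on the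
plane; only the values on the closure of `Ω` matter here. On `Γ` the normal external to the water
is `(0, -1)`, so that `∂_n = -∂_{x₂}` there. -/
structure IsFiniteEnergySolution {B : Set (ℝ × ℝ)} (S : SmoothBoundary B) (ν : ℝ)
    (f₁ g₁ : ℝ × ℝ → ℂ) (g₂ : ℝ → ℂ) (v : ℝ × ℝ → ℂ) : Prop where
  smooth : ContDiff ℝ ∞ v
  eq_water : ∀ x ∈ water B, -laplacian v x = f₁ x
  eq_body : ∀ i s, fderiv ℝ v (S.curve i s) (S.normal i s) = g₁ (S.curve i s)
  eq_surface : ∀ t : ℝ, -partial2 v (t, 0) - ν * v (t, 0) = g₂ t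
  grad_sq_integrable : IntegrableOn (gradSq v) (water B)
  trace_sq_integrable : Integrable (fun t : ℝ => ‖v (t, 0)‖ ^ 2)

/-- Condition 1: `x₁ n₁ ≤ 0` on `S`. -/
def Condition1 {B : Set (ℝ × ℝ)} (S : SmoothBoundary B) : Prop :=
  ∀ i s, (S.curve i s).1 * (S.normal i s).1 ≤ 0

/-- Condition 2 with parameter `ε`:
`x₁ (x₁² - (x₂ - ε)²) n₁ + 2 x₁² (x₂ - ε) n₂ ≥ 0` on `S`. -/
def Condition2 {B : Set (ℝ × ℝ)} (S : SmoothBoundary B) (ε : ℝ) : Prop :=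
  ∀ i s, 0 ≤ (S.curve i s).1 * ((S.curve i s).1 ^ 2 - ((S.curve i s).2 - ε) ^ 2)
      * (S.normal i s).1
    + 2 * (S.curve i s).1 ^ 2 * ((S.curve i s).2 - ε) * (S.normal i s).2

/-- `C₃ = 3 + 2(κL + 10)`. -/
def constC3 (κ L : ℝ) : ℝ := 3 + 2 * (κ * L + 10)

/-- `C₄ = √2 + κL`. -/
def constC4 (κ L : ℝ) : ℝ := Real.sqrt 2 + κ * L

end

end WaterWaves

/-! The proof is Rellich's multiplier method with two vector fields. For a real function `u` and a
field `V`, put `M = 2 V·∇u + u`. The divergence of `M ∇u - |∇u|² V` is `M Δu` plus the quadratic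
form `2 DV(∇u,∇u) + (1 - div V)|∇u|²` (`divergence_momentum`). Integrated over the water, this is an
identity between the source, the form and boundary terms (`multiplier_identity`).

On the free surface both fields equal `(x₁, 0)`, and the boundary condition turns the terms with `ν`
into a multiple of `∂₁(x₁u²)`, which integrates to zero; this is the purpose of the summand `u` in
`M`. On `S` the integrand is `V_n(|∂_n u|² - |∂_σ u|²) + 2 V_t ∂_σ u ∂_n u + u ∂_n u`. Integration
by parts along the closed curves moves `∂_σ` from `u` to the data in the mixed term, and its price
is the derivative of `V_t`, where the curvature enters. The only term that the norms do not control
is `-V_n |∂_σ u|²`.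

For `V = (x₁, 0)` the form is `2|∂₁u|²`, the quantity to be estimated, but by Condition 1 the
uncontrolled term `-x₁n₁|∂_σ u|²` is nonnegative, which is the wrong sign. For `V = x₁(x₁² - x₂²,
2x₁x₂)/|x|²` the form is a square, hence nonnegative (`gradForm_one_nonneg`), and Conditions 1 and 2
give `-x₁n₁ ≤ (H/ε) V_n` on `S` (`neg_fieldNormal_zero_le`). So `H/ε` times the second inequality,
added to the first, disposes of `∂_σ u`. The remaining terms are bounded by Young's inequality with
a free parameter `t` (`boundary_le`, `surface_le`, `source_le`), because `|V| = |x₁|` is compensated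
by the weights. Adding real and imaginary parts and minimising over `t` gives the product of the two
norms.

Three points need preparation. The divergence theorem for the water is derived from the one for
rectangles, by normal coordinates along `S` and a partition of unity (`integral_divergence_water`).
The second field is singular at the origin, so the family `field1`, `field2` has, besides the index
`α` (`0` or `1` for the two fields), a regularising term `e` in the denominator that tends to zero.
At infinity a cut-off is used whose gradient decays like the inverse distance; its error terms
vanish in the limit thanks to Hardy's inequality in the vertical direction, which also shows that
the weighted norm of `v` is finite. -/

namespace WaterWaves

/-! ### Normal coordinates along a curve and the divergence in them. -/

/-- A continuous linear form on the plane in coordinates. -/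
lemma clm_apply_coord {E : Type*} [NormedAddCommGroup E] [NormedSpace ℝ E]
    (A : ℝ × ℝ →L[ℝ] E) (a b : ℝ) : A (a, b) = a • A (1, 0) + b • A (0, 1) := by
  rw [← map_smul, ← map_smul, ← map_add]
  simp

/-- The normal coordinates along a plane curve. -/
noncomputable def collar (c : ℝ → ℝ × ℝ) (p : ℝ × ℝ) : ℝ × ℝ :=
  c p.1 + p.2 • (-(deriv c p.1).2, (deriv c p.1).1)

/-- The derivative of the normal coordinates. -/
noncomputable def collarDeriv (c : ℝ → ℝ × ℝ) (p : ℝ × ℝ) : ℝ × ℝ →L[ℝ] ℝ × ℝ :=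
  (Matrix.toLin (.finTwoProd ℝ) (.finTwoProd ℝ)
    !![(deriv c p.1).1 - p.2 * (deriv (deriv c) p.1).2, -(deriv c p.1).2;
      (deriv c p.1).2 + p.2 * (deriv (deriv c) p.1).1, (deriv c p.1).1]).toContinuousLinearMap

lemma collarDeriv_apply (c : ℝ → ℝ × ℝ) (p q : ℝ × ℝ) :
    collarDeriv c p q = (((deriv c p.1).1 - p.2 * (deriv (deriv c) p.1).2) * q.1
        + -(deriv c p.1).2 * q.2,
      ((deriv c p.1).2 + p.2 * (deriv (deriv c) p.1).1) * q.1 + (deriv c p.1).1 * q.2) := by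
  simp [collarDeriv, Matrix.toLin_finTwoProd_apply]

lemma det_collarDeriv (c : ℝ → ℝ × ℝ) (p : ℝ × ℝ) :
    (collarDeriv c p).det =
      ((deriv c p.1).1 - p.2 * (deriv (deriv c) p.1).2) * (deriv c p.1).1
        + (deriv c p.1).2 * ((deriv c p.1).2 + p.2 * (deriv (deriv c) p.1).1) := by
  unfold collarDeriv
  simp only [LinearMap.det_toContinuousLinearMap, LinearMap.det_toLin, Matrix.det_fin_two_of]
  ring

section curve

variable {c : ℝ → ℝ × ℝ}

lemma contDiff_deriv_curve (hc : ContDiff ℝ ∞ c) : ContDiff ℝ ∞ (deriv c) :=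
  (contDiff_infty_iff_deriv.1 hc).2

lemma hasDerivAt_fst_curve {c : ℝ → ℝ × ℝ} (hc : ContDiff ℝ ∞ c) (s : ℝ) :
    HasDerivAt (fun s => (c s).1) (deriv c s).1 s :=
  (ContinuousLinearMap.fst ℝ ℝ ℝ).hasFDerivAt.comp_hasDerivAt s
    (hc.differentiable (by simp) s).hasDerivAt

lemma hasDerivAt_snd_curve {c : ℝ → ℝ × ℝ} (hc : ContDiff ℝ ∞ c) (s : ℝ) :
    HasDerivAt (fun s => (c s).2) (deriv c s).2 s :=
  (ContinuousLinearMap.snd ℝ ℝ ℝ).hasFDerivAt.comp_hasDerivAt s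
    (hc.differentiable (by simp) s).hasDerivAt

lemma hasFDerivAt_collar (hc : ContDiff ℝ ∞ c) (p : ℝ × ℝ) :
    HasFDerivAt (collar c) (collarDeriv c p) p := by
  have hc' := contDiff_deriv_curve hc
  have h1 : HasFDerivAt (fun p : ℝ × ℝ => p.1) (ContinuousLinearMap.fst ℝ ℝ ℝ) p := hasFDerivAt_fst
  have h2 : HasFDerivAt (fun p : ℝ × ℝ => p.2) (ContinuousLinearMap.snd ℝ ℝ ℝ) p := hasFDerivAt_snd
  have hx := (hasDerivAt_fst_curve hc p.1).comp_hasFDerivAt p h1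
  have hy := (hasDerivAt_snd_curve hc p.1).comp_hasFDerivAt p h1
  have hx' := (hasDerivAt_fst_curve hc' p.1).comp_hasFDerivAt p h1
  have hy' := (hasDerivAt_snd_curve hc' p.1).comp_hasFDerivAt p h1
  have key := (hx.sub (h2.mul hy')).prodMk (hy.add (h2.mul hx'))
  have hfun : collar c = fun p : ℝ × ℝ =>
      (((fun s => (c s).1) ∘ fun p : ℝ × ℝ => p.1) p
        - p.2 * ((fun s => (deriv c s).2) ∘ fun p : ℝ × ℝ => p.1) p,
      ((fun s => (c s).2) ∘ fun p : ℝ × ℝ => p.1) p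
        + p.2 * ((fun s => (deriv c s).1) ∘ fun p : ℝ × ℝ => p.1) p) := by
    funext p
    ext <;> simp [collar, sub_eq_add_neg]
  rw [hfun]
  refine key.congr_fderiv (ContinuousLinearMap.ext fun q => ?_)
  rw [collarDeriv_apply]
  ext <;> simp <;> ring

lemma contDiff_collar (hc : ContDiff ℝ ∞ c) : ContDiff ℝ ∞ (collar c) := by
  have hc' := contDiff_deriv_curve hc
  unfold collar
  have h1 : ContDiff ℝ ∞ (fun p : ℝ × ℝ => deriv c p.1) := hc'.comp contDiff_fst
  exact (hc.comp contDiff_fst).add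
    (contDiff_snd.smul ((contDiff_snd.comp h1).neg.prodMk (contDiff_fst.comp h1)))

end curve

/-- The first component of the pull-back of a vector field to normal coordinates. -/
noncomputable def pull1 (c : ℝ → ℝ × ℝ) (F₁ F₂ : ℝ × ℝ → ℝ) (p : ℝ × ℝ) : ℝ :=
  F₁ (collar c p) * (deriv c p.1).1 + F₂ (collar c p) * (deriv c p.1).2

/-- The second component of the pull-back of a vector field to normal coordinates. -/
noncomputable def pull2 (c : ℝ → ℝ × ℝ) (F₁ F₂ : ℝ × ℝ → ℝ) (p : ℝ × ℝ) : ℝ :=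
  -F₁ (collar c p) * ((deriv c p.1).2 + p.2 * (deriv (deriv c) p.1).1)
    + F₂ (collar c p) * ((deriv c p.1).1 - p.2 * (deriv (deriv c) p.1).2)

/-- The divergence of a vector field on the plane. -/
noncomputable def divergence (F₁ F₂ : ℝ × ℝ → ℝ) (x : ℝ × ℝ) : ℝ :=
  fderiv ℝ F₁ x (1, 0) + fderiv ℝ F₂ x (0, 1)

section pull

variable {c : ℝ → ℝ × ℝ} {F₁ F₂ : ℝ × ℝ → ℝ}

lemma contDiff_pull1 (hc : ContDiff ℝ ∞ c) (h₁ : ContDiff ℝ 1 F₁) (h₂ : ContDiff ℝ 1 F₂) :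
    ContDiff ℝ 1 (pull1 c F₁ F₂) := by
  have hc' : ContDiff ℝ 1 (fun p : ℝ × ℝ => deriv c p.1) :=
    ((contDiff_deriv_curve hc).of_le (by simp)).comp contDiff_fst
  have hC : ContDiff ℝ 1 (collar c) := (contDiff_collar hc).of_le (by simp)
  unfold pull1
  exact ((h₁.comp hC).mul (contDiff_fst.comp hc')).add ((h₂.comp hC).mul (contDiff_snd.comp hc'))

lemma contDiff_pull2 (hc : ContDiff ℝ ∞ c) (h₁ : ContDiff ℝ 1 F₁) (h₂ : ContDiff ℝ 1 F₂) :
    ContDiff ℝ 1 (pull2 c F₁ F₂) := by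
  have hc' : ContDiff ℝ 1 (fun p : ℝ × ℝ => deriv c p.1) :=
    ((contDiff_deriv_curve hc).of_le (by simp)).comp contDiff_fst
  have hc'' : ContDiff ℝ 1 (fun p : ℝ × ℝ => deriv (deriv c) p.1) :=
    ((contDiff_deriv_curve (contDiff_deriv_curve hc)).of_le (by simp)).comp contDiff_fst
  have hC : ContDiff ℝ 1 (collar c) := (contDiff_collar hc).of_le (by simp)
  unfold pull2
  exact ((h₁.comp hC).neg.mul ((contDiff_snd.comp hc').add
      (contDiff_snd.mul (contDiff_fst.comp hc'')))).add
    ((h₂.comp hC).mul ((contDiff_fst.comp hc').sub (contDiff_snd.mul (contDiff_snd.comp hc''))))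

/-- The divergence in normal coordinates. -/
lemma divergence_pull (hc : ContDiff ℝ ∞ c) (h₁ : ContDiff ℝ 1 F₁) (h₂ : ContDiff ℝ 1 F₂)
    (p : ℝ × ℝ) :
    divergence (pull1 c F₁ F₂) (pull2 c F₁ F₂) p
      = (collarDeriv c p).det * divergence F₁ F₂ (collar c p) := by
  have hc' := contDiff_deriv_curve hc
  have hc'' := contDiff_deriv_curve hc'
  have q1 : HasFDerivAt (fun p : ℝ × ℝ => p.1) (ContinuousLinearMap.fst ℝ ℝ ℝ) p := hasFDerivAt_fst
  have q2 : HasFDerivAt (fun p : ℝ × ℝ => p.2) (ContinuousLinearMap.snd ℝ ℝ ℝ) p := hasFDerivAt_snd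
  have hx' := (hasDerivAt_fst_curve hc' p.1).comp_hasFDerivAt p q1
  have hy' := (hasDerivAt_snd_curve hc' p.1).comp_hasFDerivAt p q1
  have hx'' := (hasDerivAt_fst_curve hc'' p.1).comp_hasFDerivAt p q1
  have hy'' := (hasDerivAt_snd_curve hc'' p.1).comp_hasFDerivAt p q1
  have hC := hasFDerivAt_collar hc p
  have g1 := ((h₁.differentiable (by simp)) (collar c p)).hasFDerivAt.comp p hC
  have g2 := ((h₂.differentiable (by simp)) (collar c p)).hasFDerivAt.comp p hC
  -- `pull1` and `pull2` are the adjugate of `collarDeriv` applied to the field (the Piola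
  -- transform). The terms with derivatives of the adjugate cancel, and only the factor `det`
  -- remains.
  have e1 : HasFDerivAt (pull1 c F₁ F₂) _ p := (g1.mul hx').add (g2.mul hy')
  have e2 : HasFDerivAt (pull2 c F₁ F₂) _ p :=
    (g1.neg.mul (hy'.add (q2.mul hx''))).add (g2.mul (hx'.sub (q2.mul hy'')))
  unfold divergence
  rw [e1.fderiv, e2.fderiv, det_collarDeriv]
  simp only [Function.comp_apply, add_apply, smul_apply,
    ContinuousLinearMap.comp_apply, neg_apply, sub_apply, Pi.add_apply, Pi.mul_apply, Pi.neg_apply,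
    collarDeriv_apply, ContinuousLinearMap.coe_fst', ContinuousLinearMap.coe_snd', smul_eq_mul]
  rw [clm_apply_coord (fderiv ℝ F₁ (collar c p)), clm_apply_coord (fderiv ℝ F₂ (collar c p)),
    clm_apply_coord (fderiv ℝ F₁ (collar c p)) (_ + -(deriv c p.1).2 * 1),
    clm_apply_coord (fderiv ℝ F₂ (collar c p)) (_ + -(deriv c p.1).2 * 1)]
  simp only [smul_eq_mul]
  ring

end pull

/-- The divergence theorem on a rectangle standing on the line `y = b`, for a field that vanishes
on the other three sides. -/
lemma integral_divergence_rectangle {G₁ G₂ : ℝ × ℝ → ℝ} (h₁ : ContDiff ℝ 1 G₁)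
    (h₂ : ContDiff ℝ 1 G₂) {a₁ a₂ b₁ b₂ : ℝ} (ha : a₁ ≤ a₂) (hb : b₁ ≤ b₂)
    (hl : ∀ y ∈ Set.Icc b₁ b₂, G₁ (a₁, y) = 0) (hr : ∀ y ∈ Set.Icc b₁ b₂, G₁ (a₂, y) = 0)
    (ht : ∀ x ∈ Set.Icc a₁ a₂, G₂ (x, b₂) = 0) :
    ∫ x in Set.Ioo a₁ a₂ ×ˢ Set.Ioo b₁ b₂, divergence G₁ G₂ x
      = -∫ x in a₁..a₂, G₂ (x, b₁) := by
  have hae : (Set.Ioo a₁ a₂ ×ˢ Set.Ioo b₁ b₂ : Set (ℝ × ℝ)) =ᵐ[volume]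
      Set.Icc (a₁, b₁) (a₂, b₂) := by
    rw [← Set.Icc_prod_Icc]
    exact Measure.set_prod_ae_eq Ioo_ae_eq_Icc Ioo_ae_eq_Icc
  have hcont : Continuous (divergence G₁ G₂) := by
    unfold divergence
    exact ((h₁.continuous_fderiv (by simp)).clm_apply continuous_const).add
      ((h₂.continuous_fderiv (by simp)).clm_apply continuous_const)
  rw [setIntegral_congr_set hae]
  have key := integral_divergence_prod_Icc_of_hasFDerivAt_of_le G₁ G₂ (fderiv ℝ G₁) (fderiv ℝ G₂)
    (a₁, b₁) (a₂, b₂) ⟨ha, hb⟩ h₁.continuous.continuousOn h₂.continuous.continuousOn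
    (fun x _ => (h₁.differentiable (by simp) x).hasFDerivAt)
    (fun x _ => (h₂.differentiable (by simp) x).hasFDerivAt)
    (hcont.continuousOn.integrableOn_compact isCompact_Icc)
  refine key.trans ?_
  dsimp only
  have e1 : ∫ x in a₁..a₂, G₂ (x, b₂) = 0 :=
    intervalIntegral.integral_zero_ae (ae_of_all _ fun x hx => by
      rw [Set.uIoc_of_le ha] at hx; exact ht x (Set.Ioc_subset_Icc_self hx))
  have e2 : ∫ y in b₁..b₂, G₁ (a₂, y) = 0 :=
    intervalIntegral.integral_zero_ae (ae_of_all _ fun x hx => by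
      rw [Set.uIoc_of_le hb] at hx; exact hr x (Set.Ioc_subset_Icc_self hx))
  have e3 : ∫ y in b₁..b₂, G₁ (a₁, y) = 0 :=
    intervalIntegral.integral_zero_ae (ae_of_all _ fun x hx => by
      rw [Set.uIoc_of_le hb] at hx; exact hl x (Set.Ioc_subset_Icc_self hx))
  rw [e1, e2, e3]
  ring

lemma fderiv_eq_zero_of_notMem {F : ℝ × ℝ → ℝ} {U : Set (ℝ × ℝ)} (h : tsupport F ⊆ U)
    {x : ℝ × ℝ} (hx : x ∉ U) : fderiv ℝ F x = 0 := by
  by_contra hne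
  exact hx (h (support_fderiv_subset ℝ (Function.mem_support.2 hne)))

lemma eq_zero_of_notMem {F : ℝ × ℝ → ℝ} {U : Set (ℝ × ℝ)} (h : tsupport F ⊆ U)
    {x : ℝ × ℝ} (hx : x ∉ U) : F x = 0 := by
  by_contra hne
  exact hx (h (subset_tsupport F (Function.mem_support.2 hne)))

/-- A set that misses the frontier is covered by the disjoint open sets `B` and `(closure B)ᶜ`, so
connectedness keeps it in one of them. This decides on which side of `S` each half of a collar lies.
-/
lemma frontier_inter_nonempty_of_isPreconnected {s B : Set (ℝ × ℝ)} (hB : IsOpen B)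
    (hs : IsPreconnected s) (h₁ : (s ∩ B).Nonempty) (h₂ : ¬ s ⊆ B) : (s ∩ frontier B).Nonempty := by
  by_contra hne
  have hsub : s ⊆ B ∪ (closure B)ᶜ := by
    intro x hx
    by_contra hcon
    rw [Set.mem_union, not_or, Set.notMem_compl_iff] at hcon
    exact hne ⟨x, hx, hcon.2, by rw [hB.interior_eq]; exact hcon.1⟩
  have h₃ : (s ∩ (closure B)ᶜ).Nonempty := by
    obtain ⟨x, hx, hxB⟩ := Set.not_subset.1 h₂
    exact ⟨x, hx, (hsub hx).resolve_left hxB⟩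
  obtain ⟨x, -, hx, hx'⟩ := hs _ _ hB isClosed_closure.isOpen_compl hsub h₁ h₃
  exact hx' (subset_closure hx)

/-! ### The divergence theorem near a point of the boundary. -/

namespace SmoothBoundary

variable {B : Set (ℝ × ℝ)} (S : SmoothBoundary B)

/-- The flux of a vector field through the boundary, in the direction of the normal. -/
noncomputable def flux (F₁ F₂ : ℝ × ℝ → ℝ) : ℝ :=
  S.lineIntegral fun i s => F₁ (S.curve i s) * (S.normal i s).1
    + F₂ (S.curve i s) * (S.normal i s).2

lemma curve_mem_frontier (i : Fin S.m) (s : ℝ) : S.curve i s ∈ frontier B := by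
  rw [← S.range_eq]
  exact Set.mem_iUnion.2 ⟨i, s, rfl⟩

lemma exists_of_mem_frontier {p : ℝ × ℝ} (hp : p ∈ frontier B) : ∃ i s, S.curve i s = p := by
  rw [← S.range_eq] at hp
  exact Set.mem_iUnion.1 hp

lemma continuous_curve (i : Fin S.m) : Continuous (S.curve i) := (S.smooth i).continuous

lemma continuous_deriv_curve (i : Fin S.m) : Continuous (deriv (S.curve i)) :=
  (contDiff_deriv_curve (S.smooth i)).continuous

lemma periodic_deriv (i : Fin S.m) : Function.Periodic (deriv (S.curve i)) (S.len i) := by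
  intro s
  have h : (fun t => S.curve i (t + S.len i)) = S.curve i := funext (S.periodic i)
  rw [← deriv_comp_add_const (S.curve i) (S.len i) s, h]

lemma continuous_normal (i : Fin S.m) : Continuous (S.normal i) := by
  unfold normal
  have := S.continuous_deriv_curve i
  exact (continuous_snd.comp this).neg.prodMk (continuous_fst.comp this)

lemma periodic_normal (i : Fin S.m) : Function.Periodic (S.normal i) (S.len i) := by
  intro s
  simp [normal, S.periodic_deriv i s]

/-- Two parameters of the same point belong to the same component and differ by periods. -/
lemma curve_eq_curve {i j : Fin S.m} {s t : ℝ} (h : S.curve i s = S.curve j t) :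
    i = j ∧ ∃ n : ℤ, t = s + n * S.len i := by
  have hs := toIcoMod_mem_Ico (S.len_pos i) 0 s
  have ht := toIcoMod_mem_Ico (S.len_pos j) 0 t
  rw [zero_add] at hs ht
  have e1 : S.curve i (toIcoMod (S.len_pos i) 0 s) = S.curve i s := by
    rw [toIcoMod]
    exact (S.periodic i).sub_zsmul_eq _
  have e2 : S.curve j (toIcoMod (S.len_pos j) 0 t) = S.curve j t := by
    rw [toIcoMod]
    exact (S.periodic j).sub_zsmul_eq _
  obtain ⟨hij, hst⟩ := S.simple i j _ _ hs ht (by rw [e1, e2, h])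
  subst hij
  refine ⟨rfl, toIcoDiv (S.len_pos i) 0 t - toIcoDiv (S.len_pos i) 0 s, ?_⟩
  simp only [toIcoMod, zsmul_eq_mul] at hst
  push_cast
  linarith

lemma isCompact_range_curve (i : Fin S.m) : IsCompact (Set.range (S.curve i)) := by
  have h := (S.periodic i).image_Icc (S.len_pos i) 0
  rw [← h]
  exact isCompact_Icc.image (S.continuous_curve i)

/-- Away from a point of a curve, the rest of the boundary is closed. -/
lemma exists_isClosed_rest (i : Fin S.m) (s₀ : ℝ) {b : ℝ} (hb : 0 < b)
    (hbl : 2 * b ≤ S.len i) :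
    ∃ K : Set (ℝ × ℝ), IsClosed K ∧ S.curve i s₀ ∉ K ∧
      ∀ j r, S.curve j r ∉ K → j = i ∧ ∃ n : ℤ, |r + n * S.len i - s₀| < b := by
  -- `K` consists of the other components and of the arc of this one that is left when the
  -- parameters within `b` of `s₀` are removed: finitely many compact sets.
  refine ⟨(⋃ j ∈ {j | j ≠ i}, Set.range (S.curve j)) ∪
    S.curve i '' Set.Icc (s₀ + b) (s₀ - b + S.len i), ?_, ?_, ?_⟩
  · refine IsClosed.union (Set.Finite.isClosed_biUnion (Set.toFinite _) fun j _ =>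
      (S.isCompact_range_curve j).isClosed) ?_
    exact (isCompact_Icc.image (S.continuous_curve i)).isClosed
  · rintro (h | ⟨r, hr, h⟩)
    · obtain ⟨j, hj, r, hr⟩ := Set.mem_iUnion₂.1 h
      exact hj (S.curve_eq_curve hr).1
    · obtain ⟨-, n, hn⟩ := S.curve_eq_curve h
      have hl := S.len_pos i
      rw [hn] at hr
      have h1 : (n : ℝ) < 0 := by
        by_contra hc
        have := mul_nonneg (not_lt.1 hc) hl.le
        linarith [hr.1]
      have h2 : (n : ℝ) ≤ -1 := by
        have : n < 0 := by exact_mod_cast h1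
        exact_mod_cast (by omega : n ≤ -1)
      nlinarith [hr.2]
  · intro j r hK
    have hji : j = i := by
      by_contra hne
      exact hK (Or.inl (Set.mem_iUnion₂.2 ⟨j, hne, r, rfl⟩))
    subst hji
    refine ⟨rfl, -toIcoDiv (S.len_pos j) (s₀ - b) r, ?_⟩
    have hm := toIcoMod_mem_Ico (S.len_pos j) (s₀ - b) r
    have e1 : S.curve j (toIcoMod (S.len_pos j) (s₀ - b) r) = S.curve j r := by
      rw [toIcoMod]
      exact (S.periodic j).sub_zsmul_eq _
    have hlt : toIcoMod (S.len_pos j) (s₀ - b) r < s₀ + b := by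
      by_contra hc
      exact hK (Or.inr ⟨_, ⟨not_lt.1 hc, hm.2.le⟩, e1⟩)
    -- The representative lies in a half-open period starting at `s₀ - b`. Its left end is the same
    -- boundary point as the far end of the closed arc in `K`, hence it is excluded and the bound is
    -- strict.
    by_cases heq : toIcoMod (S.len_pos j) (s₀ - b) r = s₀ - b
    · exact absurd (Or.inr ⟨s₀ - b + S.len j, ⟨by linarith, le_rfl⟩, by rw [S.periodic j, ← heq, e1]⟩) hK
    · have := lt_of_le_of_ne hm.1 (Ne.symm heq)
      simp only [toIcoMod, zsmul_eq_mul] at this hlt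
      rw [abs_lt]
      push_cast
      constructor <;> linarith

lemma collar_zero (i : Fin S.m) (s : ℝ) : collar (S.curve i) (s, 0) = S.curve i s := by
  simp [collar]

lemma det_collarDeriv_zero (i : Fin S.m) (s : ℝ) :
    (collarDeriv (S.curve i) (s, 0)).det = 1 := by
  rw [det_collarDeriv, ← S.unit_speed i s]
  ring

/-- Normal coordinates near a point of the boundary. -/
lemma exists_collar_box (i : Fin S.m) (s₀ : ℝ) :
    ∃ a : ℝ, 0 < a ∧ 2 * a ≤ S.len i ∧
      Set.InjOn (collar (S.curve i)) (Metric.closedBall (s₀, 0) a) ∧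
      IsOpen (collar (S.curve i) '' Metric.ball (s₀, 0) a) ∧
      (∀ p ∈ Metric.closedBall ((s₀, 0) : ℝ × ℝ) a, 0 < (collarDeriv (S.curve i) p).det) ∧
      (∀ j r p, p ∈ Metric.closedBall ((s₀, 0) : ℝ × ℝ) a → S.curve j r = collar (S.curve i) p →
        j = i ∧ p.2 = 0 ∧ ∃ n : ℤ, p.1 = r + n * S.len i) := by
  set Φ := collar (S.curve i) with hΦ
  have hC : ContDiff ℝ ∞ Φ := contDiff_collar (S.smooth i)
  have hdet : (collarDeriv (S.curve i) (s₀, 0)).det ≠ 0 := by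
    rw [S.det_collarDeriv_zero]; exact one_ne_zero
  have hF : HasFDerivAt Φ
      ((collarDeriv (S.curve i) (s₀, 0)).toContinuousLinearEquivOfDetNeZero hdet :
        ℝ × ℝ →L[ℝ] ℝ × ℝ) (s₀, 0) := by
    rw [ContinuousLinearMap.coe_toContinuousLinearEquivOfDetNeZero]
    exact hasFDerivAt_collar (S.smooth i) _
  set e := hC.contDiffAt.toOpenPartialHomeomorph Φ hF (by simp) with he
  have heΦ : (e : ℝ × ℝ → ℝ × ℝ) = Φ :=
    ContDiffAt.toOpenPartialHomeomorph_coe hC.contDiffAt hF (by simp)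
  have hmem : (s₀, (0 : ℝ)) ∈ e.source :=
    ContDiffAt.mem_toOpenPartialHomeomorph_source hC.contDiffAt hF (by simp)
  have hl := S.len_pos i
  obtain ⟨b₀, hb₀, hb₀s⟩ := Metric.nhds_basis_closedBall.mem_iff.1 (e.open_source.mem_nhds hmem)
  set b := min b₀ (S.len i / 2) with hb
  have hbpos : 0 < b := lt_min hb₀ (by linarith)
  have hbl : 2 * b ≤ S.len i := by linarith [min_le_right b₀ (S.len i / 2)]
  have hbs : Metric.closedBall ((s₀, 0) : ℝ × ℝ) b ⊆ e.source :=
    (Metric.closedBall_subset_closedBall (min_le_left _ _)).trans hb₀s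
  obtain ⟨K, hK, hK₀, hKr⟩ := S.exists_isClosed_rest i s₀ hbpos hbl
  have hcont : Continuous fun p => (collarDeriv (S.curve i) p).det := by
    simp only [det_collarDeriv]
    have h1 := (S.continuous_deriv_curve i).comp (continuous_fst (X := ℝ) (Y := ℝ))
    have h2 := (contDiff_deriv_curve (contDiff_deriv_curve (S.smooth i))).continuous.comp
      (continuous_fst (X := ℝ) (Y := ℝ))
    simp only [Function.comp_def] at h1 h2
    fun_prop
  -- The box is shrunk so that its image misses `K`. A boundary point in the image then has a
  -- parameter within `b` of `s₀`, and injectivity on `e.source` puts it on the axis `p.2 = 0`.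
  have hN : (Metric.ball ((s₀, 0) : ℝ × ℝ) b ∩ Φ ⁻¹' Kᶜ ∩
      {p | 0 < (collarDeriv (S.curve i) p).det}) ∈ 𝓝 ((s₀, 0) : ℝ × ℝ) := by
    refine IsOpen.mem_nhds (((Metric.isOpen_ball).inter
      (hK.isOpen_compl.preimage hC.continuous)).inter (isOpen_lt continuous_const hcont)) ?_
    refine ⟨⟨Metric.mem_ball_self hbpos, ?_⟩, ?_⟩
    · rw [Set.mem_preimage, hΦ, S.collar_zero]; exact hK₀
    · rw [Set.mem_ofPred_eq, S.det_collarDeriv_zero]; exact one_pos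
  obtain ⟨a, ha, haN⟩ := Metric.nhds_basis_closedBall.mem_iff.1 hN
  have hab : a < b := by
    have : (s₀ + a, (0 : ℝ)) ∈ Metric.closedBall ((s₀, 0) : ℝ × ℝ) a := by
      simp [Prod.dist_eq, abs_of_pos ha, ha.le]
    have h2 := (haN this).1.1
    simpa [Prod.dist_eq, abs_of_pos ha, hbpos] using h2
  have has : Metric.closedBall ((s₀, 0) : ℝ × ℝ) a ⊆ e.source :=
    (Metric.closedBall_subset_closedBall hab.le).trans hbs
  have hinj : Set.InjOn Φ e.source := heΦ ▸ e.injOn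
  refine ⟨a, ha, by linarith, hinj.mono has, ?_, fun p hp => (haN hp).2, ?_⟩
  · rw [← heΦ]
    exact e.isOpen_image_of_subset_source Metric.isOpen_ball
      (Metric.ball_subset_closedBall.trans has)
  · intro j r p hp hjr
    have hnK : S.curve j r ∉ K := by rw [hjr]; exact (haN hp).1.2
    obtain ⟨hji, n, hn⟩ := hKr j r hnK
    subst hji
    refine ⟨rfl, ?_⟩
    have e1 : Φ (r + n * S.len j, 0) = Φ p := by
      rw [← hjr, hΦ, S.collar_zero]
      have := (S.periodic j).int_mul n r
      simpa using this
    have hsrc : (r + n * S.len j, (0 : ℝ)) ∈ e.source := by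
      apply hbs
      simp only [Metric.mem_closedBall, Prod.dist_eq, Real.dist_eq, sub_self, abs_zero]
      exact max_le hn.le hbpos.le
    have e2 := hinj hsrc (has hp) e1
    rw [← e2]
    exact ⟨rfl, n, rfl⟩

/-- The divergence theorem for the body, for fields supported near a point of the boundary. -/
lemma exists_nhds_integral_divergence (hB : IsOpen B) (i : Fin S.m) (s₀ : ℝ) :
    ∃ U : Set (ℝ × ℝ), IsOpen U ∧ S.curve i s₀ ∈ U ∧
      ∀ F₁ F₂ : ℝ × ℝ → ℝ, ContDiff ℝ 1 F₁ → ContDiff ℝ 1 F₂ →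
        tsupport F₁ ⊆ U → tsupport F₂ ⊆ U →
        ∫ x in B, divergence F₁ F₂ x = -S.flux F₁ F₂ := by
  obtain ⟨a, ha, hal, hinj, hopen, hdet, hS⟩ := S.exists_collar_box i s₀
  set Φ := collar (S.curve i) with hΦ
  have hC : Continuous Φ := (contDiff_collar (S.smooth i)).continuous
  have hball : Metric.ball ((s₀, 0) : ℝ × ℝ) a
      = Set.Ioo (s₀ - a) (s₀ + a) ×ˢ Set.Ioo (-a) a := by
    rw [← ball_prod_same, Real.ball_eq_Ioo, Real.ball_eq_Ioo]
    simp
  have hcball : Metric.closedBall ((s₀, 0) : ℝ × ℝ) a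
      = Set.Icc (s₀ - a) (s₀ + a) ×ˢ Set.Icc (-a) a := by
    rw [← closedBall_prod_same, Real.closedBall_eq_Icc, Real.closedBall_eq_Icc]
    simp
  have hbc := Metric.ball_subset_closedBall (x := ((s₀, 0) : ℝ × ℝ)) (ε := a)
  set R := Set.Ioo (s₀ - a) (s₀ + a) ×ˢ Set.Ioo 0 a with hR
  set R' := Set.Ioo (s₀ - a) (s₀ + a) ×ˢ Set.Ioo (-a) 0 with hR'
  have hRb : R ⊆ Metric.ball ((s₀, 0) : ℝ × ℝ) a := by
    rw [hball]; exact Set.prod_mono le_rfl (Set.Ioo_subset_Ioo_left (by linarith))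
  have hRb' : R' ⊆ Metric.ball ((s₀, 0) : ℝ × ℝ) a := by
    rw [hball]; exact Set.prod_mono le_rfl (Set.Ioo_subset_Ioo_right (by linarith))
  have hfr : ∀ p ∈ Metric.ball ((s₀, 0) : ℝ × ℝ) a, p.2 ≠ 0 → Φ p ∉ frontier B := by
    intro p hp hp2 hmem
    obtain ⟨j, r, hjr⟩ := S.exists_of_mem_frontier hmem
    exact hp2 (hS j r p (hbc hp) hjr).2.1
  have hpre : IsPreconnected (Φ '' R) :=
    (((convex_Ioo _ _).prod (convex_Ioo _ _)).isPreconnected).image _ hC.continuousOn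
  have hpre' : IsPreconnected (Φ '' R') :=
    (((convex_Ioo _ _).prod (convex_Ioo _ _)).isPreconnected).image _ hC.continuousOn
  -- One point on each side of the curve is enough: the two open halves of the collar are connected
  -- and miss the frontier, so the upper one lies in `B` and the lower one outside.
  obtain ⟨t, ht, hta, ht0⟩ : ∃ t, (S.curve i s₀ + t • S.normal i s₀ ∈ B ∧
      S.curve i s₀ - t • S.normal i s₀ ∉ closure B) ∧ t < a ∧ 0 < t :=
    ((S.one_sided i s₀).and ((Filter.Eventually.filter_mono nhdsWithin_le_nhds
      (Iio_mem_nhds ha)).and self_mem_nhdsWithin)).exists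
  have hΦt : ∀ t : ℝ, Φ (s₀, t) = S.curve i s₀ + t • S.normal i s₀ := fun t => rfl
  have hRB : Φ '' R ⊆ B := by
    by_contra hne
    obtain ⟨y, ⟨p, hp, rfl⟩, hy⟩ := frontier_inter_nonempty_of_isPreconnected hB hpre
      ⟨Φ (s₀, t), ⟨(s₀, t), ⟨⟨by simp [ha], by simp [ha]⟩, ht0, hta⟩, rfl⟩, ht.1⟩ hne
    exact hfr p (hRb hp) hp.2.1.ne' hy
  have hRB' : ∀ p ∈ R', Φ p ∉ B := by
    intro q hq hqB
    have hmem : Φ (s₀, -t) ∉ B := by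
      rw [hΦt, neg_smul, ← sub_eq_add_neg]
      exact fun h => ht.2 (subset_closure h)
    obtain ⟨y, ⟨p, hp, rfl⟩, hy⟩ := frontier_inter_nonempty_of_isPreconnected hB hpre'
      ⟨Φ q, ⟨q, hq, rfl⟩, hqB⟩
      fun hsub => hmem (hsub ⟨(s₀, -t), ⟨⟨by simp [ha], by simp [ha]⟩, by simpa using hta,
        by simpa using ht0⟩, rfl⟩)
    exact hfr p (hRb' hp) hp.2.2.ne hy
  set U := Φ '' Metric.ball (s₀, 0) a with hU
  have hUB : U ∩ B = Φ '' R := by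
    apply Set.Subset.antisymm
    · rintro _ ⟨⟨p, hp, rfl⟩, hpB⟩
      have hp' := hp
      rw [hball] at hp'
      rcases lt_trichotomy p.2 0 with h | h | h
      · exact absurd hpB (hRB' p ⟨hp'.1, hp'.2.1, h⟩)
      · have : Φ p = S.curve i p.1 := by
          rw [← S.collar_zero i p.1, ← h]
        have hfm := (S.curve_mem_frontier i p.1).2
        rw [hB.interior_eq, ← this] at hfm
        exact absurd hpB hfm
      · exact ⟨p, ⟨hp'.1, h, hp'.2.2⟩, rfl⟩
    · exact Set.subset_inter (Set.image_mono hRb) hRB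
  refine ⟨U, hopen, ⟨(s₀, 0), Metric.mem_ball_self ha, S.collar_zero i s₀⟩, ?_⟩
  intro F₁ F₂ h₁ h₂ hs₁ hs₂
  have hnU : ∀ p ∈ Metric.closedBall ((s₀, 0) : ℝ × ℝ) a,
      p ∉ Metric.ball ((s₀, 0) : ℝ × ℝ) a → Φ p ∉ U := by
    rintro p hp hpb ⟨q, hq, hqp⟩
    exact hpb (hinj (hbc hq) hp hqp ▸ hq)
  have hz : ∀ p ∈ Metric.closedBall ((s₀, 0) : ℝ × ℝ) a,
      p ∉ Metric.ball ((s₀, 0) : ℝ × ℝ) a → F₁ (Φ p) = 0 ∧ F₂ (Φ p) = 0 := fun p hp hpb =>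
    ⟨eq_zero_of_notMem hs₁ (hnU p hp hpb), eq_zero_of_notMem hs₂ (hnU p hp hpb)⟩
  have hdiv0 : ∀ x ∉ U, divergence F₁ F₂ x = 0 := by
    intro x hx
    simp [divergence, fderiv_eq_zero_of_notMem hs₁ hx, fderiv_eq_zero_of_notMem hs₂ hx]
  have step1 : ∫ x in B, divergence F₁ F₂ x = ∫ x in Φ '' R, divergence F₁ F₂ x := by
    rw [← hUB]
    apply setIntegral_eq_of_subset_of_forall_sdiff_eq_zero hB.measurableSet Set.inter_subset_right
    intro x hx
    exact hdiv0 x fun h => hx.2 ⟨h, hx.1⟩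
  have hRm : MeasurableSet R := measurableSet_Ioo.prod measurableSet_Ioo
  -- The Jacobian of the change of variables is the very factor in `divergence_pull`; it is positive
  -- on the box, so the absolute value disappears.
  have step2 : ∫ x in Φ '' R, divergence F₁ F₂ x
      = ∫ p in R, divergence (pull1 (S.curve i) F₁ F₂) (pull2 (S.curve i) F₁ F₂) p := by
    rw [integral_image_eq_integral_abs_det_fderiv_smul volume hRm
      (fun p _ => (hasFDerivAt_collar (S.smooth i) p).hasFDerivWithinAt)
      (hinj.mono (hRb.trans hbc))]
    refine setIntegral_congr_fun hRm fun p hp => ?_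
    simp only [smul_eq_mul]
    rw [abs_of_pos (hdet p (hbc (hRb hp))), divergence_pull (S.smooth i) h₁ h₂]
  have hp1 : ∀ p ∈ Metric.closedBall ((s₀, 0) : ℝ × ℝ) a,
      p ∉ Metric.ball ((s₀, 0) : ℝ × ℝ) a → pull1 (S.curve i) F₁ F₂ p = 0 := by
    intro p hp hpb
    have h := hz p hp hpb
    rw [hΦ] at h
    rw [pull1, h.1, h.2]; ring
  have hp2 : ∀ p ∈ Metric.closedBall ((s₀, 0) : ℝ × ℝ) a,
      p ∉ Metric.ball ((s₀, 0) : ℝ × ℝ) a → pull2 (S.curve i) F₁ F₂ p = 0 := by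
    intro p hp hpb
    have h := hz p hp hpb
    rw [hΦ] at h
    rw [pull2, h.1, h.2]; ring
  have step3 := integral_divergence_rectangle (contDiff_pull1 (S.smooth i) h₁ h₂)
    (contDiff_pull2 (S.smooth i) h₁ h₂) (a₁ := s₀ - a) (a₂ := s₀ + a) (b₁ := 0) (b₂ := a)
    (by linarith) ha.le
    (fun y hy => hp1 _ (by rw [hcball]; exact ⟨⟨le_rfl, by linarith⟩, by linarith [hy.1], hy.2⟩)
      (by rw [hball]; exact fun h => lt_irrefl _ h.1.1))
    (fun y hy => hp1 _ (by rw [hcball]; exact ⟨⟨by linarith, le_rfl⟩, by linarith [hy.1], hy.2⟩)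
      (by rw [hball]; exact fun h => lt_irrefl _ h.1.2))
    (fun x hx => hp2 _ (by rw [hcball]; exact ⟨hx, by linarith, le_rfl⟩)
      (by rw [hball]; exact fun h => lt_irrefl _ h.2.2))
  rw [step1, step2, hR, step3]
  congr 1
  set φ : ℝ → ℝ := fun s => F₁ (S.curve i s) * (S.normal i s).1
    + F₂ (S.curve i s) * (S.normal i s).2 with hφ
  have hφp : Function.Periodic φ (S.len i) := by
    intro s
    simp only [hφ, S.periodic i s, S.periodic_normal i s]
  have hφc : Continuous φ := by
    have := S.continuous_normal i
    exact ((h₁.continuous.comp (S.continuous_curve i)).mul (continuous_fst.comp this)).add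
      ((h₂.continuous.comp (S.continuous_curve i)).mul (continuous_snd.comp this))
  have hpull : ∀ s, pull2 (S.curve i) F₁ F₂ (s, 0) = φ s := by
    intro s
    simp only [pull2, hφ, normal, S.collar_zero]
    ring
  have hlin : S.flux F₁ F₂ = ∫ s in (0 : ℝ)..(S.len i), φ s := by
    unfold flux lineIntegral
    rw [Finset.sum_eq_single i]
    · intro j _ hji
      refine intervalIntegral.integral_zero_ae (ae_of_all _ fun s _ => ?_)
      have hnot : S.curve j s ∉ U := by
        rintro ⟨p, hp, hps⟩
        exact hji (hS j s p (hbc hp) hps.symm).1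
      dsimp only
      rw [eq_zero_of_notMem hs₁ hnot, eq_zero_of_notMem hs₂ hnot]
      ring
    · simp
  -- In a period starting at `s₀ - a`, a parameter beyond `s₀ + a` cannot be shifted by whole
  -- periods into the box, so the field vanishes there.
  have hrest : ∫ s in (s₀ + a)..(s₀ - a + S.len i), φ s = 0 := by
    refine intervalIntegral.integral_zero_ae (ae_of_all _ fun s hs => ?_)
    rw [Set.uIoc_of_le (by linarith)] at hs
    have hnot : S.curve i s ∉ U := by
      rintro ⟨p, hp, hps⟩
      obtain ⟨-, -, n, hn⟩ := hS i s p (hbc hp) hps.symm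
      rw [hball] at hp
      have h1 := hp.1.1
      have h2 := hp.1.2
      have hl := S.len_pos i
      rw [hn] at h1 h2
      rcases le_or_gt 0 n with h | h
      · have : (0 : ℝ) ≤ n := by exact_mod_cast h
        nlinarith [hs.1]
      · have : (n : ℝ) ≤ -1 := by exact_mod_cast (by omega : n ≤ -1)
        nlinarith [hs.2]
    simp only [hφ]
    rw [eq_zero_of_notMem hs₁ hnot, eq_zero_of_notMem hs₂ hnot]
    ring
  rw [hlin, intervalIntegral.integral_congr fun s _ => hpull s]
  have hshift := hφp.intervalIntegral_add_eq 0 (s₀ - a)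
  rw [zero_add] at hshift
  rw [hshift, ← intervalIntegral.integral_add_adjacent_intervals
    (hφc.intervalIntegrable (s₀ - a) (s₀ + a))
    (hφc.intervalIntegrable (s₀ + a) (s₀ - a + S.len i)), hrest, add_zero]

end SmoothBoundary

/-! ### The divergence theorem for the half-plane, the body and the water. -/

lemma exists_box_of_hasCompactSupport {F : ℝ × ℝ → ℝ} (hF : HasCompactSupport F) :
    ∃ M : ℝ, 0 < M ∧ ∀ x : ℝ × ℝ, x ∈ tsupport F → |x.1| < M ∧ |x.2| < M := by
  obtain ⟨M, hM0, hM⟩ := hF.isCompact.isBounded.exists_pos_norm_lt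
  refine ⟨M, hM0, fun x hx => ?_⟩
  have := hM x hx
  exact ⟨lt_of_le_of_lt (norm_fst_le x) this, lt_of_le_of_lt (norm_snd_le x) this⟩

lemma continuous_divergence {F₁ F₂ : ℝ × ℝ → ℝ} (h₁ : ContDiff ℝ 1 F₁) (h₂ : ContDiff ℝ 1 F₂) :
    Continuous (divergence F₁ F₂) := by
  unfold divergence
  exact ((h₁.continuous_fderiv (by simp)).clm_apply continuous_const).add
    ((h₂.continuous_fderiv (by simp)).clm_apply continuous_const)

lemma divergence_eq_zero_of_notMem {F₁ F₂ : ℝ × ℝ → ℝ} {U : Set (ℝ × ℝ)} (h₁ : tsupport F₁ ⊆ U)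
    (h₂ : tsupport F₂ ⊆ U) {x : ℝ × ℝ} (hx : x ∉ U) : divergence F₁ F₂ x = 0 := by
  simp [divergence, fderiv_eq_zero_of_notMem h₁ hx, fderiv_eq_zero_of_notMem h₂ hx]

lemma integrable_divergence {F₁ F₂ : ℝ × ℝ → ℝ} (h₁ : ContDiff ℝ 1 F₁) (h₂ : ContDiff ℝ 1 F₂)
    (hc₁ : HasCompactSupport F₁) (hc₂ : HasCompactSupport F₂) :
    Integrable (divergence F₁ F₂) := by
  refine (continuous_divergence h₁ h₂).integrable_of_hasCompactSupport ?_
  refine HasCompactSupport.of_support_subset_isCompact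
    (hc₁.isCompact.union hc₂.isCompact) fun x hx => ?_
  by_contra hne
  exact hx (divergence_eq_zero_of_notMem Set.subset_union_left Set.subset_union_right hne)

/-- The divergence theorem for the half-plane above height `b`. -/
lemma integral_divergence_halfPlane {F₁ F₂ : ℝ × ℝ → ℝ} (h₁ : ContDiff ℝ 1 F₁)
    (h₂ : ContDiff ℝ 1 F₂) (hc₁ : HasCompactSupport F₁) (hc₂ : HasCompactSupport F₂) (b : ℝ) :
    ∫ x in {x : ℝ × ℝ | b < x.2}, divergence F₁ F₂ x = -∫ t : ℝ, F₂ (t, b) := by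
  obtain ⟨M₁, hM₁, hb₁⟩ := exists_box_of_hasCompactSupport hc₁
  obtain ⟨M₂, hM₂, hb₂⟩ := exists_box_of_hasCompactSupport hc₂
  set M := max (max M₁ M₂) (|b|) with hM
  have hMM₁ : M₁ ≤ M := (le_max_left _ _).trans (le_max_left _ _)
  have hMM₂ : M₂ ≤ M := (le_max_right _ _).trans (le_max_left _ _)
  have hMb : |b| ≤ M := le_max_right _ _
  set Q : Set (ℝ × ℝ) := {x | |x.1| < M ∧ |x.2| < M} with hQ
  have hs₁ : tsupport F₁ ⊆ Q := fun x hx =>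
    ⟨(hb₁ x hx).1.trans_le hMM₁, (hb₁ x hx).2.trans_le hMM₁⟩
  have hs₂ : tsupport F₂ ⊆ Q := fun x hx =>
    ⟨(hb₂ x hx).1.trans_le hMM₂, (hb₂ x hx).2.trans_le hMM₂⟩
  have hM0 : 0 < M := hM₁.trans_le hMM₁
  have e1 : ∫ x in {x : ℝ × ℝ | b < x.2}, divergence F₁ F₂ x
      = ∫ x in Set.Ioo (-M) M ×ˢ Set.Ioo b M, divergence F₁ F₂ x := by
    refine setIntegral_eq_of_subset_of_forall_sdiff_eq_zero
      (measurableSet_lt measurable_const measurable_snd) (fun x hx => hx.2.1) fun x hx => ?_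
    refine divergence_eq_zero_of_notMem hs₁ hs₂ fun hxQ => hx.2 ?_
    exact ⟨abs_lt.1 hxQ.1, hx.1, (abs_lt.1 hxQ.2).2⟩
  rw [e1, integral_divergence_rectangle h₁ h₂ (by linarith) ((le_abs_self b).trans hMb)]
  · rw [intervalIntegral.integral_of_le (by linarith), setIntegral_eq_integral_of_forall_compl_eq_zero]
    intro t ht
    refine eq_zero_of_notMem hs₂ fun h => ht ?_
    exact Set.Ioo_subset_Ioc_self (abs_lt.1 h.1)
  · exact fun y _ => eq_zero_of_notMem hs₁ fun h => by
      have := (abs_lt.1 h.1).1; simp at this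
  · exact fun y _ => eq_zero_of_notMem hs₁ fun h => by
      have := (abs_lt.1 h.1).2; simp at this
  · exact fun y _ => eq_zero_of_notMem hs₂ fun h => by
      have := (abs_lt.1 h.2).2; simp at this

namespace SmoothBoundary

variable {B : Set (ℝ × ℝ)} (S : SmoothBoundary B)

lemma flux_eq_zero {F₁ F₂ : ℝ × ℝ → ℝ} (h₁ : ∀ x ∈ frontier B, F₁ x = 0)
    (h₂ : ∀ x ∈ frontier B, F₂ x = 0) : S.flux F₁ F₂ = 0 := by
  unfold flux lineIntegral
  refine Finset.sum_eq_zero fun i _ => ?_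
  refine intervalIntegral.integral_zero_ae (ae_of_all _ fun s _ => ?_)
  dsimp only
  rw [h₁ _ (S.curve_mem_frontier i s), h₂ _ (S.curve_mem_frontier i s)]
  ring

lemma flux_sum {ι : Type*} (t : Finset ι) {F₁ F₂ : ι → ℝ × ℝ → ℝ}
    (h₁ : ∀ k, Continuous (F₁ k)) (h₂ : ∀ k, Continuous (F₂ k)) :
    S.flux (fun x => ∑ k ∈ t, F₁ k x) (fun x => ∑ k ∈ t, F₂ k x)
      = ∑ k ∈ t, S.flux (F₁ k) (F₂ k) := by
  unfold flux lineIntegral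
  rw [Finset.sum_comm]
  refine Finset.sum_congr rfl fun i _ => ?_
  rw [← intervalIntegral.integral_finsetSum]
  · refine intervalIntegral.integral_congr fun s _ => ?_
    dsimp only
    rw [Finset.sum_mul, Finset.sum_mul, Finset.sum_add_distrib]
  · intro k _
    refine Continuous.intervalIntegrable ?_ _ _
    have := S.continuous_normal i
    exact (((h₁ k).comp (S.continuous_curve i)).mul (continuous_fst.comp this)).add
      (((h₂ k).comp (S.continuous_curve i)).mul (continuous_snd.comp this))

/-- Every point has a neighbourhood on which the divergence theorem for the body holds. -/
lemma exists_nhds_integral_divergence' (hB : IsOpen B) (p : ℝ × ℝ) :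
    ∃ U : Set (ℝ × ℝ), IsOpen U ∧ p ∈ U ∧
      ∀ F₁ F₂ : ℝ × ℝ → ℝ, ContDiff ℝ 1 F₁ → ContDiff ℝ 1 F₂ → HasCompactSupport F₁ →
        HasCompactSupport F₂ → tsupport F₁ ⊆ U → tsupport F₂ ⊆ U →
        ∫ x in B, divergence F₁ F₂ x = -S.flux F₁ F₂ := by
  by_cases hp : p ∈ frontier B
  · obtain ⟨i, s, rfl⟩ := S.exists_of_mem_frontier hp
    obtain ⟨U, hU, hpU, h⟩ := S.exists_nhds_integral_divergence hB i s
    exact ⟨U, hU, hpU, fun F₁ F₂ h₁ h₂ _ _ => h F₁ F₂ h₁ h₂⟩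
  by_cases hpB : p ∈ B
  · refine ⟨B, hB, hpB, fun F₁ F₂ h₁ h₂ hc₁ hc₂ hs₁ hs₂ => ?_⟩
    have hnot : ∀ x ∈ frontier B, x ∉ B := fun x hx h => hx.2 (by rwa [hB.interior_eq])
    rw [S.flux_eq_zero (fun x hx => eq_zero_of_notMem hs₁ (hnot x hx))
      (fun x hx => eq_zero_of_notMem hs₂ (hnot x hx)), neg_zero]
    obtain ⟨M₁, hM₁, hb₁⟩ := exists_box_of_hasCompactSupport hc₁
    obtain ⟨M₂, hM₂, hb₂⟩ := exists_box_of_hasCompactSupport hc₂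
    -- A half-plane containing both supports: the field vanishes on its edge, so the integral of the
    -- divergence is zero.
    set H : Set (ℝ × ℝ) := {x | -max M₁ M₂ < x.2}
    have hsH₁ : tsupport F₁ ⊆ H := fun x hx => by
      have := (abs_lt.1 (hb₁ x hx).2).1
      exact lt_of_le_of_lt (neg_le_neg (le_max_left _ _)) this
    have hsH₂ : tsupport F₂ ⊆ H := fun x hx => by
      have := (abs_lt.1 (hb₂ x hx).2).1
      exact lt_of_le_of_lt (neg_le_neg (le_max_right _ _)) this
    have e1 : ∫ x in B, divergence F₁ F₂ x = ∫ x, divergence F₁ F₂ x :=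
      setIntegral_eq_integral_of_forall_compl_eq_zero fun x hx =>
        divergence_eq_zero_of_notMem hs₁ hs₂ hx
    have e2 : ∫ x in H, divergence F₁ F₂ x = ∫ x, divergence F₁ F₂ x :=
      setIntegral_eq_integral_of_forall_compl_eq_zero fun x hx =>
        divergence_eq_zero_of_notMem hsH₁ hsH₂ hx
    rw [e1, ← e2, integral_divergence_halfPlane h₁ h₂ hc₁ hc₂]
    have : ∀ t : ℝ, F₂ (t, -max M₁ M₂) = 0 := fun t => 
      eq_zero_of_notMem hsH₂ fun h => lt_irrefl (-max M₁ M₂) h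
    simp [this]
  · have hpc : p ∉ closure B := by
      rw [closure_eq_self_union_frontier]
      exact fun h => h.elim hpB hp
    refine ⟨(closure B)ᶜ, isClosed_closure.isOpen_compl, hpc,
      fun F₁ F₂ h₁ h₂ hc₁ hc₂ hs₁ hs₂ => ?_⟩
    have hnot : ∀ x ∈ frontier B, x ∉ (closure B)ᶜ := fun x hx h => h hx.1
    rw [S.flux_eq_zero (fun x hx => eq_zero_of_notMem hs₁ (hnot x hx))
      (fun x hx => eq_zero_of_notMem hs₂ (hnot x hx)), neg_zero]
    exact setIntegral_eq_zero_of_forall_eq_zero fun x hx =>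
      divergence_eq_zero_of_notMem hs₁ hs₂ fun h => h (subset_closure hx)

/-- The divergence theorem for the body; the normal points into the body. -/
theorem integral_divergence_body (hB : IsOpen B) {F₁ F₂ : ℝ × ℝ → ℝ} (h₁ : ContDiff ℝ 1 F₁)
    (h₂ : ContDiff ℝ 1 F₂) (hc₁ : HasCompactSupport F₁) (hc₂ : HasCompactSupport F₂) :
    ∫ x in B, divergence F₁ F₂ x = -S.flux F₁ F₂ := by
  choose U hUo hpU hU using S.exists_nhds_integral_divergence' hB
  have hK : IsCompact (tsupport F₁ ∪ tsupport F₂) := hc₁.isCompact.union hc₂.isCompact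
  obtain ⟨t, ht⟩ := hK.elim_finite_subcover U hUo fun p _ => Set.mem_iUnion.2 ⟨p, hpU p⟩
  -- Both sides are additive in the field, so it may be cut into pieces supported in the sets `U p`.
  -- The functions sum to one only on the supports of `F₁` and `F₂`, which suffices for the
  -- products.
  obtain ⟨f, hf⟩ := SmoothPartitionOfUnity.exists_isSubordinate (modelWithCornersSelf ℝ (ℝ × ℝ))
    hK.isClosed (fun p : t => U p) (fun p => hUo p) (by
      intro x hx
      obtain ⟨p, hp, hxp⟩ := Set.mem_iUnion₂.1 (ht hx)
      exact Set.mem_iUnion.2 ⟨⟨p, hp⟩, hxp⟩)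
  have hfs : ∀ p, ContDiff ℝ 1 (f p) := fun p =>
    (contMDiff_iff_contDiff.1 (f p).contMDiff).of_le (by simp)
  have hsum : ∀ F : ℝ × ℝ → ℝ, tsupport F ⊆ tsupport F₁ ∪ tsupport F₂ →
      (fun x => ∑ p : t, f p x * F x) = F := by
    intro F hF
    funext x
    rw [← Finset.sum_mul]
    by_cases hx : x ∈ tsupport F
    · have := f.sum_eq_one (hF hx)
      rw [finsum_eq_sum_of_fintype] at this
      rw [this, one_mul]
    · rw [image_eq_zero_of_notMem_tsupport hx, mul_zero]
  have hg : ∀ (F : ℝ × ℝ → ℝ), ContDiff ℝ 1 F → HasCompactSupport F → ∀ p : t,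
      ContDiff ℝ 1 (fun x => f p x * F x) ∧ HasCompactSupport (fun x => f p x * F x) ∧
        tsupport (fun x => f p x * F x) ⊆ U p := by
    intro F hF hc p
    refine ⟨(hfs p).mul hF, hc.mul_left, ?_⟩
    exact (tsupport_mul_subset_left (f := f p) (g := F)).trans (hf p)
  have hs₁ := hsum F₁ Set.subset_union_left
  have hs₂ := hsum F₂ Set.subset_union_right
  have hdiv : divergence F₁ F₂ = fun x => ∑ p : t,
      divergence (fun x => f p x * F₁ x) (fun x => f p x * F₂ x) x := by
    funext x
    refine (congrArg₂ (fun F G => divergence F G x) hs₁ hs₂).symm.trans ?_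
    unfold divergence
    rw [fderiv_fun_sum fun p _ => ((hg F₁ h₁ hc₁ p).1.differentiable (by simp) x),
      fderiv_fun_sum fun p _ => ((hg F₂ h₂ hc₂ p).1.differentiable (by simp) x),
      Finset.sum_add_distrib]
    simp only [FunLike.coe_sum, Finset.sum_apply]
  have hflux : S.flux F₁ F₂ = ∑ p : t,
      S.flux (fun x => f p x * F₁ x) (fun x => f p x * F₂ x) := by
    refine (congrArg₂ (fun F G => S.flux F G) hs₁ hs₂).symm.trans ?_
    exact S.flux_sum _ (fun p => (hg F₁ h₁ hc₁ p).1.continuous)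
      (fun p => (hg F₂ h₂ hc₂ p).1.continuous)
  rw [hdiv, hflux, integral_finsetSum, ← Finset.sum_neg_distrib]
  · refine Finset.sum_congr rfl fun p _ => ?_
    have a₁ := hg F₁ h₁ hc₁ p
    have a₂ := hg F₂ h₂ hc₂ p
    exact hU p _ _ a₁.1 a₂.1 a₁.2.1 a₂.2.1 a₁.2.2 a₂.2.2
  · intro p _
    have a₁ := hg F₁ h₁ hc₁ p
    have a₂ := hg F₂ h₂ hc₂ p
    exact (integrable_divergence a₁.1 a₂.1 a₁.2.1 a₂.2.1).integrableOn

/-- Each component is the image of the null line `ℝ × {0}` under the differentiable map `p ↦ S.curve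
i p.1` of the plane into itself, and such maps preserve null sets. Hence `B` and its closure have
the same integrals. -/
lemma volume_frontier (S : SmoothBoundary B) : volume (frontier B) = 0 := by
  rw [← S.range_eq, measure_iUnion_null_iff]
  intro i
  have h : Set.range (S.curve i)
      = (fun p : ℝ × ℝ => S.curve i p.1) '' (Set.univ ×ˢ {0} : Set (ℝ × ℝ)) := by
    ext x
    simp
  rw [h]
  refine addHaar_image_eq_zero_of_differentiableOn_of_addHaar_eq_zero volume ?_ ?_
  · exact (((S.smooth i).differentiable (by simp)).comp differentiable_fst).differentiableOn
  · rw [Measure.volume_eq_prod, Measure.prod_prod]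
    simp

/-- The divergence theorem for the water domain. -/
theorem integral_divergence_water (hB : IsSubmergedBody B) {F₁ F₂ : ℝ × ℝ → ℝ}
    (h₁ : ContDiff ℝ 1 F₁) (h₂ : ContDiff ℝ 1 F₂) (hc₁ : HasCompactSupport F₁)
    (hc₂ : HasCompactSupport F₂) :
    ∫ x in water B, divergence F₁ F₂ x = S.flux F₁ F₂ - ∫ t : ℝ, F₂ (t, 0) := by
  have hcl : (closure B : Set (ℝ × ℝ)) =ᵐ[volume] B := by
    rw [closure_eq_self_union_frontier]
    exact union_ae_eq_left_of_ae_eq_empty (ae_eq_empty.2 S.volume_frontier)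
  have h := integral_divergence_halfPlane h₁ h₂ hc₁ hc₂ 0
  rw [← integral_inter_add_sdiff (s := {x : ℝ × ℝ | (0 : ℝ) < x.2}) (t := closure B)
    isClosed_closure.measurableSet (integrable_divergence h₁ h₂ hc₁ hc₂).integrableOn,
    Set.inter_eq_self_of_subset_right hB.closure_subset, setIntegral_congr_set hcl,
    S.integral_divergence_body hB.isOpen h₁ h₂ hc₁ hc₂] at h
  unfold water
  linarith

end SmoothBoundary

/-! ### The multiplier fields and the pointwise divergence identity. -/

/-- The first partial derivative of a real function on the plane. -/
noncomputable def dx (u : ℝ × ℝ → ℝ) (x : ℝ × ℝ) : ℝ := fderiv ℝ u x (1, 0)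

/-- The second partial derivative of a real function on the plane. -/
noncomputable def dy (u : ℝ × ℝ → ℝ) (x : ℝ × ℝ) : ℝ := fderiv ℝ u x (0, 1)

/-- The Laplacian of a real function on the plane. -/
noncomputable def lap (u : ℝ × ℝ → ℝ) (x : ℝ × ℝ) : ℝ := dx (dx u) x + dy (dy u) x

/-- The squared length of the gradient of a real function on the plane. -/
noncomputable def grad2 (u : ℝ × ℝ → ℝ) (x : ℝ × ℝ) : ℝ := dx u x ^ 2 + dy u x ^ 2

lemma contDiff_dx {u : ℝ × ℝ → ℝ} (hu : ContDiff ℝ ∞ u) : ContDiff ℝ ∞ (dx u) :=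
  (hu.fderiv_right (m := ∞) (by simp)).clm_apply contDiff_const

lemma contDiff_dy {u : ℝ × ℝ → ℝ} (hu : ContDiff ℝ ∞ u) : ContDiff ℝ ∞ (dy u) :=
  (hu.fderiv_right (m := ∞) (by simp)).clm_apply contDiff_const

lemma continuous_lap {u : ℝ × ℝ → ℝ} (hu : ContDiff ℝ ∞ u) : Continuous (lap u) :=
  (contDiff_dx (contDiff_dx hu)).continuous.add (contDiff_dy (contDiff_dy hu)).continuous

lemma continuous_grad2 {u : ℝ × ℝ → ℝ} (hu : ContDiff ℝ ∞ u) : Continuous (grad2 u) :=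
  ((contDiff_dx hu).continuous.pow 2).add ((contDiff_dy hu).continuous.pow 2)

lemma fderiv_apply_eq (u : ℝ × ℝ → ℝ) (x p : ℝ × ℝ) :
    fderiv ℝ u x p = p.1 * dx u x + p.2 * dy u x := by
  have := clm_apply_coord (fderiv ℝ u x) p.1 p.2
  simpa [dx, dy] using this

lemma dx_dy_comm {u : ℝ × ℝ → ℝ} (hu : ContDiff ℝ ∞ u) (x : ℝ × ℝ) :
    dx (dy u) x = dy (dx u) x := by
  have hd : DifferentiableAt ℝ (fderiv ℝ u) x :=
    (hu.fderiv_right (m := ∞) (by simp)).differentiable (by simp) x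
  have h1 : ∀ p q : ℝ × ℝ, fderiv ℝ (fun y => fderiv ℝ u y p) x q
      = fderiv ℝ (fderiv ℝ u) x q p := by
    intro p q
    rw [fderiv_clm_apply hd (differentiableAt_const p)]
    simp
  have hs : IsSymmSndFDerivAt ℝ u x := hu.contDiffAt.isSymmSndFDerivAt
    (by rw [minSmoothness_of_isRCLikeNormedField]; exact ENat.LEInfty.out)
  unfold dx dy
  rw [h1, h1]
  exact hs _ _

section rules

variable {u v : ℝ × ℝ → ℝ} {x : ℝ × ℝ}

lemma dx_eq {A : ℝ × ℝ →L[ℝ] ℝ} (h : HasFDerivAt u A x) : dx u x = A (1, 0) := by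
  rw [dx, h.fderiv]

lemma dy_eq {A : ℝ × ℝ →L[ℝ] ℝ} (h : HasFDerivAt u A x) : dy u x = A (0, 1) := by
  rw [dy, h.fderiv]

end rules

/-- The first component of the multiplier field of the integral identities. -/
noncomputable def field1 (α e : ℝ) (x : ℝ × ℝ) : ℝ :=
  x.1 - 2 * α * (x.1 * x.2 ^ 2) / (x.1 ^ 2 + x.2 ^ 2 + e)

/-- The second component of the multiplier field of the integral identities. -/
noncomputable def field2 (α e : ℝ) (x : ℝ × ℝ) : ℝ :=
  2 * α * (x.1 ^ 2 * x.2) / (x.1 ^ 2 + x.2 ^ 2 + e)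

/-- The entry `∂₁V₁` of the derivative of the multiplier field. -/
noncomputable def field11 (α e : ℝ) (x : ℝ × ℝ) : ℝ :=
  1 - 2 * α * (x.2 ^ 2 / (x.1 ^ 2 + x.2 ^ 2 + e))
    + 4 * α * (x.1 ^ 2 / (x.1 ^ 2 + x.2 ^ 2 + e) * (x.2 ^ 2 / (x.1 ^ 2 + x.2 ^ 2 + e)))

/-- The entry `∂₂V₁` of the derivative of the multiplier field. -/
noncomputable def field12 (α e : ℝ) (x : ℝ × ℝ) : ℝ :=
  -4 * α * (x.1 * x.2 / (x.1 ^ 2 + x.2 ^ 2 + e))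
    + 4 * α * (x.1 * x.2 / (x.1 ^ 2 + x.2 ^ 2 + e) * (x.2 ^ 2 / (x.1 ^ 2 + x.2 ^ 2 + e)))

/-- The entry `∂₁V₂` of the derivative of the multiplier field. -/
noncomputable def field21 (α e : ℝ) (x : ℝ × ℝ) : ℝ :=
  4 * α * (x.1 * x.2 / (x.1 ^ 2 + x.2 ^ 2 + e))
    - 4 * α * (x.1 * x.2 / (x.1 ^ 2 + x.2 ^ 2 + e) * (x.1 ^ 2 / (x.1 ^ 2 + x.2 ^ 2 + e)))

/-- The entry `∂₂V₂` of the derivative of the multiplier field. -/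
noncomputable def field22 (α e : ℝ) (x : ℝ × ℝ) : ℝ :=
  2 * α * (x.1 ^ 2 / (x.1 ^ 2 + x.2 ^ 2 + e))
    - 4 * α * (x.1 ^ 2 / (x.1 ^ 2 + x.2 ^ 2 + e) * (x.2 ^ 2 / (x.1 ^ 2 + x.2 ^ 2 + e)))

lemma hasFDerivAt_field1 (α : ℝ) {e : ℝ} {x : ℝ × ℝ} (h : x.1 ^ 2 + x.2 ^ 2 + e ≠ 0) :
    HasFDerivAt (field1 α e) (field11 α e x • ContinuousLinearMap.fst ℝ ℝ ℝ
      + field12 α e x • ContinuousLinearMap.snd ℝ ℝ ℝ) x := by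
  have q1 : HasFDerivAt (fun p : ℝ × ℝ => p.1) (ContinuousLinearMap.fst ℝ ℝ ℝ) x := hasFDerivAt_fst
  have q2 : HasFDerivAt (fun p : ℝ × ℝ => p.2) (ContinuousLinearMap.snd ℝ ℝ ℝ) x := hasFDerivAt_snd
  have hD : HasFDerivAt (fun p : ℝ × ℝ => p.1 ^ 2 + p.2 ^ 2 + e) _ x :=
    ((q1.pow 2).add (q2.pow 2)).add_const e
  have hN : HasFDerivAt (fun p : ℝ × ℝ => 2 * α * (p.1 * p.2 ^ 2)) _ x :=
    (q1.mul (q2.pow 2)).const_mul (2 * α)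
  have hI : HasFDerivAt (fun p : ℝ × ℝ => (p.1 ^ 2 + p.2 ^ 2 + e)⁻¹) _ x :=
    (hasDerivAt_inv h).comp_hasFDerivAt x hD
  have key : HasFDerivAt (field1 α e) _ x := q1.sub (hN.mul hI)
  refine key.congr_fderiv (ContinuousLinearMap.ext fun q => ?_)
  simp only [field11, field12, add_apply, sub_apply, smul_apply, ContinuousLinearMap.coe_fst',
    ContinuousLinearMap.coe_snd', smul_eq_mul, nsmul_eq_mul]
  field_simp
  push_cast
  ring

lemma hasFDerivAt_field2 (α : ℝ) {e : ℝ} {x : ℝ × ℝ} (h : x.1 ^ 2 + x.2 ^ 2 + e ≠ 0) :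
    HasFDerivAt (field2 α e) (field21 α e x • ContinuousLinearMap.fst ℝ ℝ ℝ
      + field22 α e x • ContinuousLinearMap.snd ℝ ℝ ℝ) x := by
  have q1 : HasFDerivAt (fun p : ℝ × ℝ => p.1) (ContinuousLinearMap.fst ℝ ℝ ℝ) x := hasFDerivAt_fst
  have q2 : HasFDerivAt (fun p : ℝ × ℝ => p.2) (ContinuousLinearMap.snd ℝ ℝ ℝ) x := hasFDerivAt_snd
  have hD : HasFDerivAt (fun p : ℝ × ℝ => p.1 ^ 2 + p.2 ^ 2 + e) _ x :=
    ((q1.pow 2).add (q2.pow 2)).add_const e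
  have hN : HasFDerivAt (fun p : ℝ × ℝ => 2 * α * (p.1 ^ 2 * p.2)) _ x :=
    ((q1.pow 2).mul q2).const_mul (2 * α)
  have hI : HasFDerivAt (fun p : ℝ × ℝ => (p.1 ^ 2 + p.2 ^ 2 + e)⁻¹) _ x :=
    (hasDerivAt_inv h).comp_hasFDerivAt x hD
  have key : HasFDerivAt (field2 α e) _ x := hN.mul hI
  refine key.congr_fderiv (ContinuousLinearMap.ext fun q => ?_)
  simp only [field21, field22, add_apply, smul_apply, ContinuousLinearMap.coe_fst',
    ContinuousLinearMap.coe_snd', smul_eq_mul, nsmul_eq_mul]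
  field_simp
  push_cast
  ring

lemma denom_ne_zero {e : ℝ} (he : 0 < e) (x : ℝ × ℝ) : x.1 ^ 2 + x.2 ^ 2 + e ≠ 0 := by positivity

lemma contDiff_field1 (α : ℝ) {e : ℝ} (he : 0 < e) : ContDiff ℝ ∞ (field1 α e) :=
  contDiff_fst.sub ((contDiff_const.mul (contDiff_fst.mul (contDiff_snd.pow 2))).div
    (((contDiff_fst.pow 2).add (contDiff_snd.pow 2)).add contDiff_const) (denom_ne_zero he))

lemma contDiff_field2 (α : ℝ) {e : ℝ} (he : 0 < e) : ContDiff ℝ ∞ (field2 α e) :=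
  (contDiff_const.mul ((contDiff_fst.pow 2).mul contDiff_snd)).div
    (((contDiff_fst.pow 2).add (contDiff_snd.pow 2)).add contDiff_const) (denom_ne_zero he)

/-- The multiplier `V·∇u + u/2`, doubled. -/
noncomputable def multiplier (α e : ℝ) (u : ℝ × ℝ → ℝ) (x : ℝ × ℝ) : ℝ :=
  2 * (field1 α e x * dx u x + field2 α e x * dy u x) + u x

/-- The quadratic form in the gradient produced by the multiplier field. -/
noncomputable def gradForm (α e : ℝ) (u : ℝ × ℝ → ℝ) (x : ℝ × ℝ) : ℝ :=
  2 * (field11 α e x * dx u x ^ 2 + (field12 α e x + field21 α e x) * (dx u x * dy u x)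
    + field22 α e x * dy u x ^ 2) + (1 - field11 α e x - field22 α e x) * grad2 u x

/-- The terms in which the cut-off function is differentiated. -/
noncomputable def cutoffForm (α e : ℝ) (φ u : ℝ × ℝ → ℝ) (x : ℝ × ℝ) : ℝ :=
  2 * (dx φ x * dx u x + dy φ x * dy u x) * (field1 α e x * dx u x + field2 α e x * dy u x)
    - (dx φ x * field1 α e x + dy φ x * field2 α e x) * grad2 u x
    + u x * (dx φ x * dx u x + dy φ x * dy u x)

/-- The first component of the field to which the divergence theorem is applied. -/
noncomputable def momentum1 (α e : ℝ) (φ u : ℝ × ℝ → ℝ) (x : ℝ × ℝ) : ℝ :=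
  φ x * (multiplier α e u x * dx u x - grad2 u x * field1 α e x)

/-- The second component of the field to which the divergence theorem is applied. -/
noncomputable def momentum2 (α e : ℝ) (φ u : ℝ × ℝ → ℝ) (x : ℝ × ℝ) : ℝ :=
  φ x * (multiplier α e u x * dy u x - grad2 u x * field2 α e x)

/-- The second derivatives of `u` that come from `∇(2 V·∇u)·∇u` cancel those from `V·∇|∇u|²`,
because the Hessian is symmetric. The summand `u` of the multiplier contributes `|∇u|²`, which is
the `1` in `1 - div V`. -/
lemma divergence_momentum (α : ℝ) {e : ℝ} (he : 0 < e) {φ u : ℝ × ℝ → ℝ} (hφ : ContDiff ℝ ∞ φ)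
    (hu : ContDiff ℝ ∞ u) (x : ℝ × ℝ) :
    divergence (momentum1 α e φ u) (momentum2 α e φ u) x
      = φ x * (multiplier α e u x * lap u x) + φ x * gradForm α e u x + cutoffForm α e φ u x := by
  have w1 := hasFDerivAt_field1 α (denom_ne_zero he x)
  have w2 := hasFDerivAt_field2 α (denom_ne_zero he x)
  have f0 := (hφ.differentiable (by simp) x).hasFDerivAt
  have u0 := (hu.differentiable (by simp) x).hasFDerivAt
  have u1 := ((contDiff_dx hu).differentiable (by simp) x).hasFDerivAt
  have u2 := ((contDiff_dy hu).differentiable (by simp) x).hasFDerivAt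
  have hm : HasFDerivAt (multiplier α e u) _ x :=
    (((w1.mul u1).add (w2.mul u2)).const_mul 2).add u0
  have hg : HasFDerivAt (grad2 u) _ x := (u1.pow 2).add (u2.pow 2)
  have h1 : HasFDerivAt (momentum1 α e φ u) _ x := f0.mul ((hm.mul u1).sub (hg.mul w1))
  have h2 : HasFDerivAt (momentum2 α e φ u) _ x := f0.mul ((hm.mul u2).sub (hg.mul w2))
  have hc : fderiv ℝ (dy u) x (1, 0) = fderiv ℝ (dx u) x (0, 1) := dx_dy_comm hu x
  have e1 : fderiv ℝ φ x (1, 0) = dx φ x := rfl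
  have e2 : fderiv ℝ φ x (0, 1) = dy φ x := rfl
  have e3 : fderiv ℝ u x (1, 0) = dx u x := rfl
  have e4 : fderiv ℝ u x (0, 1) = dy u x := rfl
  have e5 : lap u x = fderiv ℝ (dx u) x (1, 0) + fderiv ℝ (dy u) x (0, 1) := rfl
  rw [divergence, h1.fderiv, h2.fderiv, e5]
  simp only [add_apply, sub_apply, smul_apply, ContinuousLinearMap.coe_fst',
    ContinuousLinearMap.coe_snd', smul_eq_mul, nsmul_eq_mul, hc, e1, e2, e3, e4]
  simp only [multiplier, gradForm, cutoffForm, grad2]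
  push_cast
  ring

/-! ### Pointwise bounds for the multiplier fields. -/

section fieldBounds

variable {α e : ℝ} {x : ℝ × ℝ}

lemma ratio_bounds (he : 0 ≤ e) (x : ℝ × ℝ) :
    (0 ≤ x.1 ^ 2 / (x.1 ^ 2 + x.2 ^ 2 + e) ∧ x.1 ^ 2 / (x.1 ^ 2 + x.2 ^ 2 + e) ≤ 1) ∧
    (0 ≤ x.2 ^ 2 / (x.1 ^ 2 + x.2 ^ 2 + e) ∧ x.2 ^ 2 / (x.1 ^ 2 + x.2 ^ 2 + e) ≤ 1) ∧
    |x.1 * x.2 / (x.1 ^ 2 + x.2 ^ 2 + e)| ≤ 1 := by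
  have hD : 0 ≤ x.1 ^ 2 + x.2 ^ 2 + e := by positivity
  refine ⟨⟨by positivity, div_le_one_of_le₀ (by nlinarith [sq_nonneg x.2]) hD⟩,
    ⟨by positivity, div_le_one_of_le₀ (by nlinarith [sq_nonneg x.1]) hD⟩, ?_⟩
  rw [abs_div, abs_of_nonneg hD]
  refine div_le_one_of_le₀ ?_ hD
  rw [abs_le]
  constructor <;> nlinarith [sq_nonneg (x.1 + x.2), sq_nonneg (x.1 - x.2)]

/-- The factor of `x.1` is `1 - 2αq` with `0 ≤ q ≤ 1`. Growth no faster than `|x.1|`, uniformly in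
`e`, is what gradients of cut-off functions of inverse-distance size can compensate. -/
lemma abs_field1_le (hα₀ : 0 ≤ α) (hα₁ : α ≤ 1) (he : 0 ≤ e) (x : ℝ × ℝ) :
    |field1 α e x| ≤ |x.1| := by
  obtain ⟨-, ⟨h0, h1⟩, -⟩ := ratio_bounds he x
  have : field1 α e x = x.1 * (1 - 2 * α * (x.2 ^ 2 / (x.1 ^ 2 + x.2 ^ 2 + e))) := by
    unfold field1; ring
  rw [this, abs_mul]
  refine mul_le_of_le_one_right (abs_nonneg _) (abs_le.2 ⟨?_, ?_⟩) <;> nlinarith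

lemma abs_field2_le (hα₀ : 0 ≤ α) (hα₁ : α ≤ 1) (he : 0 ≤ e) (x : ℝ × ℝ) :
    |field2 α e x| ≤ |x.1| := by
  have hD : 0 ≤ x.1 ^ 2 + x.2 ^ 2 + e := by positivity
  have hr : |2 * (x.1 * x.2 / (x.1 ^ 2 + x.2 ^ 2 + e))| ≤ 1 := by
    rw [mul_div_assoc', abs_div, abs_of_nonneg hD]
    refine div_le_one_of_le₀ ?_ hD
    rw [abs_le]
    constructor <;> nlinarith [sq_nonneg (x.1 + x.2), sq_nonneg (x.1 - x.2)]
  have : field2 α e x = x.1 * (α * (2 * (x.1 * x.2 / (x.1 ^ 2 + x.2 ^ 2 + e)))) := by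
    unfold field2; ring
  rw [this, abs_mul, abs_mul, abs_of_nonneg hα₀]
  exact mul_le_of_le_one_right (abs_nonneg _) (mul_le_one₀ hα₁ (abs_nonneg _) hr)

/-- The entries are polynomials in ratios bounded by one. The crude bound `8` is used only for
integrability and domination and does not reach the constants of the theorem. -/
lemma abs_field_deriv_le (hα₀ : 0 ≤ α) (hα₁ : α ≤ 1) (he : 0 ≤ e) (x : ℝ × ℝ) :
    |field11 α e x| ≤ 8 ∧ |field12 α e x| ≤ 8 ∧ |field21 α e x| ≤ 8 ∧ |field22 α e x| ≤ 8 := by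
  obtain ⟨⟨p0, p1⟩, ⟨q0, q1⟩, hr⟩ := ratio_bounds he x
  unfold field11 field12 field21 field22
  generalize x.1 ^ 2 / (x.1 ^ 2 + x.2 ^ 2 + e) = p at *
  generalize x.2 ^ 2 / (x.1 ^ 2 + x.2 ^ 2 + e) = q at *
  generalize x.1 * x.2 / (x.1 ^ 2 + x.2 ^ 2 + e) = r at *
  have hpq0 := mul_nonneg p0 q0
  have hpq1 : p * q ≤ 1 := mul_le_one₀ p1 q0 q1
  have b1 : 0 ≤ α * p ∧ α * p ≤ 1 := ⟨mul_nonneg hα₀ p0, mul_le_one₀ hα₁ p0 p1⟩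
  have b2 : 0 ≤ α * q ∧ α * q ≤ 1 := ⟨mul_nonneg hα₀ q0, mul_le_one₀ hα₁ q0 q1⟩
  have b3 : 0 ≤ α * (p * q) ∧ α * (p * q) ≤ 1 :=
    ⟨mul_nonneg hα₀ hpq0, mul_le_one₀ hα₁ hpq0 hpq1⟩
  have c1 : |α * r| ≤ 1 := by
    rw [abs_mul, abs_of_nonneg hα₀]; exact mul_le_one₀ hα₁ (abs_nonneg _) hr
  have c2 : |α * (r * q)| ≤ 1 := by
    rw [← mul_assoc, abs_mul, abs_of_nonneg q0]; exact mul_le_one₀ c1 q0 q1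
  have c3 : |α * (r * p)| ≤ 1 := by
    rw [← mul_assoc, abs_mul, abs_of_nonneg p0]; exact mul_le_one₀ c1 p0 p1
  rw [abs_le] at c1 c2 c3
  simp only [abs_le]
  refine ⟨⟨?_, ?_⟩, ⟨?_, ?_⟩, ⟨?_, ?_⟩, ⟨?_, ?_⟩⟩ <;> linarith

lemma gradForm_zero (e : ℝ) (u : ℝ × ℝ → ℝ) (x : ℝ × ℝ) : gradForm 0 e u x = 2 * dx u x ^ 2 := by
  simp [gradForm, field11, field12, field21, field22]

lemma field1_zero (e : ℝ) (x : ℝ × ℝ) : field1 0 e x = x.1 := by simp [field1]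

lemma field2_zero (e : ℝ) (x : ℝ × ℝ) : field2 0 e x = 0 := by simp [field2]

/-- The form is twice the square of the component of the gradient perpendicular to the direction
`(x₁² - x₂², 2x₁x₂)/|x|²` of the field. This is the reason for the choice of the second field. -/
lemma gradForm_one_nonneg (u : ℝ × ℝ → ℝ) (hx : x.1 ^ 2 + x.2 ^ 2 ≠ 0) :
    0 ≤ gradForm 1 0 u x := by
  have h : gradForm 1 0 u x = 2 * (2 * (x.1 * x.2 / (x.1 ^ 2 + x.2 ^ 2)) * dx u x
      - (x.1 ^ 2 / (x.1 ^ 2 + x.2 ^ 2) - x.2 ^ 2 / (x.1 ^ 2 + x.2 ^ 2)) * dy u x) ^ 2 := by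
    simp only [gradForm, field11, field12, field21, field22, grad2, add_zero]
    field_simp
    ring
  rw [h]
  positivity

lemma abs_two_mul_le_grad2 (u : ℝ × ℝ → ℝ) (x : ℝ × ℝ) :
    |dx u x * dy u x| ≤ grad2 u x ∧ dx u x ^ 2 ≤ grad2 u x ∧ dy u x ^ 2 ≤ grad2 u x := by
  unfold grad2
  refine ⟨abs_le.2 ⟨?_, ?_⟩, ?_, ?_⟩ <;>
    nlinarith [sq_nonneg (dx u x + dy u x), sq_nonneg (dx u x - dy u x), sq_nonneg (dx u x),
      sq_nonneg (dy u x)]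

lemma grad2_nonneg (u : ℝ × ℝ → ℝ) (x : ℝ × ℝ) : 0 ≤ grad2 u x := by
  unfold grad2; positivity

lemma abs_gradForm_le (hα₀ : 0 ≤ α) (hα₁ : α ≤ 1) (he : 0 ≤ e) (u : ℝ × ℝ → ℝ) (x : ℝ × ℝ) :
    |gradForm α e u x| ≤ 100 * grad2 u x := by
  obtain ⟨h1, h2, h3, h4⟩ := abs_field_deriv_le hα₀ hα₁ he x
  obtain ⟨g1, g2, g3⟩ := abs_two_mul_le_grad2 u x
  have g0 := grad2_nonneg u x
  have t1 : |field11 α e x * dx u x ^ 2| ≤ 8 * grad2 u x := by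
    rw [abs_mul, abs_of_nonneg (sq_nonneg (dx u x))]
    exact mul_le_mul h1 g2 (sq_nonneg _) (by norm_num)
  have t2 : |(field12 α e x + field21 α e x) * (dx u x * dy u x)| ≤ 16 * grad2 u x := by
    rw [abs_mul]
    exact mul_le_mul ((abs_add_le _ _).trans (by linarith)) g1 (abs_nonneg _) (by norm_num)
  have t3 : |field22 α e x * dy u x ^ 2| ≤ 8 * grad2 u x := by
    rw [abs_mul, abs_of_nonneg (sq_nonneg (dy u x))]
    exact mul_le_mul h4 g3 (sq_nonneg _) (by norm_num)
  have t4 : |(1 - field11 α e x - field22 α e x) * grad2 u x| ≤ 17 * grad2 u x := by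
    rw [abs_mul, abs_of_nonneg g0]
    refine mul_le_mul_of_nonneg_right ?_ g0
    rw [abs_le] at h1 h4 ⊢
    constructor <;> linarith
  unfold gradForm
  rw [abs_le] at t1 t2 t3 t4 ⊢
  constructor <;> linarith

lemma grad_abs_le (u : ℝ × ℝ → ℝ) (x : ℝ × ℝ) :
    |dx u x| ≤ Real.sqrt (grad2 u x) ∧ |dy u x| ≤ Real.sqrt (grad2 u x) := by
  constructor <;> refine Real.abs_le_sqrt ?_
  · exact (abs_two_mul_le_grad2 u x).2.1
  · exact (abs_two_mul_le_grad2 u x).2.2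

lemma abs_field_dot_le (hα₀ : 0 ≤ α) (hα₁ : α ≤ 1) (he : 0 ≤ e) (x : ℝ × ℝ) (a b : ℝ) :
    |field1 α e x * a + field2 α e x * b| ≤ |x.1| * (|a| + |b|) := by
  refine (abs_add_le _ _).trans ?_
  rw [abs_mul, abs_mul, mul_add]
  exact add_le_add (mul_le_mul_of_nonneg_right (abs_field1_le hα₀ hα₁ he x) (abs_nonneg _))
    (mul_le_mul_of_nonneg_right (abs_field2_le hα₀ hα₁ he x) (abs_nonneg _))

lemma abs_multiplier_le (hα₀ : 0 ≤ α) (hα₁ : α ≤ 1) (he : 0 ≤ e) (u : ℝ × ℝ → ℝ) (x : ℝ × ℝ) :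
    |multiplier α e u x| ≤ 2 * (|x.1| * (|dx u x| + |dy u x|)) + |u x| := by
  unfold multiplier
  refine (abs_add_le _ _).trans ?_
  rw [abs_mul, abs_two]
  have := abs_field_dot_le hα₀ hα₁ he x (dx u x) (dy u x)
  linarith

/-- In the terms containing the field, its growth `|x.1|` is cancelled by the decay of `∇φ`. In the
term with `u` itself the decay is kept as a factor `(1 + x.2)⁻¹`, so that Hardy's inequality
applies. -/
lemma abs_cutoffForm_le (hα₀ : 0 ≤ α) (hα₁ : α ≤ 1) (he : 0 ≤ e) (φ u : ℝ × ℝ → ℝ) {C : ℝ}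
    {x : ℝ × ℝ} (hx : 0 < x.2) (h₁ : (1 + |x.1| + |x.2|) * |dx φ x| ≤ C)
    (h₂ : (1 + |x.1| + |x.2|) * |dy φ x| ≤ C) :
    |cutoffForm α e φ u x| ≤ 20 * C * (grad2 u x + (1 + x.2)⁻¹ ^ 2 * u x ^ 2) := by
  have hx' : |x.2| = x.2 := abs_of_pos hx
  set m := 1 + |x.1| + |x.2| with hm
  have hm0 : 0 < m := by positivity
  have hC : 0 ≤ C := (by positivity : 0 ≤ m * |dx φ x|).trans h₁
  obtain ⟨ha, hb⟩ := grad_abs_le u x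
  have g0 := grad2_nonneg u x
  have hsq := Real.sq_sqrt g0
  set G := Real.sqrt (grad2 u x) with hG
  have hG0 : 0 ≤ G := Real.sqrt_nonneg _
  have a1 : |x.1| * |dx φ x| ≤ C :=
    (mul_le_mul_of_nonneg_right (by rw [hm]; linarith [abs_nonneg x.2]) (abs_nonneg _)).trans h₁
  have a2 : |x.1| * |dy φ x| ≤ C :=
    (mul_le_mul_of_nonneg_right (by rw [hm]; linarith [abs_nonneg x.2]) (abs_nonneg _)).trans h₂
  have hi : 0 < 1 + x.2 := by linarith
  have b1 : |dx φ x| ≤ C * (1 + x.2)⁻¹ := by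
    rw [← div_eq_mul_inv, le_div_iff₀ hi, mul_comm]
    exact (mul_le_mul_of_nonneg_right (by rw [hm, hx']; linarith [abs_nonneg x.1])
      (abs_nonneg _)).trans h₁
  have b2 : |dy φ x| ≤ C * (1 + x.2)⁻¹ := by
    rw [← div_eq_mul_inv, le_div_iff₀ hi, mul_comm]
    exact (mul_le_mul_of_nonneg_right (by rw [hm, hx']; linarith [abs_nonneg x.1])
      (abs_nonneg _)).trans h₂
  have hdot : |dx φ x * dx u x + dy φ x * dy u x| ≤ (|dx φ x| + |dy φ x|) * G := by
    refine (abs_add_le _ _).trans ?_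
    rw [abs_mul, abs_mul, add_mul]
    exact add_le_add (mul_le_mul_of_nonneg_left ha (abs_nonneg _))
      (mul_le_mul_of_nonneg_left hb (abs_nonneg _))
  have hV : |field1 α e x * dx u x + field2 α e x * dy u x| ≤ |x.1| * (2 * G) :=
    (abs_field_dot_le hα₀ hα₁ he x _ _).trans
      (mul_le_mul_of_nonneg_left (by linarith) (abs_nonneg _))
  have t1 : |2 * (dx φ x * dx u x + dy φ x * dy u x)
      * (field1 α e x * dx u x + field2 α e x * dy u x)| ≤ 8 * C * G ^ 2 := by
    rw [abs_mul, abs_mul, abs_two]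
    calc _ ≤ 2 * ((|dx φ x| + |dy φ x|) * G) * (|x.1| * (2 * G)) := by gcongr
      _ = 4 * (|x.1| * |dx φ x| + |x.1| * |dy φ x|) * G ^ 2 := by ring
      _ ≤ 4 * (C + C) * G ^ 2 := by gcongr
      _ = 8 * C * G ^ 2 := by ring
  have t2 : |(dx φ x * field1 α e x + dy φ x * field2 α e x) * grad2 u x| ≤ 2 * C * G ^ 2 := by
    rw [abs_mul, abs_of_nonneg g0, hsq]
    refine mul_le_mul_of_nonneg_right ?_ g0
    have := abs_field_dot_le hα₀ hα₁ he x (dx φ x) (dy φ x)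
    rw [mul_comm (dx φ x), mul_comm (dy φ x)]
    linarith
  have t3 : |u x * (dx φ x * dx u x + dy φ x * dy u x)|
      ≤ C * (G ^ 2 + (1 + x.2)⁻¹ ^ 2 * u x ^ 2) := by
    rw [abs_mul]
    have hw : 0 ≤ (1 + x.2)⁻¹ * |u x| := by positivity
    calc _ ≤ |u x| * ((C * (1 + x.2)⁻¹ + C * (1 + x.2)⁻¹) * G) :=
          mul_le_mul_of_nonneg_left (hdot.trans (mul_le_mul_of_nonneg_right (by linarith) hG0))
            (abs_nonneg _)
      _ = C * (2 * G * ((1 + x.2)⁻¹ * |u x|)) := by ring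
      _ ≤ C * (G ^ 2 + ((1 + x.2)⁻¹ * |u x|) ^ 2) := by
        gcongr; exact two_mul_le_add_sq _ _
      _ = _ := by rw [mul_pow, sq_abs]
  unfold cutoffForm
  have hw2 : 0 ≤ C * ((1 + x.2)⁻¹ ^ 2 * u x ^ 2) := by positivity
  have hw3 : 0 ≤ C * grad2 u x := by positivity
  rw [hsq] at t1 t2 t3
  rw [abs_le] at t1 t2 t3 ⊢
  constructor <;> linarith

end fieldBounds

/-! ### Cut-off functions and Hardy's inequality. -/

/-- Smooth cut-off functions exhausting the plane, with gradients of the order of the inverse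
distance to the origin. -/
lemma exists_cutoff_sequence : ∃ (φ : ℕ → ℝ × ℝ → ℝ) (C : ℝ), 0 ≤ C ∧
    (∀ n, ContDiff ℝ ∞ (φ n)) ∧ (∀ n, HasCompactSupport (φ n)) ∧
    (∀ n x, 0 ≤ φ n x ∧ φ n x ≤ 1) ∧ (∀ x, ∀ᶠ n in atTop, φ n =ᶠ[𝓝 x] fun _ => 1) ∧
    (∀ n x, (1 + |x.1| + |x.2|) * |dx (φ n) x| ≤ C) ∧
    (∀ n x, (1 + |x.1| + |x.2|) * |dy (φ n) x| ≤ C) := by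
  let ψ : ContDiffBump (0 : ℝ) := ⟨1, 2, one_pos, one_lt_two⟩
  have hψ : ContDiff ℝ ∞ ψ := ψ.contDiff
  have hψc : HasCompactSupport ψ := ψ.hasCompactSupport
  have hψ0 : ∀ t : ℝ, 2 < |t| → ψ t = 0 := fun t ht =>
    ψ.zero_of_le_dist (by simpa [Real.dist_eq] using ht.le)
  have hψ0' : ∀ t : ℝ, 2 < |t| → deriv ψ t = 0 := by
    intro t ht
    have : (ψ : ℝ → ℝ) =ᶠ[𝓝 t] fun _ => 0 := by
      filter_upwards [continuous_abs.isOpen_preimage _ isOpen_Ioi |>.mem_nhds ht] with s hs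
      exact hψ0 s hs
    rw [this.deriv_eq]
    simp
  have hψ1 : ∀ t : ℝ, |t| < 1 → (ψ : ℝ → ℝ) =ᶠ[𝓝 t] fun _ => 1 := by
    intro t ht
    filter_upwards [continuous_abs.isOpen_preimage _ isOpen_Iio |>.mem_nhds ht] with s hs
    exact ψ.one_of_mem_closedBall (by simpa [Real.dist_eq] using (Set.mem_Iio.1 hs).le)
  obtain ⟨C, hC⟩ := (hψ.continuous_deriv (by simp)).bounded_above_of_compact_support hψc.deriv
  have hC0 : 0 ≤ C := (norm_nonneg _).trans (hC 0)
  have hb : ∀ t, 0 ≤ ψ t ∧ ψ t ≤ 1 := fun t => ⟨ψ.nonneg, ψ.le_one⟩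
  set κ : ℕ → ℝ := fun n => ((n : ℝ) + 1)⁻¹ with hκ
  have hκ0 : ∀ n, 0 < κ n := fun n => by positivity
  have hκ1 : ∀ n, κ n ≤ 1 := fun n => inv_le_one_of_one_le₀ (by linarith [n.cast_nonneg (α := ℝ)])
  have hD : ∀ (n : ℕ) (x : ℝ × ℝ), HasFDerivAt (fun x : ℝ × ℝ => ψ (κ n * x.1) * ψ (κ n * x.2))
      (ψ (κ n * x.1) • (deriv ψ (κ n * x.2) • κ n • ContinuousLinearMap.snd ℝ ℝ ℝ)
        + ψ (κ n * x.2) • (deriv ψ (κ n * x.1) • κ n • ContinuousLinearMap.fst ℝ ℝ ℝ)) x := by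
    intro n x
    have d : ∀ t, HasDerivAt ψ (deriv ψ t) t := fun t =>
      (hψ.differentiable (by simp) t).hasDerivAt
    exact ((d _).comp_hasFDerivAt x (hasFDerivAt_fst.const_mul (κ n))).mul
      ((d _).comp_hasFDerivAt x (hasFDerivAt_snd.const_mul (κ n)))
  have hbound : ∀ (n : ℕ) (a b : ℝ),
      (1 + |a| + |b|) * |ψ (κ n * b) * (deriv ψ (κ n * a) * κ n)| ≤ 5 * C := by
    intro n a b
    by_cases ha : 2 < |κ n * a|
    · rw [hψ0' _ ha]; simpa using hC0
    by_cases hbb : 2 < |κ n * b|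
    · rw [hψ0 _ hbb]; simpa using hC0
    rw [not_lt, abs_mul, abs_of_pos (hκ0 n)] at ha hbb
    rw [abs_mul, abs_mul, abs_of_pos (hκ0 n), abs_of_nonneg (hb _).1]
    -- The sum of `κ n ≤ 1` and the two bounds by `2` that hold on the support.
    have h5 : κ n * (1 + |a| + |b|) ≤ 5 := by
      have := hκ1 n
      nlinarith
    have h6 : ψ (κ n * b) * |deriv ψ (κ n * a)| ≤ C :=
      (mul_le_of_le_one_left (abs_nonneg _) (hb _).2).trans (hC _)
    calc _ = κ n * (1 + |a| + |b|) * (ψ (κ n * b) * |deriv ψ (κ n * a)|) := by ring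
      _ ≤ 5 * C := mul_le_mul h5 h6 (mul_nonneg (hb _).1 (abs_nonneg _)) (by norm_num)
  refine ⟨fun n x => ψ (κ n * x.1) * ψ (κ n * x.2), 5 * C, by positivity, fun n => ?_, fun n => ?_,
    fun n x => ⟨mul_nonneg (hb _).1 (hb _).1, mul_le_one₀ (hb _).2 (hb _).1 (hb _).2⟩,
    fun x => ?_, fun n x => ?_, fun n x => ?_⟩
  · exact (hψ.comp (contDiff_const.mul contDiff_fst)).mul
      (hψ.comp (contDiff_const.mul contDiff_snd))
  · refine HasCompactSupport.intro (isCompact_Icc (a := ((-(2 * (κ n)⁻¹), -(2 * (κ n)⁻¹)) : ℝ × ℝ))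
      (b := (2 * (κ n)⁻¹, 2 * (κ n)⁻¹))) fun x hx => ?_
    by_contra hne
    have h1 : |κ n * x.1| ≤ 2 := not_lt.1 fun h => hne (by simp [hψ0 _ h])
    have h2 : |κ n * x.2| ≤ 2 := not_lt.1 fun h => hne (by simp [hψ0 _ h])
    have hk := hκ0 n
    rw [abs_mul, abs_of_pos hk, mul_comm, ← le_div_iff₀ hk, div_eq_mul_inv, abs_le] at h1 h2
    exact hx ⟨⟨h1.1, h2.1⟩, ⟨h1.2, h2.2⟩⟩
  · have hlim : Tendsto κ atTop (𝓝 0) := tendsto_inv_atTop_zero.comp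
      (tendsto_atTop_add_const_right _ _ tendsto_natCast_atTop_atTop)
    have hx : ∀ a : ℝ, ∀ᶠ n in atTop, |κ n * a| < 1 := by
      intro a
      have h := ((hlim.mul_const a).abs)
      rw [zero_mul, abs_zero] at h
      exact h.eventually_lt_const one_pos
    filter_upwards [hx x.1, hx x.2] with n h1 h2
    have c1 : ContinuousAt (fun x : ℝ × ℝ => κ n * x.1) x := by fun_prop
    have c2 : ContinuousAt (fun x : ℝ × ℝ => κ n * x.2) x := by fun_prop
    filter_upwards [c1.eventually (hψ1 _ h1), c2.eventually (hψ1 _ h2)] with y hy1 hy2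
    rw [hy1, hy2, one_mul]
  · rw [dx_eq (hD n x)]
    simpa using hbound n x.1 x.2
  · rw [dy_eq (hD n x)]
    have := hbound n x.2 x.1
    rw [add_right_comm] at this
    simpa using this

section hardy

/-- Integrate the derivative of `-f²/(1+t)`: the end `T` contributes with a favourable sign, and
half of the weighted integral is absorbed when Young's inequality is applied to `2 f f'/(1+t)`. -/
lemma integral_hardy_le {f f' : ℝ → ℝ} (hf : ∀ t, HasDerivAt f (f' t) t) (hf' : Continuous f')
    {T : ℝ} (hT : 0 ≤ T) :
    ∫ t in (0 : ℝ)..T, (1 + t)⁻¹ ^ 2 * f t ^ 2 ≤ 2 * f 0 ^ 2 + 4 * ∫ t in (0 : ℝ)..T, f' t ^ 2 := by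
  have hfc : Continuous f := continuous_iff_continuousAt.2 fun t => (hf t).continuousAt
  have hw : ContinuousOn (fun t : ℝ => (1 + t)⁻¹) (Set.uIcc 0 T) := by
    refine ContinuousOn.inv₀ (by fun_prop) fun t ht => ?_
    rw [Set.uIcc_of_le hT] at ht
    linarith [ht.1]
  have i1 : IntervalIntegrable (fun t => (1 + t)⁻¹ ^ 2 * f t ^ 2) volume 0 T :=
    ((hw.pow 2).mul (hfc.continuousOn.pow 2)).intervalIntegrable
  have i2 : IntervalIntegrable (fun t => 2 * f t * f' t * (1 + t)⁻¹) volume 0 T :=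
    (((continuous_const.mul hfc).mul hf').continuousOn.mul hw).intervalIntegrable
  have i3 : IntervalIntegrable (fun t => f' t ^ 2) volume 0 T :=
    (hf'.pow 2).intervalIntegrable _ _
  have hder : ∀ t ∈ Set.uIcc 0 T, HasDerivAt (fun t => -(f t ^ 2 * (1 + t)⁻¹))
      ((1 + t)⁻¹ ^ 2 * f t ^ 2 - 2 * f t * f' t * (1 + t)⁻¹) t := by
    intro t ht
    rw [Set.uIcc_of_le hT] at ht
    have h0 : (1 + t) ≠ 0 := by linarith [ht.1]
    have hi : HasDerivAt (fun t : ℝ => (1 + t)⁻¹) (-1 / (1 + t) ^ 2) t :=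
      ((hasDerivAt_id t).const_add 1).fun_inv h0
    refine (((hf t).pow 2).mul hi).neg.congr_deriv ?_
    simp only [Pi.pow_apply]
    field_simp
    push_cast
    ring
  have hFTC := intervalIntegral.integral_eq_sub_of_hasDerivAt hder (i1.sub i2)
  rw [intervalIntegral.integral_sub i1 i2] at hFTC
  have hle : ∫ t in (0 : ℝ)..T, 2 * f t * f' t * (1 + t)⁻¹
      ≤ ∫ t in (0 : ℝ)..T, (1 / 2 * ((1 + t)⁻¹ ^ 2 * f t ^ 2) + 2 * f' t ^ 2) := by
    refine intervalIntegral.integral_mono_on hT i2 ((i1.const_mul _).add (i3.const_mul _))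
      fun t _ => ?_
    nlinarith [sq_nonneg ((1 + t)⁻¹ * f t - 2 * f' t)]
  rw [intervalIntegral.integral_add (i1.const_mul _) (i3.const_mul _),
    intervalIntegral.integral_const_mul, intervalIntegral.integral_const_mul] at hle
  have hTn : 0 ≤ f T ^ 2 * (1 + T)⁻¹ := by positivity
  simp only [add_zero, inv_one, mul_one] at hFTC
  linarith

/-- With values in `[0, ∞]` no integrability is needed on an individual vertical line, and the
inequality can be integrated over all of them by Tonelli's theorem. -/
lemma lintegral_hardy_le {f f' : ℝ → ℝ} (hf : ∀ t, HasDerivAt f (f' t) t) (hf' : Continuous f') :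
    ∫⁻ t in Set.Ioi (0 : ℝ), ENNReal.ofReal ((1 + t)⁻¹ ^ 2 * f t ^ 2)
      ≤ ENNReal.ofReal (2 * f 0 ^ 2) + 4 * ∫⁻ t in Set.Ioi (0 : ℝ), ENNReal.ofReal (f' t ^ 2) := by
  have hfc : Continuous f := continuous_iff_continuousAt.2 fun t => (hf t).continuousAt
  have hm : Measurable fun t : ℝ => ENNReal.ofReal ((1 + t)⁻¹ ^ 2 * f t ^ 2) := by
    have := hfc.measurable
    fun_prop
  have hcov := aecover_Iic (μ := volume.restrict (Set.Ioi (0 : ℝ))) (tendsto_id (x := atTop))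
  refine le_of_tendsto (hcov.lintegral_tendsto_of_countably_generated hm.aemeasurable) ?_
  filter_upwards [eventually_ge_atTop (0 : ℝ)] with T hT
  rw [id, Measure.restrict_restrict measurableSet_Iic, Set.inter_comm, Set.Ioi_inter_Iic]
  have hw : ContinuousOn (fun t : ℝ => (1 + t)⁻¹) (Set.Icc 0 T) := by
    refine ContinuousOn.inv₀ (by fun_prop) fun t ht => ?_
    linarith [ht.1]
  have i1 : IntegrableOn (fun t => (1 + t)⁻¹ ^ 2 * f t ^ 2) (Set.Ioc 0 T) :=
    (((hw.pow 2).mul (hfc.continuousOn.pow 2)).integrableOn_Icc).mono_set Set.Ioc_subset_Icc_self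
  have i3 : IntegrableOn (fun t => f' t ^ 2) (Set.Ioc 0 T) :=
    ((hf'.pow 2).continuousOn.integrableOn_Icc).mono_set Set.Ioc_subset_Icc_self
  rw [← ofReal_integral_eq_lintegral_ofReal i1 (ae_of_all _ fun t => by positivity)]
  have h := integral_hardy_le hf hf' hT
  rw [intervalIntegral.integral_of_le hT, intervalIntegral.integral_of_le hT] at h
  refine (ENNReal.ofReal_le_ofReal h).trans ?_
  rw [ENNReal.ofReal_add (by positivity)
    (mul_nonneg (by norm_num) (integral_nonneg fun t => sq_nonneg _)),
    ENNReal.ofReal_mul (p := 4) (by norm_num),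
    ofReal_integral_eq_lintegral_ofReal i3 (ae_of_all _ fun t => sq_nonneg _)]
  refine add_le_add le_rfl ?_
  rw [show ENNReal.ofReal 4 = 4 by norm_num]
  exact mul_le_mul' le_rfl (lintegral_mono_set Set.Ioc_subset_Ioi_self)

lemma halfPlane_eq : {x : ℝ × ℝ | 0 < x.2} = Set.univ ×ˢ Set.Ioi 0 := by
  ext x
  simp

lemma lintegral_halfPlane {F : ℝ × ℝ → ENNReal} (hF : Measurable F) :
    ∫⁻ x in {x : ℝ × ℝ | 0 < x.2}, F x = ∫⁻ s, ∫⁻ t in Set.Ioi (0 : ℝ), F (s, t) := by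
  rw [halfPlane_eq, Measure.volume_eq_prod, ← Measure.prod_restrict, Measure.restrict_univ,
    lintegral_prod _ hF.aemeasurable]

lemma hasDerivAt_horizontal {u : ℝ × ℝ → ℝ} (hu : ContDiff ℝ ∞ u) (b t : ℝ) :
    HasDerivAt (fun t => u (t, b)) (dx u (t, b)) t :=
  ((hu.differentiable (by simp) (t, b)).hasFDerivAt).comp_hasDerivAt t
    ((hasDerivAt_id t).prodMk (hasDerivAt_const t b))

lemma hasDerivAt_vertical {u : ℝ × ℝ → ℝ} (hu : ContDiff ℝ ∞ u) (a t : ℝ) :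
    HasDerivAt (fun t => u (a, t)) (dy u (a, t)) t :=
  ((hu.differentiable (by simp) (a, t)).hasFDerivAt).comp_hasDerivAt t
    ((hasDerivAt_const t a).prodMk (hasDerivAt_id t))

/-- Hardy's inequality in the half-plane, in qualitative form. -/
lemma integrableOn_hardy {u : ℝ × ℝ → ℝ} (hu : ContDiff ℝ ∞ u)
    (h₁ : IntegrableOn (fun x => dy u x ^ 2) {x : ℝ × ℝ | 0 < x.2})
    (h₂ : Integrable fun t : ℝ => u (t, 0) ^ 2) :
    IntegrableOn (fun x => (1 + x.2)⁻¹ ^ 2 * u x ^ 2) {x : ℝ × ℝ | 0 < x.2} := by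
  have hum := hu.continuous.measurable
  have hdm := (contDiff_dy hu).continuous.measurable
  have hm : Measurable fun x : ℝ × ℝ => (1 + x.2)⁻¹ ^ 2 * u x ^ 2 := by fun_prop
  refine ⟨hm.aestronglyMeasurable, ?_⟩
  rw [hasFiniteIntegral_iff_ofReal (ae_of_all _ fun x => by positivity),
    lintegral_halfPlane hm.ennreal_ofReal]
  have hle : ∀ s : ℝ, ∫⁻ t in Set.Ioi (0 : ℝ), ENNReal.ofReal ((1 + t)⁻¹ ^ 2 * u (s, t) ^ 2)
      ≤ ENNReal.ofReal (2 * u (s, 0) ^ 2)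
        + 4 * ∫⁻ t in Set.Ioi (0 : ℝ), ENNReal.ofReal (dy u (s, t) ^ 2) := fun s =>
    lintegral_hardy_le (hasDerivAt_vertical hu s)
      ((contDiff_dy hu).continuous.comp (by fun_prop))
  refine (lintegral_mono hle).trans_lt ?_
  rw [lintegral_add_left (by fun_prop)]
  refine ENNReal.add_lt_top.2 ⟨?_, ?_⟩
  · have := (h₂.const_mul 2).2
    rwa [hasFiniteIntegral_iff_ofReal (ae_of_all _ fun x => by positivity)] at this
  · have := h₁.2
    rw [hasFiniteIntegral_iff_ofReal (ae_of_all _ fun x => by positivity),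
      lintegral_halfPlane (by fun_prop)] at this
    rw [lintegral_const_mul' _ _ (by norm_num)]
    exact ENNReal.mul_lt_top (by norm_num) this

end hardy

/-! ### The integral identity: removal of the cut-off and of the regularisation. -/

section limit

variable {B : Set (ℝ × ℝ)}

lemma isOpen_water (B : Set (ℝ × ℝ)) : IsOpen (water B) :=
  (isOpen_lt continuous_const continuous_snd).sdiff isClosed_closure

/-- The closed body is compact and the function is continuous on the plane, so the body adds a
finite amount. Hardy's inequality can then be used on full vertical rays from the surface, including
those that cross the body. -/
lemma integrableOn_halfPlane_of_water (hB : IsSubmergedBody B) {F : ℝ × ℝ → ℝ} (hF : Continuous F)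
    (h : IntegrableOn F (water B)) : IntegrableOn F {x : ℝ × ℝ | 0 < x.2} := by
  have hc : IsCompact (closure B) := hB.isBounded.isCompact_closure
  refine (h.union (hF.continuousOn.integrableOn_compact hc)).mono_set ?_
  unfold water
  rw [Set.sdiff_union_self]
  exact Set.subset_union_left

lemma continuousAt_ratio (N : ℝ) {D : ℝ} (h : D ≠ 0) : ContinuousAt (fun e => N / (D + e)) 0 :=
  continuousAt_const.div (by fun_prop) (by simpa using h)

lemma tendsto_field {α : ℝ} {x : ℝ × ℝ} (hx : x.1 ^ 2 + x.2 ^ 2 ≠ 0) {e : ℕ → ℝ}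
    (he : Tendsto e atTop (𝓝 0)) :
    Tendsto (fun n => field1 α (e n) x) atTop (𝓝 (field1 α 0 x)) ∧
    Tendsto (fun n => field2 α (e n) x) atTop (𝓝 (field2 α 0 x)) ∧
    Tendsto (fun n => field11 α (e n) x) atTop (𝓝 (field11 α 0 x)) ∧
    Tendsto (fun n => field12 α (e n) x) atTop (𝓝 (field12 α 0 x)) ∧
    Tendsto (fun n => field21 α (e n) x) atTop (𝓝 (field21 α 0 x)) ∧
    Tendsto (fun n => field22 α (e n) x) atTop (𝓝 (field22 α 0 x)) := by
  have r : ∀ N : ℝ, Tendsto (fun n => N / (x.1 ^ 2 + x.2 ^ 2 + e n)) atTop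
      (𝓝 (N / (x.1 ^ 2 + x.2 ^ 2 + 0))) := fun N => (continuousAt_ratio N hx).tendsto.comp he
  refine ⟨tendsto_const_nhds.sub (r _), r _, ?_, ?_, ?_, ?_⟩
  · exact (tendsto_const_nhds.sub ((r _).const_mul _)).add (((r _).mul (r _)).const_mul _)
  · exact ((r _).const_mul _).add (((r _).mul (r _)).const_mul _)
  · exact ((r _).const_mul _).sub (((r _).mul (r _)).const_mul _)
  · exact ((r _).const_mul _).sub (((r _).mul (r _)).const_mul _)

lemma tendsto_multiplier {α : ℝ} {x : ℝ × ℝ} (hx : x.1 ^ 2 + x.2 ^ 2 ≠ 0) {e : ℕ → ℝ}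
    (he : Tendsto e atTop (𝓝 0)) (u : ℝ × ℝ → ℝ) :
    Tendsto (fun n => multiplier α (e n) u x) atTop (𝓝 (multiplier α 0 u x)) := by
  obtain ⟨h1, h2, -⟩ := tendsto_field (α := α) hx he
  exact (((h1.mul_const _).add (h2.mul_const _)).const_mul 2).add_const _

lemma tendsto_gradForm {α : ℝ} {x : ℝ × ℝ} (hx : x.1 ^ 2 + x.2 ^ 2 ≠ 0) {e : ℕ → ℝ}
    (he : Tendsto e atTop (𝓝 0)) (u : ℝ × ℝ → ℝ) :
    Tendsto (fun n => gradForm α (e n) u x) atTop (𝓝 (gradForm α 0 u x)) := by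
  obtain ⟨-, -, h1, h2, h3, h4⟩ := tendsto_field (α := α) hx he
  exact ((((h1.mul_const _).add ((h2.add h3).mul_const _)).add (h4.mul_const _)).const_mul 2).add
    (((tendsto_const_nhds.sub h1).sub h4).mul_const _)

lemma cutoffForm_eq_zero {α e : ℝ} {φ u : ℝ × ℝ → ℝ} {x : ℝ × ℝ} (h : φ =ᶠ[𝓝 x] fun _ => 1) :
    cutoffForm α e φ u x = 0 := by
  have h1 : fderiv ℝ φ x = 0 := by rw [h.fderiv_eq]; simp
  simp [cutoffForm, dx, dy, h1]

lemma contDiff_momentum {α e : ℝ} (he : 0 < e) {φ u : ℝ × ℝ → ℝ} (hφ : ContDiff ℝ ∞ φ)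
    (hu : ContDiff ℝ ∞ u) :
    ContDiff ℝ ∞ (momentum1 α e φ u) ∧ ContDiff ℝ ∞ (momentum2 α e φ u) := by
  have h1 := contDiff_field1 α he
  have h2 := contDiff_field2 α he
  have u1 := contDiff_dx hu
  have u2 := contDiff_dy hu
  have hm : ContDiff ℝ ∞ (multiplier α e u) :=
    (contDiff_const.mul ((h1.mul u1).add (h2.mul u2))).add hu
  have hg : ContDiff ℝ ∞ (grad2 u) := (u1.pow 2).add (u2.pow 2)
  exact ⟨hφ.mul ((hm.mul u1).sub (hg.mul h1)), hφ.mul ((hm.mul u2).sub (hg.mul h2))⟩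

namespace SmoothBoundary

variable (S : SmoothBoundary B)

/-- The exact identity with a cut-off function. -/
lemma cutoff_identity (hB : IsSubmergedBody B) {α e : ℝ} (he : 0 < e) {φ u : ℝ × ℝ → ℝ}
    (hφ : ContDiff ℝ ∞ φ) (hc : HasCompactSupport φ) (hu : ContDiff ℝ ∞ u) {ν : ℝ} {g : ℝ → ℝ}
    (hg : ∀ t, -dy u (t, 0) - ν * u (t, 0) = g t) :
    ∫ x in water B, divergence (momentum1 α e φ u) (momentum2 α e φ u) x
      = S.lineIntegral (fun i s => φ (S.curve i s) * (multiplier α e u (S.curve i s)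
            * fderiv ℝ u (S.curve i s) (S.normal i s)
          - grad2 u (S.curve i s) * (field1 α e (S.curve i s) * (S.normal i s).1
            + field2 α e (S.curve i s) * (S.normal i s).2)))
        + (∫ t : ℝ, φ (t, 0) * ((2 * t * dx u (t, 0) + u (t, 0)) * g t))
        - ν * ∫ t : ℝ, dx φ (t, 0) * (t * u (t, 0) ^ 2) := by
  obtain ⟨h1, h2⟩ := contDiff_momentum (α := α) he hφ hu
  have hl : Continuous fun t : ℝ => ((t, 0) : ℝ × ℝ) := by fun_prop
  have hcl : HasCompactSupport fun t : ℝ => φ (t, 0) := by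
    refine HasCompactSupport.intro (hc.isCompact.image continuous_fst) fun t ht => ?_
    exact image_eq_zero_of_notMem_tsupport fun h => ht ⟨(t, 0), h, rfl⟩
  have huc : Continuous fun t : ℝ => u (t, 0) := hu.continuous.comp hl
  have hu1 : Continuous fun t : ℝ => dx u (t, 0) := (contDiff_dx hu).continuous.comp hl
  have hu2 : Continuous fun t : ℝ => dy u (t, 0) := (contDiff_dy hu).continuous.comp hl
  have hφc : Continuous fun t : ℝ => φ (t, 0) := hφ.continuous.comp hl
  have hφ1 : Continuous fun t : ℝ => dx φ (t, 0) := (contDiff_dx hφ).continuous.comp hl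
  have hgcont : Continuous g := by
    have : g = fun t => -dy u (t, 0) - ν * u (t, 0) := funext fun t => (hg t).symm
    rw [this]; fun_prop
  have hcl1 : HasCompactSupport fun t : ℝ => dx φ (t, 0) := by
    have : (fun t : ℝ => dx φ (t, 0)) = deriv fun t : ℝ => φ (t, 0) :=
      funext fun t => (hasDerivAt_horizontal hφ 0 t).deriv.symm
    rw [this]
    exact hcl.deriv
  rw [S.integral_divergence_water hB (h1.of_le (by simp)) (h2.of_le (by simp)) hc.mul_right
    hc.mul_right]
  have eflux : S.flux (momentum1 α e φ u) (momentum2 α e φ u)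
      = S.lineIntegral (fun i s => φ (S.curve i s) * (multiplier α e u (S.curve i s)
            * fderiv ℝ u (S.curve i s) (S.normal i s)
          - grad2 u (S.curve i s) * (field1 α e (S.curve i s) * (S.normal i s).1
            + field2 α e (S.curve i s) * (S.normal i s).2))) := by
    unfold flux
    congr 1
    funext i s
    rw [fderiv_apply_eq]
    unfold momentum1 momentum2
    ring
  have etop : ∀ t : ℝ, momentum2 α e φ u (t, 0)
      = -(φ (t, 0) * ((2 * t * dx u (t, 0) + u (t, 0)) * g t))
        - ν * (φ (t, 0) * (2 * t * u (t, 0) * dx u (t, 0) + u (t, 0) ^ 2)) := by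
    intro t
    have hf1 : field1 α e (t, 0) = t := by simp [field1]
    have hf2 : field2 α e (t, 0) = 0 := by simp [field2]
    have hy : dy u (t, 0) = -g t - ν * u (t, 0) := by rw [← hg]; ring
    rw [momentum2, multiplier, hf1, hf2, hy]
    ring
  have i1 : Integrable fun t : ℝ => φ (t, 0) * ((2 * t * dx u (t, 0) + u (t, 0)) * g t) :=
    Continuous.integrable_of_hasCompactSupport (by fun_prop) hcl.mul_right
  have i1n : Integrable fun t : ℝ => -(φ (t, 0) * ((2 * t * dx u (t, 0) + u (t, 0)) * g t)) :=
    i1.neg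
  have i2 : Integrable fun t : ℝ =>
      φ (t, 0) * (2 * t * u (t, 0) * dx u (t, 0) + u (t, 0) ^ 2) :=
    Continuous.integrable_of_hasCompactSupport (by fun_prop) hcl.mul_right
  have i3 : Integrable fun t : ℝ => dx φ (t, 0) * (t * u (t, 0) ^ 2) :=
    Continuous.integrable_of_hasCompactSupport (by fun_prop) hcl1.mul_right
  have i4 : Integrable fun t : ℝ => φ (t, 0) * (t * u (t, 0) ^ 2) :=
    Continuous.integrable_of_hasCompactSupport (by fun_prop) hcl.mul_right
  -- `2 t u ∂₁u + u²` is the derivative of `t u²`; this fixes the coefficient of `u` in the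
  -- multiplier. Only a term with the derivative of the cut-off is left.
  have hparts : ∫ t : ℝ, (dx φ (t, 0) * (t * u (t, 0) ^ 2)
      + φ (t, 0) * (2 * t * u (t, 0) * dx u (t, 0) + u (t, 0) ^ 2)) = 0 := by
    refine integral_eq_zero_of_hasDerivAt_of_integrable (f := fun t => φ (t, 0) * (t * u (t, 0) ^ 2))
      (fun t => ?_) (i3.add i2) i4
    refine ((hasDerivAt_horizontal hφ 0 t).mul
      ((hasDerivAt_id t).mul ((hasDerivAt_horizontal hu 0 t).pow 2))).congr_deriv ?_
    simp only [Pi.pow_apply, Pi.mul_apply, id]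
    push_cast
    ring
  rw [integral_add i3 i2] at hparts
  rw [eflux, integral_congr_ae (ae_of_all _ etop), integral_sub i1n (i2.const_mul ν),
    integral_neg, integral_const_mul]
  linear_combination ν * hparts

end SmoothBoundary

end limit

namespace SmoothBoundary

variable {B : Set (ℝ × ℝ)} (S : SmoothBoundary B)

lemma normal_sq (i : Fin S.m) (s : ℝ) : (S.normal i s).1 ^ 2 + (S.normal i s).2 ^ 2 = 1 := by
  rw [← S.unit_speed i s]
  simp only [normal]
  ring

lemma abs_normal_le (i : Fin S.m) (s : ℝ) : |(S.normal i s).1| ≤ 1 ∧ |(S.normal i s).2| ≤ 1 := by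
  have h := S.normal_sq i s
  constructor <;> rw [← sq_le_one_iff_abs_le_one]
  · nlinarith [sq_nonneg (S.normal i s).2]
  · nlinarith [sq_nonneg (S.normal i s).1]

lemma curve_snd_pos (hB : IsSubmergedBody B) (i : Fin S.m) (s : ℝ) : 0 < (S.curve i s).2 :=
  hB.closure_subset (S.curve_mem_frontier i s).1

lemma curve_sq_ne_zero (hB : IsSubmergedBody B) (i : Fin S.m) (s : ℝ) :
    (S.curve i s).1 ^ 2 + (S.curve i s).2 ^ 2 ≠ 0 := by
  have := S.curve_snd_pos hB i s
  positivity

lemma tendsto_lineIntegral {F : ℕ → Fin S.m → ℝ → ℝ} {G D : Fin S.m → ℝ → ℝ}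
    (hF : ∀ n i, Continuous (F n i)) (hD : ∀ i, Continuous (D i)) (hb : ∀ n i s, |F n i s| ≤ D i s)
    (hlim : ∀ i s, Tendsto (fun n => F n i s) atTop (𝓝 (G i s))) :
    Tendsto (fun n => S.lineIntegral (F n)) atTop (𝓝 (S.lineIntegral G)) := by
  unfold lineIntegral
  refine tendsto_finsetSum _ fun i _ => ?_
  exact intervalIntegral.tendsto_integral_filter_of_dominated_convergence (D i)
    (Eventually.of_forall fun n => (hF n i).aestronglyMeasurable)
    (Eventually.of_forall fun n => ae_of_all _ fun s _ => hb n i s)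
    ((hD i).intervalIntegrable _ _) (ae_of_all _ fun s _ => hlim i s)

/-- The integral identity obtained from the multiplier `V·∇u + u/2`. -/
theorem multiplier_identity (hB : IsSubmergedBody B) {α : ℝ} (hα₀ : 0 ≤ α) (hα₁ : α ≤ 1)
    {u : ℝ × ℝ → ℝ} (hu : ContDiff ℝ ∞ u) {ν : ℝ} {g : ℝ → ℝ}
    (hg : ∀ t, -dy u (t, 0) - ν * u (t, 0) = g t) (hgc : HasCompactSupport g)
    (hgrad : IntegrableOn (grad2 u) (water B)) (htrace : Integrable fun t : ℝ => u (t, 0) ^ 2)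
    (hsource : IntegrableOn
      (fun x => (2 * (|x.1| * (|dx u x| + |dy u x|)) + |u x|) * |lap u x|) (water B)) :
    (∫ x in water B, multiplier α 0 u x * lap u x) + ∫ x in water B, gradForm α 0 u x
      = S.lineIntegral (fun i s => multiplier α 0 u (S.curve i s)
            * fderiv ℝ u (S.curve i s) (S.normal i s)
          - grad2 u (S.curve i s) * (field1 α 0 (S.curve i s) * (S.normal i s).1
            + field2 α 0 (S.curve i s) * (S.normal i s).2))
        + ∫ t : ℝ, (2 * t * dx u (t, 0) + u (t, 0)) * g t := by
  obtain ⟨φ, C, hC, hφ, hφc, hφb, hφ1, hφx, hφy⟩ := exists_cutoff_sequence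
  -- The regularisation and the cut-off are removed along one sequence: all the bounds are uniform
  -- in both.
  set e : ℕ → ℝ := fun n => 1 / ((n : ℝ) + 1) with he_def
  have he : Tendsto e atTop (𝓝 0) := tendsto_one_div_add_atTop_nhds_zero_nat
  have he0 : ∀ n, 0 < e n := fun n => Nat.one_div_pos_of_nat
  have hxw : ∀ x ∈ water B, x.1 ^ 2 + x.2 ^ 2 ≠ 0 := by
    intro x hx
    have : 0 < x.2 := hx.1
    positivity
  have hl : Continuous fun t : ℝ => ((t, 0) : ℝ × ℝ) := by fun_prop
  have huc : Continuous u := hu.continuous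
  have hdx : Continuous (dx u) := (contDiff_dx hu).continuous
  have hdy : Continuous (dy u) := (contDiff_dy hu).continuous
  have hlap : Continuous (lap u) := continuous_lap hu
  have hgr : Continuous (grad2 u) := continuous_grad2 hu
  have hu0 : Continuous fun t : ℝ => u (t, 0) := huc.comp hl
  have hu1 : Continuous fun t : ℝ => dx u (t, 0) := hdx.comp hl
  have hu2 : Continuous fun t : ℝ => dy u (t, 0) := hdy.comp hl
  have hgcont : Continuous g := by
    have : g = fun t => -dy u (t, 0) - ν * u (t, 0) := funext fun t => (hg t).symm
    rw [this]; fun_prop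
  have hφ1' : ∀ x, ∀ᶠ n in atTop, φ n x = 1 := fun x => (hφ1 x).mono fun n h => h.self_of_nhds
  have habs : ∀ n x, |φ n x| ≤ 1 := fun n x => abs_le.2 ⟨by linarith [(hφb n x).1], (hφb n x).2⟩
  have hhardy : IntegrableOn (fun x => (1 + x.2)⁻¹ ^ 2 * u x ^ 2) (water B) := by
    refine (integrableOn_hardy hu ?_ htrace).mono_set Set.sdiff_subset
    refine (integrableOn_halfPlane_of_water hB hgr hgrad).mono'
      (hdy.pow 2).aestronglyMeasurable (ae_of_all _ fun x => ?_)
    rw [Real.norm_eq_abs, abs_of_nonneg (sq_nonneg _)]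
    exact (abs_two_mul_le_grad2 u x).2.2
  -- the integral over the water
  have hmb : ∀ e : ℝ, 0 ≤ e → ∀ x, |multiplier α e u x * lap u x|
      ≤ (2 * (|x.1| * (|dx u x| + |dy u x|)) + |u x|) * |lap u x| := by
    intro e he x
    rw [abs_mul]
    exact mul_le_mul_of_nonneg_right (abs_multiplier_le hα₀ hα₁ he u x) (abs_nonneg _)
  have hdom : IntegrableOn (fun x => (2 * (|x.1| * (|dx u x| + |dy u x|)) + |u x|) * |lap u x|
      + 100 * grad2 u x + 20 * C * (grad2 u x + (1 + x.2)⁻¹ ^ 2 * u x ^ 2)) (water B) := by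
    have h1 : IntegrableOn (fun x => grad2 u x + (1 + x.2)⁻¹ ^ 2 * u x ^ 2) (water B) :=
      hgrad.add hhardy
    have h2 : IntegrableOn (fun x => (2 * (|x.1| * (|dx u x| + |dy u x|)) + |u x|) * |lap u x|
      + 100 * grad2 u x) (water B) := hsource.add (hgrad.const_mul 100)
    exact h2.add (h1.const_mul (20 * C))
  have hA : Tendsto (fun n => ∫ x in water B,
      divergence (momentum1 α (e n) (φ n) u) (momentum2 α (e n) (φ n) u) x) atTop
      (𝓝 (∫ x in water B, (multiplier α 0 u x * lap u x + gradForm α 0 u x))) := by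
    refine tendsto_integral_of_dominated_convergence
      (fun x => (2 * (|x.1| * (|dx u x| + |dy u x|)) + |u x|) * |lap u x| + 100 * grad2 u x
        + 20 * C * (grad2 u x + (1 + x.2)⁻¹ ^ 2 * u x ^ 2)) (fun n => ?_)
      hdom
      (fun n => ?_) ?_
    · obtain ⟨h1, h2⟩ := contDiff_momentum (α := α) (he0 n) (hφ n) hu
      exact (continuous_divergence (h1.of_le (by simp)) (h2.of_le (by simp))).aestronglyMeasurable
    · refine (ae_restrict_mem (isOpen_water B).measurableSet).mono fun x hx => ?_
      rw [divergence_momentum α (he0 n) (hφ n) hu, Real.norm_eq_abs]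
      refine (abs_add_le _ _).trans (add_le_add ((abs_add_le _ _).trans (add_le_add ?_ ?_)) ?_)
      · rw [abs_mul]
        exact (mul_le_of_le_one_left (abs_nonneg _) (habs n x)).trans (hmb _ (he0 n).le x)
      · rw [abs_mul]
        exact (mul_le_of_le_one_left (abs_nonneg _) (habs n x)).trans
          (abs_gradForm_le hα₀ hα₁ (he0 n).le u x)
      · exact abs_cutoffForm_le hα₀ hα₁ (he0 n).le (φ n) u hx.1 (hφx n x) (hφy n x)
    · refine (ae_restrict_mem (isOpen_water B).measurableSet).mono fun x hx => ?_
      refine (((tendsto_multiplier (hxw x hx) he u).mul_const (lap u x)).add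
        (tendsto_gradForm (hxw x hx) he u)).congr' ?_
      filter_upwards [hφ1 x] with n hn
      rw [divergence_momentum α (he0 n) (hφ n) hu, cutoffForm_eq_zero hn, hn.self_of_nhds]
      ring
  have hint1 : IntegrableOn (fun x => multiplier α 0 u x * lap u x) (water B) := by
    refine hsource.mono' ?_ (ae_of_all _ fun x => hmb 0 le_rfl x)
    refine aestronglyMeasurable_of_tendsto_ae (u := atTop)
      (f := fun n x => multiplier α (e n) u x * lap u x) (fun n => ?_) ?_
    · have := (contDiff_field1 α (he0 n)).continuous
      have := (contDiff_field2 α (he0 n)).continuous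
      refine Continuous.aestronglyMeasurable ?_
      unfold multiplier
      fun_prop
    · exact (ae_restrict_mem (isOpen_water B).measurableSet).mono fun x hx =>
        (tendsto_multiplier (hxw x hx) he u).mul_const _
  have hint2 : IntegrableOn (gradForm α 0 u) (water B) := by
    refine (hgrad.const_mul 100).mono' ?_
      (ae_of_all _ fun x => abs_gradForm_le hα₀ hα₁ le_rfl u x)
    have hmeas : Measurable (gradForm α 0 u) := by
      have := hdx.measurable
      have := hdy.measurable
      have := hgr.measurable
      unfold gradForm field11 field12 field21 field22
      fun_prop
    exact hmeas.aestronglyMeasurable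
  rw [integral_add hint1 hint2] at hA
  -- the integral over the boundary of the body
  have hB' : Tendsto (fun n => S.lineIntegral (fun i s => φ n (S.curve i s)
        * (multiplier α (e n) u (S.curve i s) * fderiv ℝ u (S.curve i s) (S.normal i s)
          - grad2 u (S.curve i s) * (field1 α (e n) (S.curve i s) * (S.normal i s).1
            + field2 α (e n) (S.curve i s) * (S.normal i s).2)))) atTop
      (𝓝 (S.lineIntegral (fun i s => multiplier α 0 u (S.curve i s)
            * fderiv ℝ u (S.curve i s) (S.normal i s)
          - grad2 u (S.curve i s) * (field1 α 0 (S.curve i s) * (S.normal i s).1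
            + field2 α 0 (S.curve i s) * (S.normal i s).2)))) := by
    refine S.tendsto_lineIntegral (D := fun i s =>
      (2 * (|(S.curve i s).1| * (|dx u (S.curve i s)| + |dy u (S.curve i s)|)) + |u (S.curve i s)|)
        * |fderiv ℝ u (S.curve i s) (S.normal i s)|
      + grad2 u (S.curve i s) * (|(S.curve i s).1| * (1 + 1))) (fun n i => ?_) (fun i => ?_)
      (fun n i s => ?_) (fun i s => ?_)
    · have c1 := S.continuous_curve i
      have c2 := S.continuous_normal i
      have k1 := hdx.comp c1
      have k2 := hdy.comp c1
      have k3 := huc.comp c1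
      have k4 := hgr.comp c1
      have k5 := continuous_fst.comp c1
      have k6 := continuous_fst.comp c2
      have k7 := continuous_snd.comp c2
      have k8 := (contDiff_field1 α (he0 n)).continuous.comp c1
      have k9 := (contDiff_field2 α (he0 n)).continuous.comp c1
      have k10 := (hφ n).continuous.comp c1
      simp only [Function.comp_def] at k1 k2 k3 k4 k5 k6 k7 k8 k9 k10
      simp only [fderiv_apply_eq, multiplier]
      exact k10.mul ((((((k8.mul k1).add (k9.mul k2)).const_mul 2).add k3).mul
        ((k6.mul k1).add (k7.mul k2))).sub (k4.mul ((k8.mul k6).add (k9.mul k7))))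
    · have c1 := S.continuous_curve i
      have c2 := S.continuous_normal i
      have k1 := hdx.comp c1
      have k2 := hdy.comp c1
      have k3 := huc.comp c1
      have k4 := hgr.comp c1
      have k5 := continuous_fst.comp c1
      have k6 := continuous_fst.comp c2
      have k7 := continuous_snd.comp c2
      simp only [Function.comp_def] at k1 k2 k3 k4 k5 k6 k7
      simp only [fderiv_apply_eq]
      exact ((((k5.abs.mul (k1.abs.add k2.abs)).const_mul 2).add k3.abs).mul
        ((k6.mul k1).add (k7.mul k2)).abs).add (k4.mul (k5.abs.mul_const _))
    · obtain ⟨n1, n2⟩ := S.abs_normal_le i s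
      rw [abs_mul]
      refine (mul_le_of_le_one_left (abs_nonneg _) (habs n _)).trans ?_
      refine (abs_sub _ _).trans (add_le_add ?_ ?_)
      · rw [abs_mul]
        exact mul_le_mul_of_nonneg_right (abs_multiplier_le hα₀ hα₁ (he0 n).le u _) (abs_nonneg _)
      · rw [abs_mul, abs_of_nonneg (grad2_nonneg u _)]
        refine mul_le_mul_of_nonneg_left ((abs_field_dot_le hα₀ hα₁ (he0 n).le _ _ _).trans ?_)
          (grad2_nonneg u _)
        exact mul_le_mul_of_nonneg_left (add_le_add n1 n2) (abs_nonneg _)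
    · have hne := S.curve_sq_ne_zero hB i s
      obtain ⟨t1, t2, -⟩ := tendsto_field (α := α) hne he
      have hlim := (((tendsto_multiplier (α := α) hne he u).mul_const
        (fderiv ℝ u (S.curve i s) (S.normal i s))).sub
          (((t1.mul_const (S.normal i s).1).add (t2.mul_const (S.normal i s).2)).const_mul
            (grad2 u (S.curve i s))))
      refine hlim.congr' ?_
      filter_upwards [hφ1' (S.curve i s)] with n hn
      rw [hn, one_mul]
  -- the integrals over the free surface
  have hT : Tendsto (fun n => ∫ t : ℝ, φ n (t, 0) * ((2 * t * dx u (t, 0) + u (t, 0)) * g t)) atTop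
      (𝓝 (∫ t : ℝ, (2 * t * dx u (t, 0) + u (t, 0)) * g t)) := by
    have hi : Integrable fun t : ℝ => (2 * t * dx u (t, 0) + u (t, 0)) * g t :=
      Continuous.integrable_of_hasCompactSupport (by fun_prop) hgc.mul_left
    refine tendsto_integral_of_dominated_convergence _ (fun n => ?_) hi.norm
      (fun n => ae_of_all _ fun t => ?_) (ae_of_all _ fun t => ?_)
    · have : Continuous fun t : ℝ => φ n (t, 0) := (hφ n).continuous.comp hl
      exact Continuous.aestronglyMeasurable (by fun_prop)
    · rw [norm_mul]
      exact mul_le_of_le_one_left (norm_nonneg _) (habs n _)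
    · refine tendsto_const_nhds.congr' ?_
      filter_upwards [hφ1' (t, 0)] with n hn
      rw [hn, one_mul]
  -- `t * dx (φ n) (t, 0)` is bounded by `C` and is eventually zero for each `t`, so square
  -- integrability of the trace is all that is required.
  have hR : Tendsto (fun n => ∫ t : ℝ, dx (φ n) (t, 0) * (t * u (t, 0) ^ 2)) atTop
      (𝓝 (∫ _ : ℝ, (0 : ℝ))) := by
    refine tendsto_integral_of_dominated_convergence _ (fun n => ?_) (htrace.const_mul C)
      (fun n => ae_of_all _ fun t => ?_) (ae_of_all _ fun t => ?_)
    · have : Continuous fun t : ℝ => dx (φ n) (t, 0) := (contDiff_dx (hφ n)).continuous.comp hl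
      exact Continuous.aestronglyMeasurable (by fun_prop)
    · rw [Real.norm_eq_abs, ← mul_assoc, abs_mul, abs_of_nonneg (sq_nonneg (u (t, 0)))]
      refine mul_le_mul_of_nonneg_right ?_ (sq_nonneg _)
      have := hφx n (t, 0)
      rw [abs_mul]
      simp only [abs_zero, add_zero] at this
      nlinarith [abs_nonneg (dx (φ n) (t, 0))]
    · refine tendsto_const_nhds.congr' ?_
      filter_upwards [hφ1 (t, 0)] with n hn
      have : dx (φ n) (t, 0) = 0 := by rw [dx, hn.fderiv_eq]; simp
      rw [this, zero_mul]
  rw [integral_zero] at hR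
  have hlim := (hB'.add hT).sub (hR.const_mul ν)
  rw [mul_zero, sub_zero] at hlim
  refine tendsto_nhds_unique hA (hlim.congr fun n => ?_)
  exact (S.cutoff_identity hB (he0 n) (hφ n) (hφc n) hu hg).symm

end SmoothBoundary

/-! ### The multiplier fields on the boundary of the body and the geometric conditions. -/

namespace SmoothBoundary

variable {B : Set (ℝ × ℝ)} (S : SmoothBoundary B)

/-- The normal component of the multiplier field on the boundary. -/
noncomputable def fieldNormal (α : ℝ) (i : Fin S.m) (s : ℝ) : ℝ :=
  field1 α 0 (S.curve i s) * (S.normal i s).1 + field2 α 0 (S.curve i s) * (S.normal i s).2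

/-- The tangential component of the multiplier field on the boundary. -/
noncomputable def fieldTangent (α : ℝ) (i : Fin S.m) (s : ℝ) : ℝ :=
  field1 α 0 (S.curve i s) * (deriv (S.curve i) s).1
    + field2 α 0 (S.curve i s) * (deriv (S.curve i) s).2

/-- The derivative of the multiplier field, evaluated twice on the unit tangent. -/
noncomputable def fieldStrain (α : ℝ) (i : Fin S.m) (s : ℝ) : ℝ :=
  field11 α 0 (S.curve i s) * (deriv (S.curve i) s).1 ^ 2
    + (field12 α 0 (S.curve i s) + field21 α 0 (S.curve i s))
      * ((deriv (S.curve i) s).1 * (deriv (S.curve i) s).2)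
    + field22 α 0 (S.curve i s) * (deriv (S.curve i) s).2 ^ 2

/-- The normal derivative on the boundary. -/
noncomputable def normalDeriv (u : ℝ × ℝ → ℝ) (i : Fin S.m) (s : ℝ) : ℝ :=
  fderiv ℝ u (S.curve i s) (S.normal i s)

/-- The tangential derivative on the boundary. -/
noncomputable def arcDeriv (u : ℝ × ℝ → ℝ) (i : Fin S.m) (s : ℝ) : ℝ :=
  fderiv ℝ u (S.curve i s) (deriv (S.curve i) s)

lemma deriv_dot_deriv2 (i : Fin S.m) (s : ℝ) :
    (deriv (S.curve i) s).1 * (deriv (deriv (S.curve i)) s).1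
      + (deriv (S.curve i) s).2 * (deriv (deriv (S.curve i)) s).2 = 0 := by
  have hc := contDiff_deriv_curve (S.smooth i)
  have h1 := (hasDerivAt_fst_curve hc s).pow 2
  have h2 := (hasDerivAt_snd_curve hc s).pow 2
  have h : HasDerivAt (fun s => (deriv (S.curve i) s).1 ^ 2 + (deriv (S.curve i) s).2 ^ 2) _ s :=
    h1.add h2
  have h3 : (fun s => (deriv (S.curve i) s).1 ^ 2 + (deriv (S.curve i) s).2 ^ 2)
      = fun _ => (1 : ℝ) := funext fun s => S.unit_speed i s
  rw [h3] at h
  have := h.unique (hasDerivAt_const s 1)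
  push_cast at this
  linarith

/-- The Frenet equation. -/
lemma deriv2_eq (i : Fin S.m) (s : ℝ) :
    (deriv (deriv (S.curve i)) s).1 = S.curvature i s * (S.normal i s).1 ∧
    (deriv (deriv (S.curve i)) s).2 = S.curvature i s * (S.normal i s).2 := by
  have h1 := S.unit_speed i s
  have h2 := S.deriv_dot_deriv2 i s
  unfold curvature normal
  dsimp only
  generalize (deriv (S.curve i) s).1 = a at *
  generalize (deriv (S.curve i) s).2 = b at *
  generalize (deriv (deriv (S.curve i)) s).1 = p at *
  generalize (deriv (deriv (S.curve i)) s).2 = q at *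
  constructor
  · linear_combination (-p) * h1 + a * h2
  · linear_combination (-q) * h1 + b * h2

/-- The strain comes from the variation of the field along the curve, and the turning of the tangent
adds the curvature times the normal component. The curvature bound enters the final estimate only
through this formula. -/
lemma hasDerivAt_fieldTangent (hB : IsSubmergedBody B) (α : ℝ) (i : Fin S.m) (s : ℝ) :
    HasDerivAt (S.fieldTangent α i)
      (S.fieldStrain α i s + S.curvature i s * S.fieldNormal α i s) s := by
  have hne : (S.curve i s).1 ^ 2 + (S.curve i s).2 ^ 2 + 0 ≠ 0 := by
    rw [add_zero]; exact S.curve_sq_ne_zero hB i s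
  have hc := ((S.smooth i).differentiable (by simp) s).hasDerivAt
  have hc' := contDiff_deriv_curve (S.smooth i)
  have h1 := (hasFDerivAt_field1 α hne).comp_hasDerivAt s hc
  have h2 := (hasFDerivAt_field2 α hne).comp_hasDerivAt s hc
  have h : HasDerivAt (S.fieldTangent α i) _ s :=
    (h1.mul (hasDerivAt_fst_curve hc' s)).add (h2.mul (hasDerivAt_snd_curve hc' s))
  refine h.congr_deriv ?_
  obtain ⟨e1, e2⟩ := S.deriv2_eq i s
  simp only [Function.comp_apply, add_apply, smul_apply, ContinuousLinearMap.coe_fst',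
    ContinuousLinearMap.coe_snd', smul_eq_mul, fieldStrain, fieldNormal, e1, e2]
  ring

/-- The field is `x.1` times the unit vector `(1, 0)` or `(cos 2θ, sin 2θ)`, with `θ` the polar
angle. This makes `|x.1|` a bound for the normal and the tangential components with constant one. -/
lemma field_sq {α : ℝ} (hα : α = 0 ∨ α = 1) {x : ℝ × ℝ} (hx : x.1 ^ 2 + x.2 ^ 2 ≠ 0) :
    field1 α 0 x ^ 2 + field2 α 0 x ^ 2 = x.1 ^ 2 := by
  rcases hα with rfl | rfl
  · simp [field1, field2]
  · simp only [field1, field2, add_zero]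
    field_simp
    ring

lemma fieldNormal_sq_add (hB : IsSubmergedBody B) {α : ℝ} (hα : α = 0 ∨ α = 1) (i : Fin S.m)
    (s : ℝ) : S.fieldNormal α i s ^ 2 + S.fieldTangent α i s ^ 2 = (S.curve i s).1 ^ 2 := by
  have h1 := S.unit_speed i s
  rw [← field_sq hα (S.curve_sq_ne_zero hB i s)]
  simp only [fieldNormal, fieldTangent, normal]
  linear_combination (field1 α 0 (S.curve i s) ^ 2 + field2 α 0 (S.curve i s) ^ 2) * h1

lemma abs_fieldNormal_le (hB : IsSubmergedBody B) {α : ℝ} (hα : α = 0 ∨ α = 1) (i : Fin S.m)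
    (s : ℝ) : |S.fieldNormal α i s| ≤ |(S.curve i s).1| := by
  rw [← sq_le_sq, ← S.fieldNormal_sq_add hB hα i s]
  nlinarith [sq_nonneg (S.fieldTangent α i s)]

lemma abs_fieldTangent_le (hB : IsSubmergedBody B) {α : ℝ} (hα : α = 0 ∨ α = 1) (i : Fin S.m)
    (s : ℝ) : |S.fieldTangent α i s| ≤ |(S.curve i s).1| := by
  rw [← sq_le_sq, ← S.fieldNormal_sq_add hB hα i s]
  nlinarith [sq_nonneg (S.fieldNormal α i s)]

/-- After integration by parts along `S` the coefficient of `u ∂_n u` is one minus twice the strain,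
up to curvature. Here the strain is the square of a component of the unit tangent. -/
lemma abs_fieldStrain_zero (i : Fin S.m) (s : ℝ) : |1 - 2 * S.fieldStrain 0 i s| ≤ 1 := by
  have h := S.unit_speed i s
  have : S.fieldStrain 0 i s = (deriv (S.curve i) s).1 ^ 2 := by
    simp [fieldStrain, field11, field12, field21, field22]
  rw [this, abs_le]
  constructor <;> nlinarith [sq_nonneg (deriv (S.curve i) s).2, sq_nonneg (deriv (S.curve i) s).1]

/-- With `p`, `q` the squared cosine and sine of the polar angle, the diagonal entries lie in `[-1,
2]` and the mixed term in `[-1, 1]`. So the strain lies in `[-2, 3]`, and `7` leaves some slack. -/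
lemma abs_fieldStrain_one (hB : IsSubmergedBody B) (i : Fin S.m) (s : ℝ) :
    |1 - 2 * S.fieldStrain 1 i s| ≤ 7 := by
  have h := S.unit_speed i s
  have hx := S.curve_sq_ne_zero hB i s
  obtain ⟨⟨p0, p1⟩, ⟨q0, q1⟩, -⟩ := ratio_bounds le_rfl (S.curve i s)
  have hpq : (S.curve i s).1 ^ 2 / ((S.curve i s).1 ^ 2 + (S.curve i s).2 ^ 2 + 0)
      + (S.curve i s).2 ^ 2 / ((S.curve i s).1 ^ 2 + (S.curve i s).2 ^ 2 + 0) = 1 := by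
    rw [add_zero, ← add_div, div_self hx]
  have hr : ((S.curve i s).1 * (S.curve i s).2
      / ((S.curve i s).1 ^ 2 + (S.curve i s).2 ^ 2 + 0)) ^ 2
      = (S.curve i s).1 ^ 2 / ((S.curve i s).1 ^ 2 + (S.curve i s).2 ^ 2 + 0)
        * ((S.curve i s).2 ^ 2 / ((S.curve i s).1 ^ 2 + (S.curve i s).2 ^ 2 + 0)) := by
    rw [add_zero]
    field_simp
  unfold fieldStrain field11 field12 field21 field22
  generalize (S.curve i s).1 ^ 2 / ((S.curve i s).1 ^ 2 + (S.curve i s).2 ^ 2 + 0) = p at *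
  generalize (S.curve i s).2 ^ 2 / ((S.curve i s).1 ^ 2 + (S.curve i s).2 ^ 2 + 0) = q at *
  generalize (S.curve i s).1 * (S.curve i s).2
    / ((S.curve i s).1 ^ 2 + (S.curve i s).2 ^ 2 + 0) = r at *
  generalize (deriv (S.curve i) s).1 = a at *
  generalize (deriv (S.curve i) s).2 = b at *
  obtain rfl : q = 1 - p := by linarith
  have hr' : |r| ≤ 1 / 2 := abs_le_of_sq_le_sq (by nlinarith [sq_nonneg (2 * p - 1)]) (by norm_num)
  have hab : |a * b| ≤ 1 / 2 := abs_le.2 ⟨by nlinarith [sq_nonneg (a + b)],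
    by nlinarith [sq_nonneg (a - b)]⟩
  have h12 : |4 * (r * (1 - 2 * p)) * (a * b)| ≤ 1 := by
    have hp : |1 - 2 * p| ≤ 1 := abs_le.2 ⟨by linarith, by linarith⟩
    rw [abs_mul, abs_mul, abs_mul, abs_of_pos (four_pos : (0 : ℝ) < 4)]
    calc _ ≤ 4 * (1 / 2 * 1) * (1 / 2 : ℝ) := by gcongr
      _ = 1 := by norm_num
  have h11 : 1 - 2 * (1 - p) + 4 * (p * (1 - p)) ≤ 2 := by nlinarith [sq_nonneg (p - 3 / 4)]
  have h11' : -1 ≤ 1 - 2 * (1 - p) + 4 * (p * (1 - p)) := by nlinarith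
  have h22 : 2 * p - 4 * (p * (1 - p)) ≤ 2 := by nlinarith
  have h22' : -1 ≤ 2 * p - 4 * (p * (1 - p)) := by nlinarith [sq_nonneg (p - 1 / 4)]
  have g1 := mul_le_mul_of_nonneg_right h11 (sq_nonneg a)
  have g1' := mul_le_mul_of_nonneg_right h11' (sq_nonneg a)
  have g2 := mul_le_mul_of_nonneg_right h22 (sq_nonneg b)
  have g2' := mul_le_mul_of_nonneg_right h22' (sq_nonneg b)
  rw [abs_le] at h12 ⊢
  constructor <;> nlinarith

lemma curve_mem_box {L h H : ℝ} (hbox : ∀ x ∈ B, |x.1| < L ∧ h < x.2 ∧ x.2 < H)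
    (i : Fin S.m) (s : ℝ) :
    |(S.curve i s).1| ≤ L ∧ h ≤ (S.curve i s).2 ∧ (S.curve i s).2 ≤ H := by
  have h1 : IsClosed {x : ℝ × ℝ | |x.1| ≤ L} := isClosed_le (by fun_prop) continuous_const
  have h2 : IsClosed {x : ℝ × ℝ | h ≤ x.2} := isClosed_le continuous_const continuous_snd
  have h3 : IsClosed {x : ℝ × ℝ | x.2 ≤ H} := isClosed_le continuous_snd continuous_const
  have hcl : IsClosed {x : ℝ × ℝ | |x.1| ≤ L ∧ h ≤ x.2 ∧ x.2 ≤ H} := h1.inter (h2.inter h3)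
  have hsub : B ⊆ {x : ℝ × ℝ | |x.1| ≤ L ∧ h ≤ x.2 ∧ x.2 ≤ H} := fun x hx =>
    ⟨(hbox x hx).1.le, (hbox x hx).2.1.le, (hbox x hx).2.2.le⟩
  exact closure_minimal hsub hcl (S.curve_mem_frontier i s).1

lemma fieldNormal_zero_eq (i : Fin S.m) (s : ℝ) :
    S.fieldNormal 0 i s = (S.curve i s).1 * (S.normal i s).1 := by
  rw [fieldNormal, field1_zero, field2_zero, zero_mul, add_zero]

/-- The algebraic form of the comparison of the two multiplier fields on the boundary. -/
lemma neg_mul_le_of_conditions {x y ε H N W : ℝ} (hε : 0 < ε) (hy : ε ≤ y) (hH : y ≤ H)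
    (hN : N ≤ 0) (hx : x = 0 → N = 0) (hW : y = ε → 0 ≤ W)
    (hc : 0 ≤ N * (x ^ 2 - (y - ε) ^ 2) + 2 * W * (y - ε)) :
    -N * (ε * (x ^ 2 + y ^ 2)) ≤ H * (N * (x ^ 2 - y ^ 2) + 2 * W * y) := by
  have hy0 : 0 < y := hε.trans_le hy
  have hH0 : 0 < H := hy0.trans_le hH
  -- At `y = ε` the hypothesis `hc` reduces to `0 ≤ N * x ^ 2` and says nothing about `W`: it forces
  -- `N = 0`, and the sign of `W` must come from `hW`.
  rcases hy.eq_or_lt with rfl | hlt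
  · have hN0 : N = 0 := by
      by_cases h0 : x = 0
      · exact hx h0
      · have : 0 < x ^ 2 := by positivity
        nlinarith
    have := hW rfl
    rw [hN0]
    have : 0 ≤ H * (2 * W * ε) := by positivity
    linarith
  · have hz : 0 < y - ε := by linarith
    refine le_of_mul_le_mul_left ?_ hz
    -- Eliminating `W` with `hc`, the right side times `y - ε` is at least `-N * ε * H * (x ^ 2 + y
    -- * (y - ε))`. What remains is `k2`, a consequence of `y ≤ H`; this is the origin of the factor
    -- `H / ε`.
    have k1 : H * (y * 0) ≤ H * (y * (N * (x ^ 2 - (y - ε) ^ 2) + 2 * W * (y - ε))) :=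
      mul_le_mul_of_nonneg_left (mul_le_mul_of_nonneg_left hc hy0.le) hH0.le
    have k2 : (y - ε) * (x ^ 2 + y ^ 2) ≤ H * (x ^ 2 + y * (y - ε)) := by
      nlinarith [sq_nonneg x, mul_nonneg (sub_nonneg.2 hH) (mul_pos hy0 hz).le,
        mul_nonneg (sub_nonneg.2 hH) (sq_nonneg x), mul_nonneg hε.le (sq_nonneg x)]
    have k3 := mul_le_mul_of_nonneg_left k2 (mul_nonneg (neg_nonneg.2 hN) hε.le)
    linarith

/-- The geometric conditions imply that the second multiplier field controls the first one. -/
lemma neg_fieldNormal_zero_le (hB : IsSubmergedBody B) {L h H ε : ℝ} (hε : 0 < ε) (hεh : ε ≤ h)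
    (hbox : ∀ x ∈ B, |x.1| < L ∧ h < x.2 ∧ x.2 < H) (h₁ : Condition1 S) (h₂ : Condition2 S ε)
    (i : Fin S.m) (s : ℝ) : -S.fieldNormal 0 i s ≤ H / ε * S.fieldNormal 1 i s := by
  obtain ⟨-, hy, hH⟩ := S.curve_mem_box hbox i s
  have hx := S.curve_sq_ne_zero hB i s
  have hD : 0 < (S.curve i s).1 ^ 2 + (S.curve i s).2 ^ 2 := lt_of_le_of_ne (by positivity) hx.symm
  have c1 := h₁ i s
  have c2 := h₂ i s
  -- At height `h` the boundary point is level with the bottom of the box, and a short step along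
  -- the normal enters `B`, which lies above `h`. This serves the degenerate case `x₂ = ε`, possible
  -- only for `ε = h`.
  have hlow : (S.curve i s).2 = h → 0 ≤ (S.normal i s).2 := by
    intro heq
    obtain ⟨t, ht, ht0⟩ := ((S.one_sided i s).and self_mem_nhdsWithin).exists
    have ht1 := (hbox _ ht.1).2.1
    have ht2 : h < (S.curve i s).2 + t * (S.normal i s).2 := by simpa [normal] using ht1
    rw [heq] at ht2
    have ht3 : 0 < t * (S.normal i s).2 := by linarith
    exact (pos_of_mul_pos_right ht3 (le_of_lt ht0)).le
  have e1 : S.fieldNormal 1 i s = ((S.curve i s).1 * (S.normal i s).1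
      * ((S.curve i s).1 ^ 2 - (S.curve i s).2 ^ 2)
      + 2 * ((S.curve i s).1 ^ 2 * (S.normal i s).2) * (S.curve i s).2)
        / ((S.curve i s).1 ^ 2 + (S.curve i s).2 ^ 2) := by
    simp only [fieldNormal, field1, field2, add_zero]
    field_simp
    ring
  have e2 : 0 ≤ (S.curve i s).1 * (S.normal i s).1
      * ((S.curve i s).1 ^ 2 - ((S.curve i s).2 - ε) ^ 2)
      + 2 * ((S.curve i s).1 ^ 2 * (S.normal i s).2) * ((S.curve i s).2 - ε) := by
    linarith
  rw [e1, fieldNormal_zero_eq, div_mul_div_comm, le_div_iff₀ (by positivity)]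
  generalize hN : (S.curve i s).1 * (S.normal i s).1 = N at *
  have hN0 : (S.curve i s).1 = 0 → N = 0 := fun h0 => by rw [← hN, h0, zero_mul]
  refine neg_mul_le_of_conditions hε (hεh.trans hy) hH c1 hN0 (fun heq => ?_) e2
  exact mul_nonneg (sq_nonneg _) (hlow (le_antisymm (heq.le.trans hεh) hy))

end SmoothBoundary

/-! ### Estimates of the boundary and surface terms. -/

/-- A weighted Young inequality. -/
lemma young_le {m₁ m₂ K a b z s : ℝ} (hK : 0 ≤ K) (h : m₁ ^ 2 + m₂ ^ 2 ≤ K ^ 2) (hz : 0 ≤ z)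
    (hs : 0 < s) : (m₁ * a + m₂ * b) * z ≤ K / 2 * (s * z ^ 2 + (a ^ 2 + b ^ 2) / s) := by
  set w := Real.sqrt (a ^ 2 + b ^ 2) with hw
  have hw0 : 0 ≤ w := Real.sqrt_nonneg _
  have hw2 : w ^ 2 = a ^ 2 + b ^ 2 := Real.sq_sqrt (by positivity)
  have h1 : m₁ * a + m₂ * b ≤ K * w := by
    refine le_of_sq_le_sq ?_ (by positivity)
    rw [mul_pow, hw2]
    have h2 : (m₁ * a + m₂ * b) ^ 2 ≤ (m₁ ^ 2 + m₂ ^ 2) * (a ^ 2 + b ^ 2) := by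
      nlinarith [sq_nonneg (m₁ * b - m₂ * a)]
    exact h2.trans (mul_le_mul_of_nonneg_right h (by positivity))
  have h3 : 2 * (w * z) ≤ s * z ^ 2 + w ^ 2 / s := by
    have : s * z ^ 2 + w ^ 2 / s - 2 * (w * z) = (s * z - w) ^ 2 / s := by
      field_simp
      ring
    have h4 : 0 ≤ (s * z - w) ^ 2 / s := by positivity
    linarith
  rw [← hw2]
  calc _ ≤ K * w * z := mul_le_mul_of_nonneg_right h1 hz
    _ = K / 2 * (2 * (w * z)) := by ring
    _ ≤ _ := mul_le_mul_of_nonneg_left h3 (by positivity)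

lemma weight0Sq_pos {ν : ℝ} (hν : 0 < ν) (L : ℝ) (x : ℝ × ℝ) : 0 < weight0Sq ν L x := by
  unfold weight0Sq; positivity

/-- The weight pays for the growth `|x.1|` of the multiplier fields in the source term. -/
lemma weight0Sq_mul_le {ν : ℝ} (hν : 0 < ν) (L : ℝ) (x : ℝ × ℝ) :
    weight0Sq ν L x * x.1 ^ 2 ≤ 1 := by
  unfold weight0Sq
  rw [div_mul_eq_mul_div, div_le_one (by positivity)]
  nlinarith [sq_nonneg (L * ν), sq_nonneg (ν * x.2)]

lemma sq_le_inv_weight0Sq {ν : ℝ} (hν : 0 < ν) (L : ℝ) (x : ℝ × ℝ) :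
    x.1 ^ 2 ≤ (weight0Sq ν L x)⁻¹ := by
  rw [← one_div, le_div_iff₀ (weight0Sq_pos hν L x), mul_comm]
  exact weight0Sq_mul_le hν L x

lemma continuous_weight0Sq {ν : ℝ} (hν : 0 < ν) (L : ℝ) : Continuous (weight0Sq ν L) := by
  unfold weight0Sq
  refine Continuous.div (by fun_prop) (by fun_prop) fun x => ?_
  positivity

lemma weight1Sq_pos {ν L H : ℝ} (hν : 0 < ν) (hL : 0 < L) (hH : 0 < H) : 0 < weight1Sq ν L H := by
  unfold weight1Sq; positivity

lemma inv_le_inv_weight2Sq {ν : ℝ} (hν : 0 < ν) (t : ℝ) : ν⁻¹ ≤ (weight2Sq ν t)⁻¹ := by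
  unfold weight2Sq
  rw [inv_div, inv_eq_one_div]
  gcongr
  nlinarith [sq_nonneg (ν * t)]

namespace SmoothBoundary

variable {B : Set (ℝ × ℝ)} (S : SmoothBoundary B)

lemma lineIntegral_mono {F G : Fin S.m → ℝ → ℝ} (hF : ∀ i, Continuous (F i))
    (hG : ∀ i, Continuous (G i)) (h : ∀ i s, F i s ≤ G i s) :
    S.lineIntegral F ≤ S.lineIntegral G := by
  unfold lineIntegral
  exact Finset.sum_le_sum fun i _ => intervalIntegral.integral_mono (S.len_pos i).le
    ((hF i).intervalIntegrable _ _) ((hG i).intervalIntegrable _ _) (h i)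

lemma lineIntegral_add {F G : Fin S.m → ℝ → ℝ} (hF : ∀ i, Continuous (F i))
    (hG : ∀ i, Continuous (G i)) :
    S.lineIntegral (fun i s => F i s + G i s) = S.lineIntegral F + S.lineIntegral G := by
  unfold lineIntegral
  rw [← Finset.sum_add_distrib]
  exact Finset.sum_congr rfl fun i _ => intervalIntegral.integral_add
    ((hF i).intervalIntegrable _ _) ((hG i).intervalIntegrable _ _)

lemma lineIntegral_const_mul (a : ℝ) (F : Fin S.m → ℝ → ℝ) :
    S.lineIntegral (fun i s => a * F i s) = a * S.lineIntegral F := by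
  unfold lineIntegral
  rw [Finset.mul_sum]
  exact Finset.sum_congr rfl fun i _ => intervalIntegral.integral_const_mul _ _

lemma lineIntegral_nonneg {F : Fin S.m → ℝ → ℝ} (h : ∀ i s, 0 ≤ F i s) : 0 ≤ S.lineIntegral F :=
  Finset.sum_nonneg fun i _ => intervalIntegral.integral_nonneg (S.len_pos i).le fun s _ => h i s

lemma lineIntegral_deriv_eq_zero {F F' : Fin S.m → ℝ → ℝ}
    (hF : ∀ i s, HasDerivAt (F i) (F' i s) s) (hF' : ∀ i, Continuous (F' i))
    (hp : ∀ i, Function.Periodic (F i) (S.len i)) : S.lineIntegral F' = 0 := by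
  unfold lineIntegral
  refine Finset.sum_eq_zero fun i _ => ?_
  rw [intervalIntegral.integral_eq_sub_of_hasDerivAt (fun s _ => hF i s)
    ((hF' i).intervalIntegrable _ _)]
  have := hp i 0
  rw [zero_add] at this
  rw [this, sub_self]

lemma contDiff_normal (i : Fin S.m) : ContDiff ℝ ∞ (S.normal i) := by
  have := contDiff_deriv_curve (S.smooth i)
  exact (contDiff_snd.comp this).neg.prodMk (contDiff_fst.comp this)

lemma contDiff_normalDeriv {u : ℝ × ℝ → ℝ} (hu : ContDiff ℝ ∞ u) (i : Fin S.m) :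
    ContDiff ℝ ∞ (S.normalDeriv u i) :=
  ((hu.fderiv_right (m := ∞) (by simp)).comp (S.smooth i)).clm_apply (S.contDiff_normal i)

lemma contDiff_arcDeriv {u : ℝ × ℝ → ℝ} (hu : ContDiff ℝ ∞ u) (i : Fin S.m) :
    ContDiff ℝ ∞ (S.arcDeriv u i) :=
  ((hu.fderiv_right (m := ∞) (by simp)).comp (S.smooth i)).clm_apply
    (contDiff_deriv_curve (S.smooth i))

lemma contDiff_field_curve (hB : IsSubmergedBody B) (α : ℝ) (i : Fin S.m) :
    ContDiff ℝ ∞ (fun s => field1 α 0 (S.curve i s)) ∧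
      ContDiff ℝ ∞ (fun s => field2 α 0 (S.curve i s)) := by
  have h1 : ContDiff ℝ ∞ fun s => (S.curve i s).1 := contDiff_fst.comp (S.smooth i)
  have h2 : ContDiff ℝ ∞ fun s => (S.curve i s).2 := contDiff_snd.comp (S.smooth i)
  have hD : ∀ s, (S.curve i s).1 ^ 2 + (S.curve i s).2 ^ 2 + 0 ≠ 0 := fun s => by
    rw [add_zero]; exact S.curve_sq_ne_zero hB i s
  exact ⟨h1.sub ((contDiff_const.mul (h1.mul (h2.pow 2))).div
      (((h1.pow 2).add (h2.pow 2)).add contDiff_const) hD),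
    (contDiff_const.mul ((h1.pow 2).mul h2)).div
      (((h1.pow 2).add (h2.pow 2)).add contDiff_const) hD⟩

lemma contDiff_fieldNormal (hB : IsSubmergedBody B) (α : ℝ) (i : Fin S.m) :
    ContDiff ℝ ∞ (S.fieldNormal α i) :=
  ((S.contDiff_field_curve hB α i).1.mul (contDiff_fst.comp (S.contDiff_normal i))).add
    ((S.contDiff_field_curve hB α i).2.mul (contDiff_snd.comp (S.contDiff_normal i)))

lemma contDiff_fieldTangent (hB : IsSubmergedBody B) (α : ℝ) (i : Fin S.m) :
    ContDiff ℝ ∞ (S.fieldTangent α i) :=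
  have h := contDiff_deriv_curve (S.smooth i)
  ((S.contDiff_field_curve hB α i).1.mul (contDiff_fst.comp h)).add
    ((S.contDiff_field_curve hB α i).2.mul (contDiff_snd.comp h))

lemma hasDerivAt_comp_curve {u : ℝ × ℝ → ℝ} (hu : ContDiff ℝ ∞ u) (i : Fin S.m) (s : ℝ) :
    HasDerivAt (fun s => u (S.curve i s)) (S.arcDeriv u i s) s :=
  (hu.differentiable (by simp) _).hasFDerivAt.comp_hasDerivAt s
    ((S.smooth i).differentiable (by simp) s).hasDerivAt

/-- The integrand on the boundary, up to an exact derivative. -/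
lemma boundary_integrand_eq (α : ℝ) (u : ℝ × ℝ → ℝ) (i : Fin S.m) (s : ℝ) :
    multiplier α 0 u (S.curve i s) * fderiv ℝ u (S.curve i s) (S.normal i s)
        - grad2 u (S.curve i s) * (field1 α 0 (S.curve i s) * (S.normal i s).1
          + field2 α 0 (S.curve i s) * (S.normal i s).2)
      = S.fieldNormal α i s * S.normalDeriv u i s ^ 2
        + 2 * (S.fieldTangent α i s * S.arcDeriv u i s * S.normalDeriv u i s)
        + u (S.curve i s) * S.normalDeriv u i s
        - S.fieldNormal α i s * S.arcDeriv u i s ^ 2 := by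
  have h := S.unit_speed i s
  simp only [fieldNormal, fieldTangent, normalDeriv, arcDeriv, fderiv_apply_eq, multiplier, grad2,
    normal]
  generalize (deriv (S.curve i) s).1 = a at *
  generalize (deriv (S.curve i) s).2 = b at *
  generalize dx u (S.curve i s) = p
  generalize dy u (S.curve i s) = q
  generalize field1 α 0 (S.curve i s) = f
  generalize field2 α 0 (S.curve i s) = g
  linear_combination (-2 * (f * p + g * q) * (-b * p + a * q)
    + (p ^ 2 + q ^ 2) * (f * -b + g * a)) * h

/-- The estimate of the boundary terms of the integral identity. -/
lemma boundary_le (hB : IsSubmergedBody B) {κ L H ν : ℝ} (hκ : 0 ≤ κ) (hL : 0 < L) (hH : 0 < H)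
    (hν : 0 < ν) (hx : ∀ i s, |(S.curve i s).1| ≤ L) (hcurv : ∀ i s, |S.curvature i s| ≤ κ)
    {α m K : ℝ} (hα : α = 0 ∨ α = 1) (hm : ∀ i s, |1 - 2 * S.fieldStrain α i s| ≤ m) (hK : 0 ≤ K)
    (hmK : m ^ 2 + 2 ^ 2 ≤ K ^ 2) {u : ℝ × ℝ → ℝ} (hu : ContDiff ℝ ∞ u) {t : ℝ} (ht : 0 < t) :
    S.lineIntegral (fun i s => multiplier α 0 u (S.curve i s)
          * fderiv ℝ u (S.curve i s) (S.normal i s)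
        - grad2 u (S.curve i s) * (field1 α 0 (S.curve i s) * (S.normal i s).1
          + field2 α 0 (S.curve i s) * (S.normal i s).2))
      ≤ (K + 2 * (κ * L)) / 2 * (t * S.lineIntegral (fun i s =>
            weight1Sq ν L H * u (S.curve i s) ^ 2)
          + t⁻¹ * (S.lineIntegral (fun i s => (weight1Sq ν L H)⁻¹ * S.normalDeriv u i s ^ 2)
            + S.lineIntegral (fun i s => (weight1Sq ν L H)⁻¹
              * ((S.curve i s).1 ^ 2 * deriv (S.normalDeriv u i) s ^ 2))))
        + S.lineIntegral (fun i s => (weight1Sq ν L H)⁻¹ * S.normalDeriv u i s ^ 2)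
        + S.lineIntegral (fun i s => -S.fieldNormal α i s * S.arcDeriv u i s ^ 2) := by
  set γ := weight1Sq ν L H with hγ
  have hγ0 : 0 < γ := weight1Sq_pos hν hL hH
  -- Since `γ₁⁻² = L + ν⁻¹ + H`, the term `V_n |∂_n u|²` with `|V_n| ≤ L` is bounded by the data
  -- with coefficient one.
  have hLγ : L ≤ γ⁻¹ := by
    rw [hγ, weight1Sq, inv_inv]
    have : 0 < ν⁻¹ := by positivity
    linarith
  have cu : ∀ i, Continuous fun s => u (S.curve i s) := fun i =>
    hu.continuous.comp (S.continuous_curve i)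
  have cx : ∀ i, Continuous fun s => (S.curve i s).1 := fun i =>
    continuous_fst.comp (S.continuous_curve i)
  have cg : ∀ i, Continuous (S.normalDeriv u i) := fun i => (S.contDiff_normalDeriv hu i).continuous
  have cg' : ∀ i, Continuous (deriv (S.normalDeriv u i)) := fun i =>
    (S.contDiff_normalDeriv hu i).continuous_deriv (by simp)
  have ca : ∀ i, Continuous (S.arcDeriv u i) := fun i => (S.contDiff_arcDeriv hu i).continuous
  have cn : ∀ i, Continuous (S.fieldNormal α i) := fun i =>
    (S.contDiff_fieldNormal hB α i).continuous
  have ct : ∀ i, Continuous (S.fieldTangent α i) := fun i =>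
    (S.contDiff_fieldTangent hB α i).continuous
  have ct' : ∀ i, Continuous (deriv (S.fieldTangent α i)) := fun i =>
    (S.contDiff_fieldTangent hB α i).continuous_deriv (by simp)
  -- The mixed term `2 V_t ∂_σ u ∂_n u` is part of the derivative of `2 u V_t ∂_n u`, whose integral
  -- over closed curves is zero. What replaces it contains `u`, the data and `∂_σ` of the data, but
  -- no derivative of `u` along `S`.
  have hder : ∀ i s, HasDerivAt
      (fun s => 2 * (u (S.curve i s) * (S.fieldTangent α i s * S.normalDeriv u i s)))
      (2 * (S.arcDeriv u i s * (S.fieldTangent α i s * S.normalDeriv u i s)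
        + u (S.curve i s) * (deriv (S.fieldTangent α i) s * S.normalDeriv u i s
          + S.fieldTangent α i s * deriv (S.normalDeriv u i) s))) s := fun i s =>
    ((S.hasDerivAt_comp_curve hu i s).mul
      ((((S.contDiff_fieldTangent hB α i).differentiable (by simp) s).hasDerivAt).mul
        ((S.contDiff_normalDeriv hu i).differentiable (by simp) s).hasDerivAt)).const_mul 2
  have d0 : ∀ i, Continuous fun s => 2 * (S.arcDeriv u i s * (S.fieldTangent α i s
      * S.normalDeriv u i s) + u (S.curve i s) * (deriv (S.fieldTangent α i) s
        * S.normalDeriv u i s + S.fieldTangent α i s * deriv (S.normalDeriv u i) s)) := fun i =>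
    (((ca i).mul ((ct i).mul (cg i))).add ((cu i).mul
      (((ct' i).mul (cg i)).add ((ct i).mul (cg' i))))).const_mul 2
  have d1 : ∀ i, Continuous fun s => γ * u (S.curve i s) ^ 2 := fun i =>
    ((cu i).pow 2).const_mul γ
  have d2 : ∀ i, Continuous fun s => γ⁻¹ * S.normalDeriv u i s ^ 2 := fun i =>
    ((cg i).pow 2).const_mul _
  have d3 : ∀ i, Continuous fun s => γ⁻¹ * ((S.curve i s).1 ^ 2 * deriv (S.normalDeriv u i) s ^ 2) :=
    fun i => (((cx i).pow 2).mul ((cg' i).pow 2)).const_mul _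
  have d4 : ∀ i, Continuous fun s => -S.fieldNormal α i s * S.arcDeriv u i s ^ 2 := fun i =>
    (cn i).neg.mul ((ca i).pow 2)
  have d5 : ∀ i, Continuous fun s => (K + 2 * (κ * L)) / 2 * (t * (γ * u (S.curve i s) ^ 2)
      + t⁻¹ * (γ⁻¹ * S.normalDeriv u i s ^ 2
        + γ⁻¹ * ((S.curve i s).1 ^ 2 * deriv (S.normalDeriv u i) s ^ 2))) := fun i =>
    (((d1 i).const_mul t).add (((d2 i).add (d3 i)).const_mul _)).const_mul _
  have d6 : ∀ i, Continuous fun s => (K + 2 * (κ * L)) / 2 * (t * (γ * u (S.curve i s) ^ 2)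
      + t⁻¹ * (γ⁻¹ * S.normalDeriv u i s ^ 2
        + γ⁻¹ * ((S.curve i s).1 ^ 2 * deriv (S.normalDeriv u i) s ^ 2)))
      + γ⁻¹ * S.normalDeriv u i s ^ 2 := fun i => (d5 i).add (d2 i)
  have d7 : ∀ i, Continuous fun s => (K + 2 * (κ * L)) / 2 * (t * (γ * u (S.curve i s) ^ 2)
      + t⁻¹ * (γ⁻¹ * S.normalDeriv u i s ^ 2
        + γ⁻¹ * ((S.curve i s).1 ^ 2 * deriv (S.normalDeriv u i) s ^ 2)))
      + γ⁻¹ * S.normalDeriv u i s ^ 2 + -S.fieldNormal α i s * S.arcDeriv u i s ^ 2 := fun i =>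
    (d6 i).add (d4 i)
  have d8 : ∀ i, Continuous fun s => t * (γ * u (S.curve i s) ^ 2) := fun i => (d1 i).const_mul t
  have d9 : ∀ i, Continuous fun s => t⁻¹ * (γ⁻¹ * S.normalDeriv u i s ^ 2
      + γ⁻¹ * ((S.curve i s).1 ^ 2 * deriv (S.normalDeriv u i) s ^ 2)) := fun i =>
    ((d2 i).add (d3 i)).const_mul _
  have hzero := S.lineIntegral_deriv_eq_zero hder d0 (fun i s => by
    simp only [S.periodic i s, fieldTangent, normalDeriv, S.periodic_deriv i s,
      S.periodic_normal i s])
  have hmono : S.lineIntegral (fun i s => multiplier α 0 u (S.curve i s)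
          * fderiv ℝ u (S.curve i s) (S.normal i s)
        - grad2 u (S.curve i s) * (field1 α 0 (S.curve i s) * (S.normal i s).1
          + field2 α 0 (S.curve i s) * (S.normal i s).2))
      ≤ S.lineIntegral (fun i s => 2 * (S.arcDeriv u i s * (S.fieldTangent α i s
            * S.normalDeriv u i s)
          + u (S.curve i s) * (deriv (S.fieldTangent α i) s * S.normalDeriv u i s
            + S.fieldTangent α i s * deriv (S.normalDeriv u i) s))
        + ((K + 2 * (κ * L)) / 2 * (t * (γ * u (S.curve i s) ^ 2)
          + t⁻¹ * (γ⁻¹ * S.normalDeriv u i s ^ 2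
            + γ⁻¹ * ((S.curve i s).1 ^ 2 * deriv (S.normalDeriv u i) s ^ 2)))
        + γ⁻¹ * S.normalDeriv u i s ^ 2
        + -S.fieldNormal α i s * S.arcDeriv u i s ^ 2)) := by
    refine S.lineIntegral_mono (fun i => ?_) (fun i => ?_) (fun i s => ?_)
    · simp only [S.boundary_integrand_eq α u]
      exact ((((cn i).mul ((cg i).pow 2)).add ((((ct i).mul (ca i)).mul (cg i)).const_mul 2)).add
        ((cu i).mul (cg i))).sub ((cn i).mul ((ca i).pow 2))
    · exact (d0 i).add (d7 i)
    · rw [S.boundary_integrand_eq α u, (S.hasDerivAt_fieldTangent hB α i s).deriv]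
      have b1 := S.abs_fieldNormal_le hB hα i s
      have b2 := S.abs_fieldTangent_le hB hα i s
      have b3 := hm i s
      have b4 := hcurv i s
      have b5 := hx i s
      generalize (S.curve i s).1 = x at *
      generalize S.fieldNormal α i s = N at *
      generalize S.fieldTangent α i s = T at *
      generalize S.fieldStrain α i s = D at *
      generalize S.curvature i s = k at *
      generalize S.arcDeriv u i s = a
      generalize deriv (S.normalDeriv u i) s = g'
      generalize S.normalDeriv u i s = g
      generalize u (S.curve i s) = w
      have hs : 0 < t * γ := by positivity
      -- The pair `(m, 2)` consists of the coefficients of `g` and of `x * g'`. The curvature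
      -- coefficient `2 * (κ * L)` belongs to `g` alone and is treated separately in `y2`, so that
      -- it enters the constant additively.
      have y1 := young_le (m₁ := m) (m₂ := 2) (a := |g|) (b := |x| * |g'|) (z := |w|) hK hmK
        (abs_nonneg _) hs
      have y2 := young_le (m₁ := 2 * (κ * L)) (m₂ := 0) (a := |g|) (b := |x| * |g'|) (z := |w|)
        (K := 2 * (κ * L)) (by positivity) (by simp) (abs_nonneg _) hs
      have e1 : t * γ * |w| ^ 2 + (|g| ^ 2 + (|x| * |g'|) ^ 2) / (t * γ)
          = t * (γ * w ^ 2) + t⁻¹ * (γ⁻¹ * g ^ 2 + γ⁻¹ * (x ^ 2 * g' ^ 2)) := by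
        rw [mul_pow, sq_abs, sq_abs, sq_abs, sq_abs]
        field_simp
      rw [e1] at y1 y2
      have z1 : N * g ^ 2 ≤ γ⁻¹ * g ^ 2 := mul_le_mul_of_nonneg_right
        (((le_abs_self N).trans b1).trans (b5.trans hLγ)) (sq_nonneg _)
      have z2 : w * g * (1 - 2 * D) ≤ m * |g| * |w| := by
        refine (le_abs_self _).trans ?_
        rw [abs_mul, abs_mul]
        calc |w| * |g| * |1 - 2 * D| ≤ |w| * |g| * m := by gcongr
          _ = _ := by ring
      have z3 : -(2 * (w * (T * g'))) ≤ 2 * (|x| * |g'|) * |w| := by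
        refine (neg_le_abs _).trans ?_
        rw [abs_mul, abs_mul, abs_mul, abs_two]
        calc 2 * (|w| * (|T| * |g'|)) ≤ 2 * (|w| * (|x| * |g'|)) := by gcongr
          _ = _ := by ring
      have z4 : -(2 * (w * (k * N * g))) ≤ 2 * (κ * L) * |g| * |w| := by
        refine (neg_le_abs _).trans ?_
        rw [abs_mul, abs_mul, abs_mul, abs_mul, abs_two]
        calc 2 * (|w| * (|k| * |N| * |g|)) ≤ 2 * (|w| * (κ * L * |g|)) := by
              gcongr; exact b1.trans b5
          _ = _ := by ring
      linarith
  refine hmono.trans (le_of_eq ?_)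
  rw [S.lineIntegral_add d0 d7, hzero, zero_add, S.lineIntegral_add d6 d4,
    S.lineIntegral_add d5 d2, S.lineIntegral_const_mul, S.lineIntegral_add d8 d9,
    S.lineIntegral_const_mul t, S.lineIntegral_const_mul t⁻¹, S.lineIntegral_add d2 d3]

end SmoothBoundary

/-- The estimate of the surface term of the integral identity. -/
lemma surface_le {ν : ℝ} (hν : 0 < ν) {K : ℝ} (hK : 0 ≤ K) (hK5 : 5 ≤ K ^ 2) {u : ℝ × ℝ → ℝ}
    (hu : ContDiff ℝ ∞ u) {g : ℝ → ℝ} (hg : ContDiff ℝ ∞ g) (hgc : HasCompactSupport g)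
    (htrace : Integrable fun t : ℝ => u (t, 0) ^ 2) {t : ℝ} (ht : 0 < t) :
    ∫ x : ℝ, (2 * x * dx u (x, 0) + u (x, 0)) * g x
      ≤ K / 2 * (t * (ν * ∫ x : ℝ, u (x, 0) ^ 2)
        + t⁻¹ * ((∫ x : ℝ, (weight2Sq ν x)⁻¹ * g x ^ 2)
          + ν⁻¹ * ∫ x : ℝ, x ^ 2 * deriv g x ^ 2)) := by
  have hl : Continuous fun t : ℝ => ((t, 0) : ℝ × ℝ) := by fun_prop
  have cu : Continuous fun t : ℝ => u (t, 0) := hu.continuous.comp hl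
  have cu1 : Continuous fun t : ℝ => dx u (t, 0) := (contDiff_dx hu).continuous.comp hl
  have cg := hg.continuous
  have cg' := hg.continuous_deriv (by simp)
  have hgc' := hgc.deriv
  have cw : Continuous fun x : ℝ => (weight2Sq ν x)⁻¹ := by
    unfold weight2Sq
    refine Continuous.inv₀ (Continuous.div (by fun_prop) (by fun_prop) fun x => by positivity)
      fun x => by positivity
  have i1 : Integrable fun x : ℝ => (2 * x * dx u (x, 0) + u (x, 0)) * g x :=
    Continuous.integrable_of_hasCompactSupport (by fun_prop) hgc.mul_left
  have i2 : Integrable fun x : ℝ => 2 * (x * u (x, 0) * g x) :=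
    Continuous.integrable_of_hasCompactSupport (by fun_prop) hgc.mul_left.mul_left
  have i3 : Integrable fun x : ℝ => u (x, 0) * g x :=
    Continuous.integrable_of_hasCompactSupport (by fun_prop) hgc.mul_left
  have i4 : Integrable fun x : ℝ => 2 * (x * u (x, 0)) * deriv g x :=
    Continuous.integrable_of_hasCompactSupport (by fun_prop) hgc'.mul_left
  have hsq : ∀ {f : ℝ → ℝ}, HasCompactSupport f → HasCompactSupport fun x => f x ^ 2 := by
    intro f hf
    simp only [sq]
    exact hf.mul_left
  have i5 : Integrable fun x : ℝ => (weight2Sq ν x)⁻¹ * g x ^ 2 :=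
    Continuous.integrable_of_hasCompactSupport (by fun_prop) (hsq hgc).mul_left
  have i6 : Integrable fun x : ℝ => x ^ 2 * deriv g x ^ 2 :=
    Continuous.integrable_of_hasCompactSupport (by fun_prop) (hsq hgc').mul_left
  have i7 : Integrable fun x : ℝ => 2 * ((u (x, 0) + x * dx u (x, 0)) * g x
      + x * u (x, 0) * deriv g x) :=
    ((Continuous.integrable_of_hasCompactSupport (by fun_prop) hgc.mul_left).add
      (Continuous.integrable_of_hasCompactSupport (by fun_prop) hgc'.mul_left)).const_mul 2
  -- Subtracting the derivative of `2 x u g` removes `∂₁u` from the surface. The coefficients left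
  -- for `g` and `x * deriv g` are `1` and `2` in modulus, which explains `5 ≤ K ^ 2`.
  have hparts : ∫ x : ℝ, 2 * ((u (x, 0) + x * dx u (x, 0)) * g x + x * u (x, 0) * deriv g x)
      = 0 := by
    refine integral_eq_zero_of_hasDerivAt_of_integrable (fun x => ?_) i7 i2
    refine ((((hasDerivAt_id x).mul (hasDerivAt_horizontal hu 0 x)).mul
      (hg.differentiable (by simp) x).hasDerivAt).const_mul 2).congr_deriv ?_
    simp [id]
  have e1 : ∫ x : ℝ, (2 * x * dx u (x, 0) + u (x, 0)) * g x
      = ∫ x : ℝ, (-(u (x, 0) * g x) - 2 * (x * u (x, 0)) * deriv g x) := by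
    have h := integral_sub i1 i7
    rw [hparts, sub_zero] at h
    rw [← h]
    refine integral_congr_ae (ae_of_all _ fun x => ?_)
    dsimp only
    ring
  rw [e1]
  have i8 : Integrable fun x : ℝ => -(u (x, 0) * g x) - 2 * (x * u (x, 0)) * deriv g x :=
    i3.neg.sub i4
  have i9 : Integrable fun x : ℝ => t * (ν * u (x, 0) ^ 2) := (htrace.const_mul ν).const_mul t
  have i10 : Integrable fun x : ℝ => ν⁻¹ * (x ^ 2 * deriv g x ^ 2) := i6.const_mul _
  have i11 : Integrable fun x : ℝ => (weight2Sq ν x)⁻¹ * g x ^ 2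
      + ν⁻¹ * (x ^ 2 * deriv g x ^ 2) := i5.add i10
  have i12 : Integrable fun x : ℝ => t⁻¹ * ((weight2Sq ν x)⁻¹ * g x ^ 2
      + ν⁻¹ * (x ^ 2 * deriv g x ^ 2)) := i11.const_mul _
  have i13 : Integrable fun x : ℝ => K / 2 * (t * (ν * u (x, 0) ^ 2)
      + t⁻¹ * ((weight2Sq ν x)⁻¹ * g x ^ 2 + ν⁻¹ * (x ^ 2 * deriv g x ^ 2))) :=
    (i9.add i12).const_mul _
  have hle := integral_mono i8 i13 fun x => by
    dsimp only
    have y := young_le (m₁ := 1) (m₂ := 2) (a := |g x|) (b := |x| * |deriv g x|)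
      (z := |u (x, 0)|) hK (by linarith) (abs_nonneg _) (mul_pos ht hν)
    have e : t * ν * |u (x, 0)| ^ 2 + (|g x| ^ 2 + (|x| * |deriv g x|) ^ 2) / (t * ν)
        = t * (ν * u (x, 0) ^ 2) + t⁻¹ * (ν⁻¹ * g x ^ 2 + ν⁻¹ * (x ^ 2 * deriv g x ^ 2)) := by
      rw [mul_pow, sq_abs, sq_abs, sq_abs, sq_abs]
      field_simp
    rw [e] at y
    have z1 : -(u (x, 0) * g x) ≤ 1 * |g x| * |u (x, 0)| := by
      refine (neg_le_abs _).trans (le_of_eq ?_)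
      rw [abs_mul]; ring
    have z2 : -(2 * (x * u (x, 0)) * deriv g x) ≤ 2 * (|x| * |deriv g x|) * |u (x, 0)| := by
      refine (neg_le_abs _).trans (le_of_eq ?_)
      rw [abs_mul, abs_mul, abs_mul, abs_two]; ring
    have z3 : ν⁻¹ * g x ^ 2 ≤ (weight2Sq ν x)⁻¹ * g x ^ 2 :=
      mul_le_mul_of_nonneg_right (inv_le_inv_weight2Sq hν x) (sq_nonneg _)
    have z4 : K / 2 * (t⁻¹ * (ν⁻¹ * g x ^ 2)) ≤ K / 2 * (t⁻¹ * ((weight2Sq ν x)⁻¹ * g x ^ 2)) := by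
      gcongr
    linarith
  refine hle.trans (le_of_eq ?_)
  rw [integral_const_mul, integral_add i9 i12, integral_const_mul, integral_const_mul,
    integral_const_mul, integral_add i5 i10, integral_const_mul]

/-! ### The source term and the estimate for real solutions. -/

section water

variable {B : Set (ℝ × ℝ)}

/-- The source term of the integral identity is integrable. -/
lemma integrableOn_source {ν L : ℝ} (hν : 0 < ν) {u : ℝ × ℝ → ℝ} (hu : ContDiff ℝ ∞ u)
    (hgrad : IntegrableOn (grad2 u) (water B))
    (hweight : IntegrableOn (fun x => weight0Sq ν L x * u x ^ 2) (water B))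
    (hlap : IntegrableOn (fun x => (weight0Sq ν L x)⁻¹ * lap u x ^ 2) (water B)) :
    IntegrableOn
      (fun x => (2 * (|x.1| * (|dx u x| + |dy u x|)) + |u x|) * |lap u x|) (water B) := by
  have hdom : IntegrableOn (fun x => grad2 u x + weight0Sq ν L x * u x ^ 2
      + 3 * ((weight0Sq ν L x)⁻¹ * lap u x ^ 2)) (water B) :=
    (hgrad.add hweight).add (hlap.const_mul 3)
  refine hdom.mono' ?_ (ae_of_all _ fun x => ?_)
  · have h1 := (contDiff_dx hu).continuous
    have h2 := (contDiff_dy hu).continuous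
    have h3 := continuous_lap hu
    have h4 := hu.continuous
    exact Continuous.aestronglyMeasurable (by fun_prop)
  · rw [Real.norm_eq_abs, abs_of_nonneg (by positivity)]
    have hw := weight0Sq_pos hν L x
    have hx := sq_le_inv_weight0Sq hν L x
    have t1 : ∀ a : ℝ, 2 * (|x.1| * |a|) * |lap u x| ≤ a ^ 2
        + (weight0Sq ν L x)⁻¹ * lap u x ^ 2 := by
      intro a
      have h1 : x.1 ^ 2 * lap u x ^ 2 ≤ (weight0Sq ν L x)⁻¹ * lap u x ^ 2 :=
        mul_le_mul_of_nonneg_right hx (sq_nonneg _)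
      have h2 := two_mul_le_add_sq |a| (|x.1| * |lap u x|)
      rw [mul_pow, sq_abs, sq_abs, sq_abs] at h2
      linarith
    have t2 : |u x| * |lap u x| ≤ weight0Sq ν L x * u x ^ 2
        + (weight0Sq ν L x)⁻¹ * lap u x ^ 2 := by
      have y := young_le (m₁ := 1) (m₂ := 0) (K := 1) (a := |lap u x|) (b := 0) (z := |u x|)
        one_pos.le (by norm_num) (abs_nonneg _) hw
      rw [sq_abs, sq_abs] at y
      have h1 : (lap u x ^ 2 + 0 ^ 2) / weight0Sq ν L x = (weight0Sq ν L x)⁻¹ * lap u x ^ 2 := by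
        field_simp; ring
      rw [h1] at y
      have h3 : 0 ≤ weight0Sq ν L x * u x ^ 2 := by positivity
      have h4 : 0 ≤ (weight0Sq ν L x)⁻¹ * lap u x ^ 2 := by positivity
      linarith
    have t3 := t1 (dx u x)
    have t4 := t1 (dy u x)
    have : grad2 u x = dx u x ^ 2 + dy u x ^ 2 := rfl
    linarith

/-- The estimate of the source term of the integral identity. -/
lemma source_le {ν L : ℝ} (hν : 0 < ν) {α K : ℝ} (hα : α = 0 ∨ α = 1) (hK : 0 ≤ K)
    (hK5 : 5 ≤ K ^ 2) {u : ℝ × ℝ → ℝ} (hgrad : IntegrableOn (grad2 u) (water B))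
    (hweight : IntegrableOn (fun x => weight0Sq ν L x * u x ^ 2) (water B))
    (hlap : IntegrableOn (fun x => (weight0Sq ν L x)⁻¹ * lap u x ^ 2) (water B))
    {t : ℝ} (ht : 0 < t) :
    -∫ x in water B, multiplier α 0 u x * lap u x
      ≤ K / 2 * (t * ((∫ x in water B, weight0Sq ν L x * u x ^ 2) + ∫ x in water B, grad2 u x)
        + t⁻¹ * ∫ x in water B, (weight0Sq ν L x)⁻¹ * lap u x ^ 2) := by
  have i1 : IntegrableOn (fun x => weight0Sq ν L x * u x ^ 2 + grad2 u x) (water B) :=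
    hweight.add hgrad
  have i2 : IntegrableOn (fun x => t * (weight0Sq ν L x * u x ^ 2 + grad2 u x)) (water B) :=
    i1.const_mul t
  have i3 : IntegrableOn (fun x => t⁻¹ * ((weight0Sq ν L x)⁻¹ * lap u x ^ 2)) (water B) :=
    hlap.const_mul _
  have i4 : IntegrableOn (fun x => K / 2 * (t * (weight0Sq ν L x * u x ^ 2 + grad2 u x)
      + t⁻¹ * ((weight0Sq ν L x)⁻¹ * lap u x ^ 2))) (water B) := (i2.add i3).const_mul _
  rw [← integral_add hweight hgrad, ← integral_const_mul, ← integral_const_mul,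
    ← integral_add i2 i3, ← integral_const_mul]
  refine (neg_le_abs _).trans ?_
  rw [← Real.norm_eq_abs]
  refine norm_integral_le_of_norm_le i4 ?_
  refine (ae_restrict_mem (isOpen_water B).measurableSet).mono fun x hx => ?_
  have hx0 : x.1 ^ 2 + x.2 ^ 2 ≠ 0 := by
    have : 0 < x.2 := hx.1
    positivity
  have hw := weight0Sq_pos hν L x
  have g0 := grad2_nonneg u x
  have hV : |field1 α 0 x * dx u x + field2 α 0 x * dy u x| ≤ |x.1| * Real.sqrt (grad2 u x) := by
    refine abs_le_of_sq_le_sq ?_ (by positivity)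
    rw [mul_pow, sq_abs, Real.sq_sqrt g0, ← SmoothBoundary.field_sq hα hx0, grad2]
    nlinarith [sq_nonneg (field1 α 0 x * dy u x - field2 α 0 x * dx u x)]
  have hm : |multiplier α 0 u x| ≤ 2 * (|x.1| * Real.sqrt (grad2 u x)) + 1 * |u x| := by
    unfold multiplier
    refine (abs_add_le _ _).trans ?_
    rw [abs_mul, abs_two, one_mul]
    linarith
  rw [Real.norm_eq_abs, abs_mul]
  -- Here the single factor in `young_le` is the datum `lap u`, while the pair is made from the
  -- solution; hence the parameter is inverted.
  have hs : 0 < (t * weight0Sq ν L x)⁻¹ := by positivity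
  have y := young_le (m₁ := 2) (m₂ := 1) (a := |x.1| * Real.sqrt (grad2 u x)) (b := |u x|)
    (z := |lap u x|) hK (by linarith) (abs_nonneg _) hs
  refine (mul_le_mul_of_nonneg_right hm (abs_nonneg _)).trans (y.trans ?_)
  refine mul_le_mul_of_nonneg_left ?_ (by positivity)
  rw [mul_pow, sq_abs, sq_abs, sq_abs, Real.sq_sqrt g0, div_inv_eq_mul, mul_inv]
  have h1 : t * (weight0Sq ν L x * x.1 ^ 2) * grad2 u x ≤ t * 1 * grad2 u x := by
    gcongr
    exact weight0Sq_mul_le hν L x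
  linarith

namespace SmoothBoundary

variable (S : SmoothBoundary B)

/-- The square of the norm of the solution. -/
noncomputable def solEnergy (ν L H : ℝ) (u : ℝ × ℝ → ℝ) : ℝ :=
  (∫ x in water B, weight0Sq ν L x * u x ^ 2) + (∫ x in water B, grad2 u x)
    + S.lineIntegral (fun i s => weight1Sq ν L H * u (S.curve i s) ^ 2)
    + ν * ∫ t : ℝ, u (t, 0) ^ 2

/-- The square of the norm of the data. -/
noncomputable def dataEnergy (ν L H : ℝ) (u : ℝ × ℝ → ℝ) (g : ℝ → ℝ) : ℝ :=
  (∫ x in water B, (weight0Sq ν L x)⁻¹ * lap u x ^ 2)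
    + S.lineIntegral (fun i s => (weight1Sq ν L H)⁻¹ * S.normalDeriv u i s ^ 2)
    + S.lineIntegral (fun i s => (weight1Sq ν L H)⁻¹
        * ((S.curve i s).1 ^ 2 * deriv (S.normalDeriv u i) s ^ 2))
    + (∫ t : ℝ, (weight2Sq ν t)⁻¹ * g t ^ 2)
    + ν⁻¹ * ∫ t : ℝ, t ^ 2 * deriv g t ^ 2

/-- The estimate of the first derivative for real solutions. -/
theorem integral_dx_sq_le (hB : IsSubmergedBody B) {κ L h H ε ν : ℝ} (hκ : 0 ≤ κ) (hL : 0 < L)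
    (hε : 0 < ε) (hεh : ε ≤ h) (hhH : h < H) (hν : 0 < ν)
    (hbox : ∀ x ∈ B, |x.1| < L ∧ h < x.2 ∧ x.2 < H) (hcurv : ∀ i s, |S.curvature i s| ≤ κ)
    (h₁ : Condition1 S) (h₂ : Condition2 S ε) {u : ℝ × ℝ → ℝ} (hu : ContDiff ℝ ∞ u) {g : ℝ → ℝ}
    (hgs : ContDiff ℝ ∞ g) (hgc : HasCompactSupport g)
    (hg : ∀ t, -dy u (t, 0) - ν * u (t, 0) = g t) (hgrad : IntegrableOn (grad2 u) (water B))
    (htrace : Integrable fun t : ℝ => u (t, 0) ^ 2)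
    (hweight : IntegrableOn (fun x => weight0Sq ν L x * u x ^ 2) (water B))
    (hlap : IntegrableOn (fun x => (weight0Sq ν L x)⁻¹ * lap u x ^ 2) (water B))
    {t : ℝ} (ht : 0 < t) :
    ∫ x in water B, dx u x ^ 2
      ≤ (constC4 κ L + H * constC3 κ L / (2 * ε)) / 2
          * (t * S.solEnergy ν L H u + t⁻¹ * S.dataEnergy ν L H u g)
        + (H / (2 * ε) + 1 / 2) * S.dataEnergy ν L H u g := by
  have hH : 0 < H := (hε.trans_le hεh).trans hhH
  have hsource := integrableOn_source hν hu hgrad hweight hlap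
  have hx : ∀ i s, |(S.curve i s).1| ≤ L := fun i s => (S.curve_mem_box hbox i s).1
  have hw1 := weight1Sq_pos hν hL hH
  have key : ∀ {α m K : ℝ}, (α = 0 ∨ α = 1) → 1 ≤ m →
      (∀ i s, |1 - 2 * S.fieldStrain α i s| ≤ m) → 0 ≤ K → m ^ 2 + 2 ^ 2 ≤ K ^ 2 →
      ∫ x in water B, gradForm α 0 u x
        ≤ (K + 2 * (κ * L)) / 2 * (t * S.solEnergy ν L H u + t⁻¹ * S.dataEnergy ν L H u g)
          + S.dataEnergy ν L H u g
          + S.lineIntegral (fun i s => -S.fieldNormal α i s * S.arcDeriv u i s ^ 2) := by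
    intro α m K hα hm1 hm hK hmK
    have hα₀ : 0 ≤ α := by rcases hα with rfl | rfl <;> norm_num
    have hα₁ : α ≤ 1 := by rcases hα with rfl | rfl <;> norm_num
    have hK5 : 5 ≤ K ^ 2 := by nlinarith
    have e := S.multiplier_identity hB hα₀ hα₁ hu hg hgc hgrad htrace hsource
    have b1 := source_le hν hα hK hK5 hgrad hweight hlap ht
    have b2 := S.boundary_le hB hκ hL hH hν hx hcurv hα hm hK hmK hu ht
    have b3 := surface_le hν hK hK5 hu hgs hgc htrace ht
    unfold solEnergy dataEnergy
    have p1 : 0 ≤ ∫ x in water B, weight0Sq ν L x * u x ^ 2 :=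
      integral_nonneg fun x => mul_nonneg (weight0Sq_pos hν L x).le (sq_nonneg _)
    have p2 : 0 ≤ ∫ x in water B, grad2 u x := integral_nonneg fun x => grad2_nonneg u x
    have p3 : 0 ≤ ν * ∫ t : ℝ, u (t, 0) ^ 2 :=
      mul_nonneg hν.le (integral_nonneg fun t => sq_nonneg _)
    have q1 : 0 ≤ ∫ x in water B, (weight0Sq ν L x)⁻¹ * lap u x ^ 2 :=
      integral_nonneg fun x => mul_nonneg (inv_nonneg.2 (weight0Sq_pos hν L x).le) (sq_nonneg _)
    have q2 : 0 ≤ S.lineIntegral (fun i s => (weight1Sq ν L H)⁻¹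
        * ((S.curve i s).1 ^ 2 * deriv (S.normalDeriv u i) s ^ 2)) :=
      S.lineIntegral_nonneg fun i s => by positivity
    have q3 : 0 ≤ ∫ t : ℝ, (weight2Sq ν t)⁻¹ * g t ^ 2 :=
      integral_nonneg fun x => mul_nonneg (by unfold weight2Sq; positivity) (sq_nonneg _)
    have q4 : 0 ≤ ν⁻¹ * ∫ t : ℝ, t ^ 2 * deriv g t ^ 2 :=
      mul_nonneg (by positivity) (integral_nonneg fun t => by positivity)
    generalize (∫ x in water B, weight0Sq ν L x * u x ^ 2) = A0 at *
    generalize (∫ x in water B, grad2 u x) = A1 at *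
    generalize S.lineIntegral (fun i s => weight1Sq ν L H * u (S.curve i s) ^ 2) = A2 at *
    generalize (∫ t : ℝ, u (t, 0) ^ 2) = A3 at *
    generalize (∫ x in water B, (weight0Sq ν L x)⁻¹ * lap u x ^ 2) = B0 at *
    generalize S.lineIntegral (fun i s => (weight1Sq ν L H)⁻¹ * S.normalDeriv u i s ^ 2) = B1 at *
    generalize S.lineIntegral (fun i s => (weight1Sq ν L H)⁻¹
        * ((S.curve i s).1 ^ 2 * deriv (S.normalDeriv u i) s ^ 2)) = B2 at *
    generalize (∫ t : ℝ, (weight2Sq ν t)⁻¹ * g t ^ 2) = B3 at *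
    generalize (∫ t : ℝ, t ^ 2 * deriv g t ^ 2) = B4 at *
    have hkl : 0 ≤ κ * L := by positivity
    -- The curvature coefficient arises only in the boundary estimate; `r` extends it to the other
    -- terms of both energies.
    have r : 0 ≤ κ * L * (t * (A0 + A1 + ν * A3) + t⁻¹ * (B0 + B3 + ν⁻¹ * B4)) := by positivity
    linarith
  -- With this `K`, `(K + 2κL)/2` is `constC4 κ L`; the requirement is `5 ≤ 8`.
  have k0 := key (α := 0) (m := 1) (K := 2 * Real.sqrt 2) (Or.inl rfl) le_rfl
    S.abs_fieldStrain_zero (by positivity) (by rw [mul_pow, Real.sq_sqrt (by norm_num)]; norm_num)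
  -- With this `K`, `K + 2κL` is `constC3 κ L = 3 + 2(κL + 10)`; the requirement is `53 ≤ 529`.
  have k1 := key (α := 1) (m := 7) (K := 23) (Or.inr rfl) (by norm_num)
    (S.abs_fieldStrain_one hB) (by norm_num) (by norm_num)
  have e0 : ∫ x in water B, gradForm 0 0 u x = 2 * ∫ x in water B, dx u x ^ 2 := by
    rw [← integral_const_mul]
    exact integral_congr_ae (ae_of_all _ fun x => gradForm_zero 0 u x)
  have e1 : 0 ≤ ∫ x in water B, gradForm 1 0 u x := by
    refine setIntegral_nonneg (isOpen_water B).measurableSet fun x hx => ?_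
    have : 0 < x.2 := hx.1
    exact gradForm_one_nonneg u (by positivity)
  have ca : ∀ i, Continuous (S.arcDeriv u i) := fun i => (S.contDiff_arcDeriv hu i).continuous
  have cn : ∀ α i, Continuous (S.fieldNormal α i) := fun α i =>
    (S.contDiff_fieldNormal hB α i).continuous
  -- The geometric conditions act only here. The uncontrolled integral in `k0` is at most `-(H / ε)`
  -- times the one in `k1`, so both disappear from the sum of `k0` and `H / ε` times `k1`.
  have hcmp : S.lineIntegral (fun i s => -S.fieldNormal 0 i s * S.arcDeriv u i s ^ 2)
      ≤ -(H / ε) * S.lineIntegral (fun i s => -S.fieldNormal 1 i s * S.arcDeriv u i s ^ 2) := by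
    rw [← S.lineIntegral_const_mul]
    refine S.lineIntegral_mono (fun i => (cn 0 i).neg.mul ((ca i).pow 2))
      (fun i => ((cn 1 i).neg.mul ((ca i).pow 2)).const_mul _) fun i s => ?_
    have := mul_le_mul_of_nonneg_right
      (S.neg_fieldNormal_zero_le hB hε hεh hbox h₁ h₂ i s) (sq_nonneg (S.arcDeriv u i s))
    linarith
  rw [e0] at k0
  have hHε : 0 < H / ε := by positivity
  have k2 := mul_le_mul_of_nonneg_left (e1.trans k1) hHε.le
  have e2 : H * constC3 κ L / (2 * ε) = H / ε * constC3 κ L / 2 := by field_simp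
  have e3 : H / (2 * ε) = H / ε / 2 := by field_simp
  rw [e2, e3]
  unfold constC3 constC4
  generalize S.lineIntegral (fun i s => -S.fieldNormal 1 i s * S.arcDeriv u i s ^ 2) = J₁ at *
  generalize S.lineIntegral (fun i s => -S.fieldNormal 0 i s * S.arcDeriv u i s ^ 2) = J₀ at *
  generalize H / ε = q at *
  linarith

end SmoothBoundary

end water

/-! ### Real components of complex functions and finiteness of the norms. -/

lemma contDiff_partial1 {v : ℝ × ℝ → ℂ} (hv : ContDiff ℝ ∞ v) : ContDiff ℝ ∞ (partial1 v) :=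
  (hv.fderiv_right (m := ∞) (by simp)).clm_apply contDiff_const

lemma contDiff_partial2 {v : ℝ × ℝ → ℂ} (hv : ContDiff ℝ ∞ v) : ContDiff ℝ ∞ (partial2 v) :=
  (hv.fderiv_right (m := ∞) (by simp)).clm_apply contDiff_const

lemma continuous_laplacian {v : ℝ × ℝ → ℂ} (hv : ContDiff ℝ ∞ v) : Continuous (laplacian v) :=
  (contDiff_partial1 (contDiff_partial1 hv)).continuous.add
    (contDiff_partial2 (contDiff_partial2 hv)).continuous

section component

variable (ℓ : ℂ →L[ℝ] ℝ) {v : ℝ × ℝ → ℂ}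

lemma fderiv_component (hv : ContDiff ℝ ∞ v) (x p : ℝ × ℝ) :
    fderiv ℝ (fun y => ℓ (v y)) x p = ℓ (fderiv ℝ v x p) := by
  have h := ℓ.hasFDerivAt.comp x (hv.differentiable (by simp) x).hasFDerivAt
  have h' : HasFDerivAt (fun y => ℓ (v y)) (ℓ.comp (fderiv ℝ v x)) x := h
  rw [h'.fderiv]
  rfl

lemma dx_component (hv : ContDiff ℝ ∞ v) :
    dx (fun y => ℓ (v y)) = fun x => ℓ (partial1 v x) :=
  funext fun x => fderiv_component ℓ hv x _

lemma dy_component (hv : ContDiff ℝ ∞ v) :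
    dy (fun y => ℓ (v y)) = fun x => ℓ (partial2 v x) :=
  funext fun x => fderiv_component ℓ hv x _

lemma lap_component (hv : ContDiff ℝ ∞ v) (x : ℝ × ℝ) :
    lap (fun y => ℓ (v y)) x = ℓ (laplacian v x) := by
  unfold lap laplacian
  rw [dx_component ℓ hv, dy_component ℓ hv, dx_component ℓ (contDiff_partial1 hv),
    dy_component ℓ (contDiff_partial2 hv), map_add]

lemma deriv_component {g : ℝ → ℂ} (hg : ContDiff ℝ ∞ g) (t : ℝ) :
    deriv (fun s => ℓ (g s)) t = ℓ (deriv g t) :=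
  (ℓ.hasFDerivAt.comp_hasDerivAt t (hg.differentiable (by simp) t).hasDerivAt).deriv

/-- A real component of a square-integrable function is square-integrable. -/
lemma Integrable.component {X : Type*} [TopologicalSpace X] [MeasurableSpace X]
    [OpensMeasurableSpace X] [SecondCountableTopology X] {μ : Measure X} (hℓ : ∀ z, |ℓ z| ≤ ‖z‖)
    {w : X → ℝ} (hw : Continuous w) (hw0 : ∀ x, 0 ≤ w x) {F : X → ℂ} (hF : Continuous F)
    (h : Integrable (fun x => w x * ‖F x‖ ^ 2) μ) : Integrable (fun x => w x * ℓ (F x) ^ 2) μ := by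
  refine h.mono' (Continuous.aestronglyMeasurable (by fun_prop)) (ae_of_all _ fun x => ?_)
  rw [Real.norm_eq_abs, abs_of_nonneg (mul_nonneg (hw0 x) (sq_nonneg _)), ← sq_abs]
  exact mul_le_mul_of_nonneg_left (pow_le_pow_left₀ (abs_nonneg _) (hℓ _) 2) (hw0 x)

end component

lemma abs_reCLM_le (z : ℂ) : |Complex.reCLM z| ≤ ‖z‖ := Complex.abs_re_le_norm z

lemma abs_imCLM_le (z : ℂ) : |Complex.imCLM z| ≤ ‖z‖ := Complex.abs_im_le_norm z

lemma norm_sq_eq_add (z : ℂ) : ‖z‖ ^ 2 = Complex.reCLM z ^ 2 + Complex.imCLM z ^ 2 := by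
  rw [Complex.sq_norm, Complex.normSq_apply, Complex.reCLM_apply, Complex.imCLM_apply]
  ring

lemma integral_norm_sq_eq_add {X : Type*} [TopologicalSpace X] [MeasurableSpace X]
    [OpensMeasurableSpace X] [SecondCountableTopology X] {μ : Measure X}
    {w : X → ℝ} (hw : Continuous w) (hw0 : ∀ x, 0 ≤ w x) {F : X → ℂ} (hF : Continuous F)
    (h : Integrable (fun x => w x * ‖F x‖ ^ 2) μ) :
    ∫ x, w x * ‖F x‖ ^ 2 ∂μ
      = (∫ x, w x * Complex.reCLM (F x) ^ 2 ∂μ) + ∫ x, w x * Complex.imCLM (F x) ^ 2 ∂μ := by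
  rw [← integral_add (Integrable.component _ abs_reCLM_le hw hw0 hF h)
    (Integrable.component _ abs_imCLM_le hw hw0 hF h)]
  exact integral_congr_ae (ae_of_all _ fun x => by dsimp only; rw [norm_sq_eq_add, mul_add])

/-- The best parameter is `t = b / a`. Shifting both numbers by `δ > 0` covers the cases in which
one of them is zero, and `δ` then tends to zero. -/
lemma le_of_forall_weighted {X c a b d : ℝ} (hc : 0 ≤ c) (ha : 0 ≤ a) (hb : 0 ≤ b)
    (h : ∀ t : ℝ, 0 < t → X ≤ c / 2 * (t * a ^ 2 + t⁻¹ * b ^ 2) + d) : X ≤ c * a * b + d := by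
  have hlim : Tendsto (fun δ : ℝ => c / 2 * (2 * a * b + δ * (a + b)) + d) (𝓝[>] 0)
      (𝓝 (c / 2 * (2 * a * b + 0 * (a + b)) + d)) :=
    (Continuous.tendsto (by fun_prop) 0).mono_left nhdsWithin_le_nhds
  have hle : X ≤ c / 2 * (2 * a * b + 0 * (a + b)) + d := by
    refine ge_of_tendsto hlim (eventually_nhdsWithin_of_forall fun δ hδ => ?_)
    have hδ : 0 < δ := hδ
    refine (h ((b + δ) / (a + δ)) (by positivity)).trans ?_
    have h1 : (b + δ) / (a + δ) * a ^ 2 ≤ (b + δ) * a := by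
      rw [div_mul_eq_mul_div, div_le_iff₀ (by positivity)]
      nlinarith [mul_nonneg (mul_nonneg (add_nonneg hb hδ.le) ha) hδ.le]
    have h2 : ((b + δ) / (a + δ))⁻¹ * b ^ 2 ≤ (a + δ) * b := by
      rw [inv_div, div_mul_eq_mul_div, div_le_iff₀ (by positivity)]
      nlinarith [mul_nonneg (mul_nonneg (add_nonneg ha hδ.le) hb) hδ.le]
    have h3 := mul_le_mul_of_nonneg_left (add_le_add h1 h2) (div_nonneg hc two_pos.le)
    linarith
  linarith

/-- The weighted norm of a function of finite energy is finite. -/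
lemma integrableOn_weight0Sq {B : Set (ℝ × ℝ)} (hB : IsSubmergedBody B) {ν : ℝ} (hν : 0 < ν)
    (L : ℝ) {u : ℝ × ℝ → ℝ} (hu : ContDiff ℝ ∞ u) (hgrad : IntegrableOn (grad2 u) (water B))
    (htrace : Integrable fun t : ℝ => u (t, 0) ^ 2) :
    IntegrableOn (fun x => weight0Sq ν L x * u x ^ 2) (water B) := by
  have hdy : IntegrableOn (fun x => dy u x ^ 2) (water B) := by
    have h2 := (contDiff_dy hu).continuous
    refine hgrad.mono' (Continuous.aestronglyMeasurable (by fun_prop)) (ae_of_all _ fun x => ?_)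
    rw [Real.norm_eq_abs, abs_of_nonneg (sq_nonneg _)]
    exact le_add_of_nonneg_left (sq_nonneg _)
  have hh := (integrableOn_hardy hu
    (integrableOn_halfPlane_of_water hB ((contDiff_dy hu).continuous.pow 2) hdy) htrace).mono_set
    (show water B ⊆ {x | 0 < x.2} from Set.sdiff_subset)
  -- The weight is at most `ν²/(1 + ν²x₂²)`, and `(1 + x₂)² ≤ 2 + 2x₂²` turns this into a multiple
  -- of Hardy's weight.
  refine (hh.const_mul (2 * ν ^ 2 + 2)).mono'
    (((continuous_weight0Sq hν L).mul (hu.continuous.pow 2)).aestronglyMeasurable) ?_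
  refine (ae_restrict_mem (isOpen_water B).measurableSet).mono fun x hx => ?_
  have hx2 : 0 < x.2 := hx.1
  rw [Real.norm_eq_abs, abs_of_nonneg (mul_nonneg (weight0Sq_pos hν L x).le (sq_nonneg _)),
    ← mul_assoc]
  refine mul_le_mul_of_nonneg_right ?_ (sq_nonneg _)
  unfold weight0Sq
  rw [inv_pow, ← div_eq_mul_inv, div_le_div_iff₀ (by positivity) (by positivity)]
  have h1 : (1 + x.2) ^ 2 ≤ 2 + 2 * x.2 ^ 2 := by nlinarith [sq_nonneg (1 - x.2)]
  have h2 : ν ^ 2 * (1 + x.2) ^ 2 ≤ ν ^ 2 * (2 + 2 * x.2 ^ 2) := by gcongr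
  have h3 : 0 ≤ (2 * ν ^ 2 + 2) * (L ^ 2 * ν ^ 2 + ν ^ 2 * x.1 ^ 2) := by positivity
  have h4 : 0 ≤ 2 * ν ^ 2 * (ν ^ 2 * x.2 ^ 2) := by positivity
  nlinarith

/-- The amplitude of the sum of the two outgoing waves. -/
noncomputable def amplitude (χ : ℝ → ℝ) (ν w : ℝ) (dp dm : ℂ) (t : ℝ) : ℂ :=
  dp * ((χ (t * w) : ℂ) * Complex.exp (-Complex.I * ν * t))
    + dm * ((χ (-t * w) : ℂ) * Complex.exp (Complex.I * ν * t))

/-- The amplitude of the Laplacian of the sum of the two outgoing waves. -/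
noncomputable def sourceAmplitude (χ : ℝ → ℝ) (ν w : ℝ) (dp dm : ℂ) (t : ℝ) : ℂ :=
  deriv (deriv (amplitude χ ν w dp dm)) t + ν ^ 2 * amplitude χ ν w dp dm t

lemma contDiff_amplitude {χ : ℝ → ℝ} (hχ : IsCutoff χ) (ν w : ℝ) (dp dm : ℂ) :
    ContDiff ℝ ∞ (amplitude χ ν w dp dm) := by
  have h1 : ContDiff ℝ ∞ fun t : ℝ => (χ (t * w) : ℂ) :=
    Complex.ofRealCLM.contDiff.comp (hχ.smooth.comp (by fun_prop))
  have h2 : ContDiff ℝ ∞ fun t : ℝ => (χ (-t * w) : ℂ) :=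
    Complex.ofRealCLM.contDiff.comp (hχ.smooth.comp (by fun_prop))
  have h3 : ContDiff ℝ ∞ fun t : ℝ => (t : ℂ) := Complex.ofRealCLM.contDiff
  unfold amplitude
  exact (contDiff_const.mul (h1.mul (contDiff_const.mul h3).cexp)).add
    (contDiff_const.mul (h2.mul (contDiff_const.mul h3).cexp))

lemma continuous_sourceAmplitude {χ : ℝ → ℝ} (hχ : IsCutoff χ) (ν w : ℝ) (dp dm : ℂ) :
    Continuous (sourceAmplitude χ ν w dp dm) := by
  have h := contDiff_amplitude hχ ν w dp dm
  exact (((contDiff_infty_iff_deriv.1 (contDiff_infty_iff_deriv.1 h).2).2).continuous).add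
    (continuous_const.mul h.continuous)

lemma hasDerivAt_cexp_mul (c k : ℂ) (t : ℝ) :
    HasDerivAt (fun s : ℝ => c * Complex.exp (k * s)) (k * c * Complex.exp (k * t)) t := by
  have h : HasDerivAt (fun s : ℝ => k * (s : ℂ)) k t := by
    simpa using (Complex.ofRealCLM.hasDerivAt (x := t)).const_mul k
  refine (h.cexp.const_mul c).congr_deriv ?_
  ring

/-- An exponential with `k² = -ν²` is annihilated by `d²/dt² + ν²`; equivalently, its product with
`exp(-ν x₂)` is harmonic. -/
lemma sourceAmplitude_eq_zero_of_eventuallyEq {χ : ℝ → ℝ} {ν w : ℝ} {dp dm c k : ℂ} {t : ℝ}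
    (hk : k ^ 2 = -(ν : ℂ) ^ 2)
    (h : amplitude χ ν w dp dm =ᶠ[𝓝 t] fun s : ℝ => c * Complex.exp (k * s)) :
    sourceAmplitude χ ν w dp dm t = 0 := by
  have e : deriv (deriv fun s : ℝ => c * Complex.exp (k * s)) t
      = k * (k * c) * Complex.exp (k * t) := by
    rw [show (deriv fun s : ℝ => c * Complex.exp (k * s))
      = fun s : ℝ => k * c * Complex.exp (k * s) from funext fun s => (hasDerivAt_cexp_mul c k s).deriv]
    exact (hasDerivAt_cexp_mul (k * c) k t).deriv
  unfold sourceAmplitude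
  rw [h.deriv.deriv_eq, e, h.eq_of_nhds]
  linear_combination c * Complex.exp (k * t) * hk

/-- For `|t| > 3 / w` one cut-off is one and the other zero, so the amplitude is there a single wave
and contributes nothing to the source. -/
lemma hasCompactSupport_sourceAmplitude {χ : ℝ → ℝ} (hχ : IsCutoff χ) (ν : ℝ) {w : ℝ} (hw : 0 < w)
    (dp dm : ℂ) : HasCompactSupport (sourceAmplitude χ ν w dp dm) := by
  refine HasCompactSupport.intro (K := Set.Icc (-(3 / w)) (3 / w)) isCompact_Icc fun t ht => ?_
  rw [Set.mem_Icc, not_and_or, not_le, not_le] at ht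
  rcases ht with ht | ht
  · refine sourceAmplitude_eq_zero_of_eventuallyEq (c := dm) (k := Complex.I * ν) ?_ ?_
    · rw [mul_pow, Complex.I_sq]; ring
    · filter_upwards [eventually_lt_nhds ht] with s hs
      have h3 : 3 < -s * w := (div_lt_iff₀ hw).1 (by linarith)
      unfold amplitude
      rw [hχ.eq_one _ h3, hχ.eq_zero (s * w) (by linarith)]
      simp
  · refine sourceAmplitude_eq_zero_of_eventuallyEq (c := dp) (k := -Complex.I * ν) ?_ ?_
    · rw [mul_pow, neg_sq, Complex.I_sq]; ring
    · filter_upwards [eventually_gt_nhds ht] with s hs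
      have h3 : 3 < s * w := (div_lt_iff₀ hw).1 hs
      unfold amplitude
      rw [hχ.eq_one _ h3, hχ.eq_zero (-s * w) (by linarith)]
      simp

lemma laplacian_mul_cexp {A : ℝ → ℂ} (hA : ContDiff ℝ ∞ A) (ν : ℝ) (x : ℝ × ℝ) :
    laplacian (fun y => A y.1 * Complex.exp (-(ν : ℂ) * y.2)) x
      = (deriv (deriv A) x.1 + ν ^ 2 * A x.1) * Complex.exp (-(ν : ℂ) * x.2) := by
  -- The constant `c` lets the same rule be applied twice: a derivative in `x₂` only replaces `c` by
  -- `-ν c`.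
  have key : ∀ {A : ℝ → ℂ}, ContDiff ℝ ∞ A → ∀ c : ℂ,
      (partial1 fun y => A y.1 * (c * Complex.exp (-(ν : ℂ) * y.2)))
        = (fun y => deriv A y.1 * (c * Complex.exp (-(ν : ℂ) * y.2))) ∧
      (partial2 fun y => A y.1 * (c * Complex.exp (-(ν : ℂ) * y.2)))
        = (fun y => A y.1 * (-(ν : ℂ) * c * Complex.exp (-(ν : ℂ) * y.2))) := by
    intro A hA c
    have h : ∀ y : ℝ × ℝ,
        partial1 (fun y => A y.1 * (c * Complex.exp (-(ν : ℂ) * y.2))) y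
          = deriv A y.1 * (c * Complex.exp (-(ν : ℂ) * y.2)) ∧
        partial2 (fun y => A y.1 * (c * Complex.exp (-(ν : ℂ) * y.2))) y
          = A y.1 * (-(ν : ℂ) * c * Complex.exp (-(ν : ℂ) * y.2)) := by
      intro y
      have h1 : HasFDerivAt (fun y : ℝ × ℝ => A y.1) _ y :=
        (hA.differentiable (by simp) y.1).hasDerivAt.hasFDerivAt.comp y hasFDerivAt_fst
      have h2 : HasFDerivAt (fun y : ℝ × ℝ => c * Complex.exp (-(ν : ℂ) * y.2)) _ y :=
        (hasDerivAt_cexp_mul c (-(ν : ℂ)) y.2).hasFDerivAt.comp y hasFDerivAt_snd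
      have h3 : HasFDerivAt (fun y : ℝ × ℝ => A y.1 * (c * Complex.exp (-(ν : ℂ) * y.2))) _ y :=
        h1.mul h2
      rw [partial1, partial2, h3.fderiv]
      simp [mul_comm]
    exact ⟨funext fun y => (h y).1, funext fun y => (h y).2⟩
  have e : (fun y : ℝ × ℝ => A y.1 * Complex.exp (-(ν : ℂ) * y.2))
      = fun y => A y.1 * (1 * Complex.exp (-(ν : ℂ) * y.2)) := by simp
  rw [e, laplacian, (key hA 1).1, (key (contDiff_infty_iff_deriv.1 hA).2 1).1, (key hA 1).2,
    (key hA _).2]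
  ring

lemma remainderSource_eq {χ : ℝ → ℝ} (hχ : IsCutoff χ) (ν L H : ℝ) (dp dm : ℂ) (f : ℝ × ℝ → ℂ)
    (x : ℝ × ℝ) : remainderSource χ ν L H dp dm f x
      = f x + sourceAmplitude χ ν (weight1Sq ν L H) dp dm x.1 * Complex.exp (-(ν : ℂ) * x.2) := by
  unfold remainderSource sourceAmplitude
  rw [← laplacian_mul_cexp (contDiff_amplitude hχ ν (weight1Sq ν L H) dp dm)]
  congr 2
  funext y
  simp only [wavePlus, waveMinus, amplitude, sub_eq_add_neg, Complex.exp_add, neg_mul]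
  ring

lemma integrableOn_sq_mul_exp {ν : ℝ} (hν : 0 < ν) :
    IntegrableOn (fun t : ℝ => t ^ 2 * Real.exp (-ν * t) ^ 2) (Set.Ioi 0) ∧
      IntegrableOn (fun t : ℝ => Real.exp (-ν * t) ^ 2) (Set.Ioi 0) := by
  have e : ∀ t : ℝ, Real.exp (-ν * t) ^ 2 = Real.exp (-(2 * ν) * t) := by
    intro t
    rw [← Real.exp_nat_mul]
    congr 1
    push_cast
    ring
  have h := fun s (hs : (-1 : ℝ) < s) =>
    integrableOn_rpow_mul_exp_neg_mul_rpow (p := 1) (b := 2 * ν) hs one_pos (by positivity)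
  simp only [e]
  exact ⟨by simpa using h 2 (by norm_num), by simpa using h 0 (by norm_num)⟩

/-- The weighted norm of the right-hand side of the remainder problem is finite. -/
lemma integrableOn_remainderSource (B : Set (ℝ × ℝ)) {ν L H : ℝ} (hν : 0 < ν) (hL : 0 < L)
    (hH : 0 < H) {χ : ℝ → ℝ} (hχ : IsCutoff χ) (dp dm : ℂ) {f : ℝ × ℝ → ℂ} (hf : Continuous f)
    (hfc : HasCompactSupport f) :
    IntegrableOn (fun x => (weight0Sq ν L x)⁻¹ * ‖remainderSource χ ν L H dp dm f x‖ ^ 2)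
      (water B) := by
  have cD := continuous_sourceAmplitude hχ ν (weight1Sq ν L H) dp dm
  have hD := hasCompactSupport_sourceAmplitude hχ ν (weight1Sq_pos hν hL hH) dp dm
  simp only [remainderSource_eq hχ]
  generalize sourceAmplitude χ ν (weight1Sq ν L H) dp dm = D at *
  have cw : Continuous fun x => (weight0Sq ν L x)⁻¹ :=
    (continuous_weight0Sq hν L).inv₀ fun x => (weight0Sq_pos hν L x).ne'
  have i1 : Integrable fun x => (weight0Sq ν L x)⁻¹ * ‖f x‖ ^ 2 := by
    refine Continuous.integrable_of_hasCompactSupport (by fun_prop) ?_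
    simp only [sq]
    exact (hfc.norm.mul_left).mul_left
  have i2 : Integrable fun t : ℝ => (L ^ 2 + (ν⁻¹) ^ 2 + t ^ 2) * ‖D t‖ ^ 2 := by
    refine Continuous.integrable_of_hasCompactSupport (by fun_prop) ?_
    simp only [sq ‖D _‖]
    exact (hD.norm.mul_left).mul_left
  have i3 : Integrable fun t : ℝ => ‖D t‖ ^ 2 := by
    refine Continuous.integrable_of_hasCompactSupport (by fun_prop) ?_
    simp only [sq ‖D _‖]
    exact hD.norm.mul_left
  obtain ⟨i4, i5⟩ := integrableOn_sq_mul_exp hν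
  -- The inverse weight is `L² + ν⁻² + x₁² + x₂²`. The wave part therefore splits into two products
  -- of a compactly supported function of `x₁` and an exponentially decaying function of `x₂`.
  have i6 : IntegrableOn (fun x : ℝ × ℝ => (L ^ 2 + (ν⁻¹) ^ 2 + x.1 ^ 2) * ‖D x.1‖ ^ 2
      * Real.exp (-ν * x.2) ^ 2 + ‖D x.1‖ ^ 2 * (x.2 ^ 2 * Real.exp (-ν * x.2) ^ 2))
      {x : ℝ × ℝ | 0 < x.2} := by
    rw [halfPlane_eq, IntegrableOn, Measure.volume_eq_prod, ← Measure.prod_restrict,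
      Measure.restrict_univ]
    exact (i2.mul_prod i5).add (i3.mul_prod i4)
  have i7 := (i1.integrableOn.const_mul 2).add
    ((i6.mono_set (show water B ⊆ {x | 0 < x.2} from Set.sdiff_subset)).const_mul 2)
  refine i7.mono' (Continuous.aestronglyMeasurable (by fun_prop)) (ae_of_all _ fun x => ?_)
  have hw := weight0Sq_pos hν L x
  have e : (weight0Sq ν L x)⁻¹ = L ^ 2 + (ν⁻¹) ^ 2 + x.1 ^ 2 + x.2 ^ 2 := by
    unfold weight0Sq
    field_simp
  have hn : ‖D x.1 * Complex.exp (-(ν : ℂ) * x.2)‖ = ‖D x.1‖ * Real.exp (-ν * x.2) := by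
    rw [norm_mul, Complex.norm_exp]
    simp
  have h1 : ‖f x + D x.1 * Complex.exp (-(ν : ℂ) * x.2)‖ ^ 2
      ≤ 2 * ‖f x‖ ^ 2 + 2 * (‖D x.1‖ * Real.exp (-ν * x.2)) ^ 2 := by
    have h2 := norm_add_le (f x) (D x.1 * Complex.exp (-(ν : ℂ) * x.2))
    rw [hn] at h2
    have h3 := pow_le_pow_left₀ (norm_nonneg _) h2 2
    have h4 := sq_nonneg (‖f x‖ - ‖D x.1‖ * Real.exp (-ν * x.2))
    linarith
  rw [Real.norm_eq_abs, abs_of_nonneg (by positivity)]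
  refine (mul_le_mul_of_nonneg_left h1 (inv_nonneg.2 hw.le)).trans (le_of_eq ?_)
  simp only [Pi.add_apply]
  rw [e]
  ring

/-! ### The norms of complex solutions and the theorem. -/

namespace SmoothBoundary

variable {B : Set (ℝ × ℝ)} (S : SmoothBoundary B)

lemma lineIntegral_norm_sq_eq_add {w : Fin S.m → ℝ → ℝ} (hw : ∀ i, Continuous (w i))
    {F : Fin S.m → ℝ → ℂ} (hF : ∀ i, Continuous (F i)) :
    S.lineIntegral (fun i s => w i s * ‖F i s‖ ^ 2)
      = S.lineIntegral (fun i s => w i s * Complex.reCLM (F i s) ^ 2)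
        + S.lineIntegral (fun i s => w i s * Complex.imCLM (F i s) ^ 2) := by
  rw [← S.lineIntegral_add (fun i => by have := hw i; have := hF i; fun_prop)
    (fun i => by have := hw i; have := hF i; fun_prop)]
  simp only [norm_sq_eq_add, mul_add]

lemma solEnergy_nonneg {ν L H : ℝ} (hν : 0 < ν) (hL : 0 < L) (hH : 0 < H) (u : ℝ × ℝ → ℝ) :
    0 ≤ S.solEnergy ν L H u := by
  have p1 : 0 ≤ ∫ x in water B, weight0Sq ν L x * u x ^ 2 :=
    integral_nonneg fun x => mul_nonneg (weight0Sq_pos hν L x).le (sq_nonneg _)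
  have p2 : 0 ≤ ∫ x in water B, grad2 u x := integral_nonneg fun x => grad2_nonneg u x
  have p3 : 0 ≤ S.lineIntegral (fun i s => weight1Sq ν L H * u (S.curve i s) ^ 2) :=
    S.lineIntegral_nonneg fun i s => mul_nonneg (weight1Sq_pos hν hL hH).le (sq_nonneg _)
  have p4 : 0 ≤ ∫ t : ℝ, u (t, 0) ^ 2 := integral_nonneg fun t => sq_nonneg _
  unfold solEnergy
  positivity

lemma dataEnergy_nonneg {ν L H : ℝ} (hν : 0 < ν) (hL : 0 < L) (hH : 0 < H) (u : ℝ × ℝ → ℝ)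
    (g : ℝ → ℝ) : 0 ≤ S.dataEnergy ν L H u g := by
  have hw := weight1Sq_pos hν hL hH
  have q1 : 0 ≤ ∫ x in water B, (weight0Sq ν L x)⁻¹ * lap u x ^ 2 :=
    integral_nonneg fun x => mul_nonneg (inv_nonneg.2 (weight0Sq_pos hν L x).le) (sq_nonneg _)
  have q2 : 0 ≤ S.lineIntegral (fun i s => (weight1Sq ν L H)⁻¹ * S.normalDeriv u i s ^ 2) :=
    S.lineIntegral_nonneg fun i s => by positivity
  have q3 : 0 ≤ S.lineIntegral (fun i s => (weight1Sq ν L H)⁻¹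
      * ((S.curve i s).1 ^ 2 * deriv (S.normalDeriv u i) s ^ 2)) :=
    S.lineIntegral_nonneg fun i s => by positivity
  have q4 : 0 ≤ ∫ t : ℝ, (weight2Sq ν t)⁻¹ * g t ^ 2 :=
    integral_nonneg fun x => mul_nonneg (by unfold weight2Sq; positivity) (sq_nonneg _)
  have q5 : 0 ≤ ∫ t : ℝ, t ^ 2 * deriv g t ^ 2 := integral_nonneg fun t => by positivity
  unfold dataEnergy
  positivity

section solution

variable {ν L H : ℝ} {f₁ g₁ : ℝ × ℝ → ℂ} {g₂ : ℝ → ℂ} {v : ℝ × ℝ → ℂ}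

lemma integrable_component (ℓ : ℂ →L[ℝ] ℝ) (hℓ : ∀ z, |ℓ z| ≤ ‖z‖)
    (hv : IsFiniteEnergySolution S ν f₁ g₁ g₂ v) :
    IntegrableOn (grad2 fun x => ℓ (v x)) (water B) ∧
      Integrable fun t : ℝ => ℓ (v (t, 0)) ^ 2 := by
  have hs := hv.smooth
  have c0 := hs.continuous
  have c1 := (contDiff_partial1 hs).continuous
  have c2 := (contDiff_partial2 hs).continuous
  constructor
  · have c := continuous_grad2 (u := fun x => ℓ (v x)) (ℓ.contDiff.comp hs)
    refine hv.grad_sq_integrable.mono' c.aestronglyMeasurable (ae_of_all _ fun x => ?_)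
    rw [Real.norm_eq_abs, abs_of_nonneg (grad2_nonneg _ x), grad2, dx_component ℓ hs,
      dy_component ℓ hs, ← sq_abs, ← sq_abs (ℓ (partial2 v x))]
    exact add_le_add (pow_le_pow_left₀ (abs_nonneg _) (hℓ _) 2)
      (pow_le_pow_left₀ (abs_nonneg _) (hℓ _) 2)
  · have h := Integrable.component ℓ hℓ (w := fun _ : ℝ => (1 : ℝ)) continuous_const
      (fun _ => zero_le_one) (F := fun t : ℝ => v (t, 0)) (by fun_prop) (μ := volume)
    simp only [one_mul] at h
    exact h hv.trace_sq_integrable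

lemma integral_partial1_sq_eq (hv : IsFiniteEnergySolution S ν f₁ g₁ g₂ v) :
    ∫ x in water B, ‖partial1 v x‖ ^ 2
      = (∫ x in water B, dx (fun x => Complex.reCLM (v x)) x ^ 2)
        + ∫ x in water B, dx (fun x => Complex.imCLM (v x)) x ^ 2 := by
  have c1 := (contDiff_partial1 hv.smooth).continuous
  have h : IntegrableOn (fun x => ‖partial1 v x‖ ^ 2) (water B) := by
    refine hv.grad_sq_integrable.mono' (Continuous.aestronglyMeasurable (by fun_prop))
      (ae_of_all _ fun x => ?_)
    rw [Real.norm_eq_abs, abs_of_nonneg (sq_nonneg _)]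
    exact le_add_of_nonneg_right (sq_nonneg _)
  have e := integral_norm_sq_eq_add (w := fun _ : ℝ × ℝ => (1 : ℝ)) continuous_const
      (fun _ => zero_le_one) c1 (μ := volume.restrict (water B))
  simp only [one_mul] at e
  rw [e h, dx_component _ hv.smooth, dx_component _ hv.smooth]

lemma solNorm_sq (hν : 0 < ν) (hL : 0 < L) (hH : 0 < H)
    (hv : IsFiniteEnergySolution S ν f₁ g₁ g₂ v)
    (hweight : IntegrableOn (fun x => weight0Sq ν L x * ‖v x‖ ^ 2) (water B)) :
    solNorm S ν L H v ^ 2 = S.solEnergy ν L H (fun x => Complex.reCLM (v x))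
      + S.solEnergy ν L H (fun x => Complex.imCLM (v x)) := by
  have cv := hv.smooth.continuous
  have e1 := integral_norm_sq_eq_add (continuous_weight0Sq hν L)
    (fun x => (weight0Sq_pos hν L x).le) cv hweight
  have e2 : ∫ x in water B, gradSq v x
      = (∫ x in water B, grad2 (fun x => Complex.reCLM (v x)) x)
        + ∫ x in water B, grad2 (fun x => Complex.imCLM (v x)) x := by
    rw [← integral_add (S.integrable_component _ abs_reCLM_le hv).1
      (S.integrable_component _ abs_imCLM_le hv).1]
    refine integral_congr_ae (ae_of_all _ fun x => ?_)
    simp only [gradSq, grad2, dx_component _ hv.smooth, dy_component _ hv.smooth, norm_sq_eq_add]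
    ring
  have e3 := S.lineIntegral_norm_sq_eq_add (w := fun _ _ => weight1Sq ν L H)
    (fun _ => continuous_const) (F := fun i s => v (S.curve i s))
    fun i => cv.comp (S.smooth i).continuous
  have e4 := integral_norm_sq_eq_add (w := fun _ : ℝ => (1 : ℝ)) continuous_const
    (fun _ => zero_le_one) (F := fun t : ℝ => v (t, 0)) (by fun_prop) (μ := volume)
  simp only [one_mul] at e4
  have h1 := S.solEnergy_nonneg hν hL hH fun x => Complex.reCLM (v x)
  have h2 := S.solEnergy_nonneg hν hL hH fun x => Complex.imCLM (v x)
  have e : (∫ x in water B, weight0Sq ν L x * ‖v x‖ ^ 2) + (∫ x in water B, gradSq v x)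
      + S.lineIntegral (fun i s => weight1Sq ν L H * ‖v (S.curve i s)‖ ^ 2)
      + ν * (∫ t : ℝ, ‖v (t, 0)‖ ^ 2)
      = S.solEnergy ν L H (fun x => Complex.reCLM (v x))
        + S.solEnergy ν L H (fun x => Complex.imCLM (v x)) := by
    rw [e1, e2, e3, e4 hv.trace_sq_integrable]
    unfold solEnergy
    ring
  unfold solNorm
  rw [e, Real.sq_sqrt (add_nonneg h1 h2)]

lemma normalDeriv_component (ℓ : ℂ →L[ℝ] ℝ) (hv : IsFiniteEnergySolution S ν f₁ g₁ g₂ v)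
    (i : Fin S.m) : S.normalDeriv (fun x => ℓ (v x)) i = fun s => ℓ (g₁ (S.curve i s)) :=
  funext fun s => (fderiv_component ℓ hv.smooth _ _).trans (by rw [hv.eq_body])

/-- `dataEnergy` expresses the data through the solution itself. The equations in the water and on
`S` identify `lap` and `normalDeriv` of the components of `v` with the components of `-f₁` and `g₁`,
and all the squares are additive over the two components. -/
lemma dataNorm_sq (hν : 0 < ν) (hL : 0 < L) (hH : 0 < H)
    (hv : IsFiniteEnergySolution S ν f₁ g₁ g₂ v)
    (hg₁ : ∀ i, ContDiff ℝ ∞ (fun s => g₁ (S.curve i s))) (hg₂ : ContDiff ℝ ∞ g₂)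
    (hgc : HasCompactSupport g₂)
    (hsource : IntegrableOn (fun x => (weight0Sq ν L x)⁻¹ * ‖laplacian v x‖ ^ 2) (water B)) :
    dataNorm S ν L H f₁ g₁ g₂ ^ 2
      = S.dataEnergy ν L H (fun x => Complex.reCLM (v x)) (fun t => Complex.reCLM (g₂ t))
        + S.dataEnergy ν L H (fun x => Complex.imCLM (v x)) (fun t => Complex.imCLM (g₂ t)) := by
  have cw : Continuous fun x => (weight0Sq ν L x)⁻¹ :=
    (continuous_weight0Sq hν L).inv₀ fun x => (weight0Sq_pos hν L x).ne'
  have e1 := integral_norm_sq_eq_add cw (fun x => (inv_pos.2 (weight0Sq_pos hν L x)).le)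
    (continuous_laplacian hv.smooth) hsource
  simp only [← lap_component _ hv.smooth] at e1
  have e0 : ∫ x in water B, (weight0Sq ν L x)⁻¹ * ‖f₁ x‖ ^ 2
      = ∫ x in water B, (weight0Sq ν L x)⁻¹ * ‖laplacian v x‖ ^ 2 :=
    setIntegral_congr_fun (isOpen_water B).measurableSet fun x hx => by
      rw [← hv.eq_water x hx, norm_neg]
  have e2 := S.lineIntegral_norm_sq_eq_add (w := fun _ _ => (weight1Sq ν L H)⁻¹)
    (fun _ => continuous_const) (F := fun i s => g₁ (S.curve i s)) fun i => (hg₁ i).continuous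
  have e3 := S.lineIntegral_norm_sq_eq_add
    (w := fun i s => (weight1Sq ν L H)⁻¹ * (S.curve i s).1 ^ 2)
    (fun i => by have := (S.smooth i).continuous; fun_prop)
    (F := fun i s => S.tangentialDeriv g₁ i s) fun i => (hg₁ i).continuous_deriv (by simp)
  have cw2 : Continuous fun x : ℝ => (weight2Sq ν x)⁻¹ := by
    unfold weight2Sq
    refine Continuous.inv₀ (Continuous.div (by fun_prop) (by fun_prop) fun x => by positivity)
      fun x => by positivity
  have hsq : ∀ {φ : ℝ → ℂ}, HasCompactSupport φ → HasCompactSupport fun x => ‖φ x‖ ^ 2 := by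
    intro φ hφ
    simp only [sq]
    exact hφ.norm.mul_left
  have cg := hg₂.continuous
  have cg' := hg₂.continuous_deriv (by simp)
  have e4 := integral_norm_sq_eq_add (μ := volume) cw2
    (fun x => inv_nonneg.2 (by unfold weight2Sq; positivity)) cg
    (Continuous.integrable_of_hasCompactSupport (by fun_prop) (hsq hgc).mul_left)
  have e5 := integral_norm_sq_eq_add (μ := volume) (w := fun t : ℝ => t ^ 2) (by fun_prop)
    (fun x => sq_nonneg x) cg'
    (Continuous.integrable_of_hasCompactSupport (by fun_prop) (hsq hgc.deriv).mul_left)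
  have ed : ∀ (ℓ : ℂ →L[ℝ] ℝ) (i : Fin S.m) (s : ℝ),
      deriv (S.normalDeriv (fun x => ℓ (v x)) i) s = ℓ (S.tangentialDeriv g₁ i s) := by
    intro ℓ i s
    rw [S.normalDeriv_component ℓ hv]
    exact deriv_component ℓ (hg₁ i) s
  have h1 := S.dataEnergy_nonneg hν hL hH (fun x => Complex.reCLM (v x))
    (fun t => Complex.reCLM (g₂ t))
  have h2 := S.dataEnergy_nonneg hν hL hH (fun x => Complex.imCLM (v x))
    (fun t => Complex.imCLM (g₂ t))
  simp only [mul_assoc] at e3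
  have e : (∫ x in water B, (weight0Sq ν L x)⁻¹ * ‖f₁ x‖ ^ 2)
      + S.lineIntegral (fun i s => (weight1Sq ν L H)⁻¹ * ‖g₁ (S.curve i s)‖ ^ 2)
      + S.lineIntegral (fun i s =>
          (weight1Sq ν L H)⁻¹ * ((S.curve i s).1 ^ 2 * ‖S.tangentialDeriv g₁ i s‖ ^ 2))
      + (∫ t : ℝ, (weight2Sq ν t)⁻¹ * ‖g₂ t‖ ^ 2)
      + ν⁻¹ * (∫ t : ℝ, t ^ 2 * ‖deriv g₂ t‖ ^ 2)
      = S.dataEnergy ν L H (fun x => Complex.reCLM (v x)) (fun t => Complex.reCLM (g₂ t))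
        + S.dataEnergy ν L H (fun x => Complex.imCLM (v x)) (fun t => Complex.imCLM (g₂ t)) := by
    rw [e0, e1, e2, e3, e4, e5]
    unfold dataEnergy
    simp only [ed]
    simp only [S.normalDeriv_component _ hv, deriv_component _ hg₂]
    ring
  unfold dataNorm
  rw [e, Real.sq_sqrt (add_nonneg h1 h2)]

end solution

end SmoothBoundary

lemma constC4_nonneg {κ L : ℝ} (h : 0 ≤ κ * L) : 0 ≤ constC4 κ L :=
  add_nonneg (Real.sqrt_nonneg 2) h

/-- As `√2 ≤ 2`, `constC4` is at most half of `constC3`, and `1 ≤ q` does the rest. -/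
lemma constC4_le {κ L q : ℝ} (h : 0 ≤ κ * L) (hq : 1 ≤ q) :
    constC4 κ L + q * constC3 κ L / 2 ≤ constC3 κ L * q := by
  have h2 : Real.sqrt 2 ≤ 2 := Real.sqrt_le_iff.2 ⟨by norm_num, by norm_num⟩
  have h3 : constC3 κ L * 1 ≤ constC3 κ L * q :=
    mul_le_mul_of_nonneg_left hq (by unfold constC3; linarith)
  have h4 : constC4 κ L ≤ constC3 κ L / 2 := by
    unfold constC3 constC4
    linarith
  linarith

end WaterWaves

theorem theorem4p3 (κ L h H ε : ℝ) (hκ : 0 ≤ κ) (hL : 0 < L)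
    (hε : 0 < ε) (hεh : ε ≤ h) (hhH : h < H) :
    ∃ C₅ C₆ : ℝ,
      (C₅ ≤ WaterWaves.constC4 κ L + H * WaterWaves.constC3 κ L / (2 * ε) ∧
        WaterWaves.constC4 κ L + H * WaterWaves.constC3 κ L / (2 * ε)
          ≤ WaterWaves.constC3 κ L * (H / ε)) ∧
      (C₆ ≤ H / (2 * ε) + 1 / 2 ∧ H / (2 * ε) + 1 / 2 ≤ H / ε) ∧
      ∀ (B : Set (ℝ × ℝ)) (S : WaterWaves.SmoothBoundary B),
        WaterWaves.IsSubmergedBody B →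
        (∀ x ∈ B, |x.1| < L ∧ h < x.2 ∧ x.2 < H) →
        (∀ i s, |S.curvature i s| ≤ κ) →
        WaterWaves.Condition1 S →
        WaterWaves.Condition2 S ε →
        ∀ (ν : ℝ) (χ : ℝ → ℝ) (dp dm : ℂ) (f g₁ : ℝ × ℝ → ℂ) (g₂ : ℝ → ℂ) (v : ℝ × ℝ → ℂ),
          0 < ν →
          WaterWaves.IsCutoff χ →
          (ContDiff ℝ ∞ f ∧ HasCompactSupport f ∧ tsupport f ⊆ WaterWaves.water B) →
          (∀ i, ContDiff ℝ ∞ (fun s => g₁ (S.curve i s))) →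
          (ContDiff ℝ ∞ g₂ ∧ HasCompactSupport g₂) →
          WaterWaves.IsFiniteEnergySolution S ν
            (WaterWaves.remainderSource χ ν L H dp dm f) g₁ g₂ v →
          IntegrableOn (fun x => WaterWaves.weight0Sq ν L x * ‖v x‖ ^ 2) (WaterWaves.water B) ∧
          IntegrableOn (fun x => (WaterWaves.weight0Sq ν L x)⁻¹
            * ‖WaterWaves.remainderSource χ ν L H dp dm f x‖ ^ 2) (WaterWaves.water B) ∧
          ∫ x in WaterWaves.water B, ‖WaterWaves.partial1 v x‖ ^ 2
            ≤ C₅ * WaterWaves.solNorm S ν L H v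
                * WaterWaves.dataNorm S ν L H
                    (WaterWaves.remainderSource χ ν L H dp dm f) g₁ g₂
              + C₆ * WaterWaves.dataNorm S ν L H
                    (WaterWaves.remainderSource χ ν L H dp dm f) g₁ g₂ ^ 2 := by
  have hεH : ε < H := hεh.trans_lt hhH
  have hH : 0 < H := hε.trans hεH
  have hq : 1 ≤ H / ε := (one_le_div hε).2 hεH.le
  have hκL : 0 ≤ κ * L := mul_nonneg hκ hL.le
  have e1 : H * WaterWaves.constC3 κ L / (2 * ε) = H / ε * WaterWaves.constC3 κ L / 2 := by
    field_simp
  have e2 : H / (2 * ε) = H / ε / 2 := by field_simp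
  -- The constants are taken equal to their upper bounds.
  refine ⟨_, _, ⟨le_rfl, ?_⟩, ⟨le_rfl, ?_⟩, ?_⟩
  · rw [e1]
    exact WaterWaves.constC4_le hκL hq
  · rw [e2]
    linarith
  intro B S hB hbox hcurv h₁ h₂ ν χ dp dm f g₁ g₂ v hν hχ hf hg₁ hg₂ hv
  have hs := hv.smooth
  have hsource := WaterWaves.integrableOn_remainderSource B hν hL hH hχ dp dm hf.1.continuous
    hf.2.1
  have hsource' : IntegrableOn (fun x => (WaterWaves.weight0Sq ν L x)⁻¹
      * ‖WaterWaves.laplacian v x‖ ^ 2) (WaterWaves.water B) :=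
    hsource.congr_fun (fun x hx => by dsimp only; rw [← hv.eq_water x hx, norm_neg])
      (WaterWaves.isOpen_water B).measurableSet
  have hcomp : ∀ ℓ : ℂ →L[ℝ] ℝ, (∀ z, |ℓ z| ≤ ‖z‖) →
      IntegrableOn (fun x => WaterWaves.weight0Sq ν L x * ℓ (v x) ^ 2) (WaterWaves.water B) :=
    fun ℓ hℓ => WaterWaves.integrableOn_weight0Sq hB hν L (ℓ.contDiff.comp hs)
      (S.integrable_component ℓ hℓ hv).1 (S.integrable_component ℓ hℓ hv).2
  have hweight : IntegrableOn (fun x => WaterWaves.weight0Sq ν L x * ‖v x‖ ^ 2)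
      (WaterWaves.water B) := by
    simp only [WaterWaves.norm_sq_eq_add, mul_add]
    exact (hcomp _ WaterWaves.abs_reCLM_le).add (hcomp _ WaterWaves.abs_imCLM_le)
  refine ⟨hweight, hsource, ?_⟩
  -- The minimisation over `t` is applied to the complex solution: squares of norms add over real
  -- and imaginary parts, products of norms do not, so the two real estimates are added with a
  -- common `t`.
  refine WaterWaves.le_of_forall_weighted ?_ (Real.sqrt_nonneg _) (Real.sqrt_nonneg _)
    fun t ht => ?_
  · have : 0 ≤ WaterWaves.constC3 κ L := by unfold WaterWaves.constC3; linarith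
    have := WaterWaves.constC4_nonneg hκL
    positivity
  have hreal : ∀ ℓ : ℂ →L[ℝ] ℝ, (∀ z, |ℓ z| ≤ ‖z‖) → (∀ (r : ℝ) z, ℓ (r * z) = r * ℓ z) → _ :=
    fun ℓ hℓ hr => S.integral_dx_sq_le hB hκ hL hε hεh hhH hν hbox hcurv h₁ h₂
      (u := fun x => ℓ (v x)) (ℓ.contDiff.comp hs) (g := fun t => ℓ (g₂ t))
      (ℓ.contDiff.comp hg₂.1) (hg₂.2.comp_left (map_zero ℓ))
      (fun s => by
        rw [WaterWaves.dy_component ℓ hs, ← hv.eq_surface s, map_sub, map_neg, hr])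
      (S.integrable_component ℓ hℓ hv).1 (S.integrable_component ℓ hℓ hv).2 (hcomp ℓ hℓ)
      (by
        simp only [WaterWaves.lap_component ℓ hs]
        exact WaterWaves.Integrable.component ℓ hℓ
          ((WaterWaves.continuous_weight0Sq hν L).inv₀ fun x => (WaterWaves.weight0Sq_pos hν L x).ne')
          (fun x => (inv_pos.2 (WaterWaves.weight0Sq_pos hν L x)).le)
          (WaterWaves.continuous_laplacian hs) hsource') ht
  have r1 := hreal Complex.reCLM WaterWaves.abs_reCLM_le fun r z => by simp
  have r2 := hreal Complex.imCLM WaterWaves.abs_imCLM_le fun r z => by simp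
  rw [S.integral_partial1_sq_eq hv, S.solNorm_sq hν hL hH hv hweight,
    S.dataNorm_sq hν hL hH hv hg₁ hg₂.1 hg₂.2 hsource']
  linarith
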